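/- **Conventions.** A \emph{loop} is a set with a binary operation and a two-sided unit $1$ in which, in $xy=z$, any two of $x,y,z$ determine the third. It is a (right) \emph{Bol loop} if $((xy)z)y=x((yz)y)$ for all $x,y,z$; its \emph{exponent} is the least $n\ge 1$ with $x^n=1$ for all $x$. A subloop $N$ is \emph{normal} if $xN=Nx$, $(Nx)y=N(xy)$, $x(yN)=(xy)N$ for all $x,y$; a loop is \emph{simple} if it is nontrivial and has no normal subloops other than $\{1\}$ and itself. A \emph{loop folder} is a triple $(G,H,K)$ of a group $G$, a subgroup $H\le G$ and a set $K\subseteq G$ with $1\in K$ such that $K$ is a set of representatives of the right cosets of every conjugate of $H$; its loop is $(K,\circ)$, where $x\circ y$ is the element of $K$ in $Hxy$. **The group $G$.** Let $G$ be a group with an elementary Abelian normal subgroup $J$ of order $32$ such that $G/J\cong PGL(2,5)$, $J$ is the $\mathbb F_2$-permutation module of $PGL(2,5)$ on the $6$ points of the projective line modulo its center (the constant vectors), $[G,G]/[G,J]\cong SL(2,5)$, and $G$ splits over $[G,G]J$. Put $J_0=[G,J]$, let $P$ be a Sylow $5$-subgroup of $G$, $H=N_G(P)$, and let $c$ be an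 involution in $G\setminus [G,G]J$. Let $\rho:G\to S_5$ be a surjective homomorphism with kernel $J$; then $\rho(H)\cong F_{20}$, the affine group of $\mathbb F_5$. **The module $U$.** Let $N\subset\mathbb F_2^5$ be the $S_5$-module of vectors of coordinate sum zero, and let $U=N\oplus N$, on which even $\sigma\in S_5$ act by $(u_1,u_2)\mapsto(\sigma u_1,\sigma u_2)$ and odd $\sigma$ by $(u_1,u_2)\mapsto(\sigma u_2,\sigma u_1)$. Put $U_1=N\oplus 0$, $U_2=0\oplus N$, $W=\{(n,n): n\in N\}$. Let $S\subset U$ consist of $0$ and of the elements of $W\cup U_1\cup U_2$ whose $A_5$-orbit has length $5$. Let $T$ be a $\rho(H)$-submodule of $U$ with $T\ne 0,U,W$ (there are exactly two of them). **The construction.** Let $k\ge 1$, let $\mathscr U=U^k$, $\mathscr W=W^k$, and $\mathscr G=G\ltimes\mathscr U$, where $G$ acts on $\mathscr U$ through $\rho$. Fix one of the $k$ summands, $U^*\cong U$, and let $W^*,S^*,T^*\subseteq U^*$ correspond to $W,S,T$; let $T^{k-1}$ be the sum of the copies of $T$ in the other $k-1$ summands. Let $\psi:J_0\to T^*$ be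 an isomorphism of $F_{20}$-modules, that is, an $H$-equivariant group isomorphism. Write $J\times\mathscr U$ additively and put $$\mathscr T_\psi=\{v+\psi(v)+u : v\in J_0,\ u\in T^{k-1}\},\qquad \mathscr H=H\ltimes\mathscr T_\psi,$$ $$\widetilde{\mathscr W}=(\mathscr W\setminus W^*)\cup S^*,\qquad \mathscr K=c^{\mathscr G}\cup(J_0+\widetilde{\mathscr W}).$$ **Theorem.** $(\mathscr G,\mathscr H,\mathscr K)$ is a Bol loop folder: it is a loop folder, $\mathscr K\setminus\{1\}$ is a union of conjugacy classes of involutions of $\mathscr G$, and the corresponding loop is a Bol loop. This Bol loop is simple, of exponent $2$ and of order $96\cdot 16^k$. Consequently there are infinitely many finite simple Bol loops of exponent $2$: for every $k\ge1$ there is one of order $96\cdot16^k$. -/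

import Mathlib

open scoped MatrixGroups LinearAlgebra.Projectivization

namespace BolLoops

/-! ### Loops -/

/-- A loop: a binary operation with a two-sided unit such that in `x * y = z` any two of
`x, y, z` determine the third. -/
class Loop (Q : Type*) extends MulOneClass Q where
  existsUnique_right : ∀ a b : Q, ∃! x : Q, a * x = b
  existsUnique_left : ∀ a b : Q, ∃! x : Q, x * a = b

namespace Loop

variable (Q : Type*) [Loop Q]

/-- The right Bol identity. It says `R_y R_z R_y = R_((y z) y)` for the right multiplications. -/
def IsBol : Prop :=
  ∀ x y z : Q, ((x * y) * z) * y = x * ((y * z) * y)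

variable {Q} in
/-- The powers `x ^ n` (in a Bol loop the bracketing does not matter). -/
def npow (x : Q) : ℕ → Q
  | 0 => 1
  | n + 1 => npow x n * x

/-- `n` is the smallest positive integer with `x ^ n = 1` for all `x`. -/
def HasExponent (n : ℕ) : Prop :=
  IsLeast {m : ℕ | 0 < m ∧ ∀ x : Q, npow x m = 1} n

variable {Q} in
/-- A normal subloop: a subset that contains `1`, is closed under the product and both divisions,
and satisfies `x N = N x`, `(N x) y = N (x y)` and `x (y N) = (x y) N`. -/
structure IsNormalSubloop (N : Set Q) : Prop where
  one_mem : (1 : Q) ∈ N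
  mul_mem : ∀ a ∈ N, ∀ b ∈ N, a * b ∈ N
  right_div_mem : ∀ a ∈ N, ∀ x : Q, a * x ∈ N → x ∈ N
  left_div_mem : ∀ a ∈ N, ∀ x : Q, x * a ∈ N → x ∈ N
  comm : ∀ x : Q, (fun n => x * n) '' N = (fun n => n * x) '' N
  assoc_right : ∀ x y : Q, (fun n => (n * x) * y) '' N = (fun n => n * (x * y)) '' N
  assoc_left : ∀ x y : Q, (fun n => x * (y * n)) '' N = (fun n => (x * y) * n) '' N

/-- A simple loop: nontrivial, without normal subloops other than the two trivial ones. -/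
def IsSimple : Prop :=
  Nontrivial Q ∧ ∀ N : Set Q, IsNormalSubloop N → N = {1} ∨ N = Set.univ

end Loop

/-! ### Loop folders -/

section Folder

variable {G : Type*} [Group G] {H : Subgroup G} {K : Set G}

/-- `(G, H, K)` is a loop folder: `1 ∈ K`, and `K` is a set of representatives of the right
cosets of every conjugate of `H`. -/
structure IsLoopFolder (H : Subgroup G) (K : Set G) : Prop where
  one_mem : (1 : G) ∈ K
  transversal : ∀ g : G,
    Subgroup.IsComplement (H.map (MulAut.conj g).toMonoidHom : Set G) K

theorem IsLoopFolder.existsUnique_conj (F : IsLoopFolder H K) (t g : G) :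
    ∃! k : K, t⁻¹ * ((k : G) * g⁻¹) * t ∈ H := by
  obtain ⟨⟨⟨a, ha⟩, k⟩, h1, h2⟩ := (F.transversal t).existsUnique g
  obtain ⟨h, hh, rfl⟩ := ha
  simp only [MulEquiv.coe_toMonoidHom, MulAut.conj_apply] at h1
  refine ⟨k, ?_, ?_⟩
  · have : t⁻¹ * ((k : G) * g⁻¹) * t = h⁻¹ := by rw [← h1]; group
    simpa only [this] using H.inv_mem hh
  · intro k' hk'
    have := h2 ⟨⟨t * (t⁻¹ * ((k' : G) * g⁻¹) * t)⁻¹ * t⁻¹, _, H.inv_mem hk', rfl⟩, k'⟩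
      (by simp only; group)
    exact congrArg Prod.snd this

theorem IsLoopFolder.existsUnique (F : IsLoopFolder H K) (g : G) :
    ∃! k : K, (k : G) * g⁻¹ ∈ H := by
  simpa using F.existsUnique_conj 1 g

/-- The underlying type of the loop of a loop folder is `K`. -/
def IsLoopFolder.Q (_ : IsLoopFolder H K) : Type _ := K

namespace IsLoopFolder

variable (F : IsLoopFolder H K)

/-- The element of `G` underlying an element of the loop. -/
def val (x : F.Q) : G := Subtype.val (p := (· ∈ K)) x

/-- `x ∘ y` is the unique element of `K` in the coset `H x y`. -/
noncomputable def op (x y : F.Q) : F.Q := (F.existsUnique (F.val x * F.val y)).choose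

theorem op_eq_iff (x y z : F.Q) :
    F.op x y = z ↔ F.val z * (F.val x * F.val y)⁻¹ ∈ H := by
  have hs := (F.existsUnique (F.val x * F.val y)).choose_spec
  exact ⟨fun h => h ▸ hs.1, fun h => (hs.2 z h).symm⟩

/-- The loop of a loop folder. -/
noncomputable instance : Loop F.Q where
  mul := F.op
  one := ⟨1, F.one_mem⟩
  one_mul x := (F.op_eq_iff _ _ _).2 (by
    change F.val x * (1 * F.val x)⁻¹ ∈ H
    simp [H.one_mem])
  mul_one x := (F.op_eq_iff _ _ _).2 (by
    change F.val x * (F.val x * 1)⁻¹ ∈ H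
    simp [H.one_mem])
  existsUnique_right a b := by
    have key : ∀ x : F.Q, F.op a x = b ↔
        (F.val a)⁻¹⁻¹ * (F.val x * ((F.val a)⁻¹ * F.val b)⁻¹) * (F.val a)⁻¹ ∈ H := by
      intro x
      rw [F.op_eq_iff, ← H.inv_mem_iff]
      simp [mul_assoc]
    exact (existsUnique_congr (fun x => key x)).2
      (F.existsUnique_conj (F.val a)⁻¹ ((F.val a)⁻¹ * F.val b))
  existsUnique_left a b := by
    have key : ∀ x : F.Q, F.op x a = b ↔ F.val x * (F.val b * (F.val a)⁻¹)⁻¹ ∈ H := by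
      intro x
      rw [F.op_eq_iff, ← H.inv_mem_iff]
      simp [mul_assoc]
    exact (existsUnique_congr (fun x => key x)).2 (F.existsUnique (F.val b * (F.val a)⁻¹))

end IsLoopFolder

/-- `K` consists of `1` and a union of conjugacy classes of involutions of `G`. -/
def IsUnionOfInvolutionClasses (K : Set G) : Prop :=
  ∃ 𝒞 : Set G, (∀ a ∈ 𝒞, orderOf a = 2) ∧ K = {1} ∪ ⋃ a ∈ 𝒞, conjugatesOf a

end Folder

/-! ### The group `G` -/

instance : Fact (Nat.Prime 5) := ⟨Nat.prime_five⟩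

/-- `G` has the elementary Abelian normal subgroup `J` of order `32`, `G ⧸ J ≅ PGL(2, 5)` and `J` is
the `𝔽₂`-permutation module of `PGL(2, 5)` on the projective line modulo its center (the constant
functions); moreover `[G, G] ⧸ [G, J] ≅ SL(2, 5)` and `G` splits over `[G, G] J`. -/
structure IsNonsplitS5Extension {G : Type*} [Group G] (J : Subgroup G) : Prop where
  normal : J.Normal
  card : Nat.card J = 32
  comm : ∀ x ∈ J, ∀ y ∈ J, x * y = y * x
  sq : ∀ x ∈ J, x ^ 2 = 1
  perm_module : ∃ π : G →* PGL(2, ZMod 5), Function.Surjective π ∧ π.ker = J ∧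
    ∃ f : (ℙ (ZMod 5) (Fin 2 → ZMod 5) → ZMod 2) →+ Additive J, Function.Surjective f ∧
      (∀ v, f v = 0 ↔ ∃ a, ∀ p, v p = a) ∧
      ∀ (g : G) (v : ℙ (ZMod 5) (Fin 2 → ZMod 5) → ZMod 2),
        ((f (fun p => v ((π g)⁻¹ • p))).toMul : G) = g * ((f v).toMul : G) * g⁻¹
  quotient_SL : ∃ q : commutator G →* SL(2, ZMod 5), Function.Surjective q ∧
    q.ker = (⁅(⊤ : Subgroup G), J⁆).subgroupOf (commutator G)
  splits : ∃ C : Subgroup G, Subgroup.IsComplement' (commutator G ⊔ J) C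

/-- The subgroup `J₀ = [G, J]`. -/
abbrev J₀ {G : Type*} [Group G] (J : Subgroup G) : Subgroup G := ⁅(⊤ : Subgroup G), J⁆

/-! ### The `S₅`-module `U` -/

/-- The `4`-dimensional irreducible component `N` of the permutation module of `S₅` on `5` points:
the vectors of coordinate sum zero. -/
def N : Submodule (ZMod 2) (Fin 5 → ZMod 2) where
  carrier := {v | ∑ x, v x = 0}
  add_mem' := by
    intro a b ha hb
    simp only [Set.mem_ofPred_eq] at *
    simp [Finset.sum_add_distrib, ha, hb]
  zero_mem' := by simp
  smul_mem' := by
    intro r a ha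
    simp only [Set.mem_ofPred_eq] at *
    simp [← Finset.mul_sum, ha]

/-- `S₅` permutes the coordinates of the vectors in `N`. -/
instance : DistribMulAction (Equiv.Perm (Fin 5)) N where
  smul σ v := ⟨fun x => v.1 (σ⁻¹ x), by
    have := Equiv.sum_comp σ⁻¹ v.1
    exact this.trans v.2⟩
  one_smul v := rfl
  mul_smul σ τ v := by
    apply Subtype.ext
    funext x
    change v.1 ((σ * τ)⁻¹ x) = v.1 (τ⁻¹ (σ⁻¹ x))
    rw [mul_inv_rev]
    rfl
  smul_zero σ := rfl
  smul_add σ v w := rfl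

/-- The underlying space of the `8`-dimensional module `U`, the sum of two copies of `N`. -/
def U : Type := N × N

namespace U

instance : AddCommGroup U := inferInstanceAs (AddCommGroup (N × N))

instance : Module (ZMod 2) U := inferInstanceAs (Module (ZMod 2) (N × N))

/-- An even permutation acts on both copies of `N`; an odd permutation acts on both copies and
interchanges them. -/
instance : SMul (Equiv.Perm (Fin 5)) U where
  smul σ u := if Equiv.Perm.sign σ = 1 then (σ • u.1, σ • u.2) else (σ • u.2, σ • u.1)

theorem smul_fst (σ : Equiv.Perm (Fin 5)) (u : U) :
    (σ • u).1 = σ • (if Equiv.Perm.sign σ = 1 then u.1 else u.2) := by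
  change Prod.fst (if _ then _ else _) = _
  split_ifs <;> rfl

theorem smul_snd (σ : Equiv.Perm (Fin 5)) (u : U) :
    (σ • u).2 = σ • (if Equiv.Perm.sign σ = 1 then u.2 else u.1) := by
  change Prod.snd (if _ then _ else _) = _
  split_ifs <;> rfl

instance : DistribMulAction (Equiv.Perm (Fin 5)) U where
  one_smul u := by
    apply Prod.ext <;> simp [smul_fst, smul_snd]
  mul_smul σ τ u := by
    rcases Int.units_eq_one_or (Equiv.Perm.sign σ) with h | h <;>
      rcases Int.units_eq_one_or (Equiv.Perm.sign τ) with h' | h' <;>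
      apply Prod.ext <;> simp [smul_fst, smul_snd, h, h', mul_smul]
  smul_zero σ := by
    have h1 : (0 : U).1 = 0 := rfl
    have h2 : (0 : U).2 = 0 := rfl
    apply Prod.ext <;> simp [smul_fst, smul_snd, h1, h2]
  smul_add σ u w := by
    have h1 (a b : U) : (a + b).1 = a.1 + b.1 := rfl
    have h2 (a b : U) : (a + b).2 = a.2 + b.2 := rfl
    apply Prod.ext <;> simp only [smul_fst, smul_snd, h1, h2] <;> split_ifs <;> simp

/-- The submodule `U₁ = N ⊕ 0`. -/
def U₁ : Submodule (ZMod 2) U where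
  carrier := {u | u.2 = 0}
  add_mem' := by
    intro a b (ha : a.2 = 0) (hb : b.2 = 0)
    change a.2 + b.2 = 0
    rw [ha, hb, add_zero]
  zero_mem' := rfl
  smul_mem' := by
    intro r a (ha : a.2 = 0)
    change r • a.2 = 0
    rw [ha, smul_zero]

/-- The submodule `U₂ = 0 ⊕ N`. -/
def U₂ : Submodule (ZMod 2) U where
  carrier := {u | u.1 = 0}
  add_mem' := by
    intro a b (ha : a.1 = 0) (hb : b.1 = 0)
    change a.1 + b.1 = 0
    rw [ha, hb, add_zero]
  zero_mem' := rfl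
  smul_mem' := by
    intro r a (ha : a.1 = 0)
    change r • a.1 = 0
    rw [ha, smul_zero]

/-- The submodule `W = {(n, n) | n ∈ N}`, the only proper nonzero `S₅`-submodule of `U`. -/
def W : Submodule (ZMod 2) U where
  carrier := {u | u.1 = u.2}
  add_mem' := by
    intro a b (ha : a.1 = a.2) (hb : b.1 = b.2)
    change a.1 + b.1 = a.2 + b.2
    rw [ha, hb]
  zero_mem' := rfl
  smul_mem' := by
    intro r a (ha : a.1 = a.2)
    change r • a.1 = r • a.2
    rw [ha]

/-- The `A₅`-orbit of `u`. -/
def altOrbit (u : U) : Set U := {w | ∃ σ ∈ alternatingGroup (Fin 5), w = σ • u}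

/-- The nonlinear complement `S`: zero together with the `A₅`-orbits of length `5` in `W`, `U₁`
and `U₂`. -/
def S : Set U :=
  {u | u = 0 ∨ ((u ∈ W ∨ u ∈ U₁ ∨ u ∈ U₂) ∧ (altOrbit u).ncard = 5)}

end U

/-! ### The group `𝓖 = G ⋉ U ^ k` and its subsets -/

section Construction

variable {G : Type*} [Group G] (ρ : G →* Equiv.Perm (Fin 5)) (k : ℕ)

/-- The action of `G` on `U ^ k` through `ρ : G → S₅`. -/
def act : G →* MulAut (Multiplicative (Fin k → U)) :=
  MonoidHom.mk'
    (fun g =>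
      { toFun := fun v => Multiplicative.ofAdd (ρ g • v.toAdd)
        invFun := fun v => Multiplicative.ofAdd ((ρ g)⁻¹ • v.toAdd)
        left_inv := fun v => by simp
        right_inv := fun v => by simp
        map_mul' := fun v w => by simp })
    (fun g h => by
      ext v
      simp [mul_smul])

/-- The group `𝓖 = G ⋉ U ^ k`. -/
abbrev BigGroup : Type _ := Multiplicative (Fin k → U) ⋊[act ρ k] G

variable {ρ k}

theorem J₀_le_ker {J : Subgroup G} (hρ : ρ.ker = J) : J₀ J ≤ ρ.ker := by
  subst hρ
  exact Subgroup.commutator_le_right _ _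

/-- The subgroup `𝓣_ψ = {v + ψ(v) + u | v ∈ J₀, u ∈ T ^ (k - 1)}` of `𝓖`, where `ψ` takes its values
in the `i`-th copy of `T` and `T ^ (k - 1)` is the sum of the other copies. -/
def twistedT {J : Subgroup G} (hρ : ρ.ker = J) (i : Fin k) {T : Submodule (ZMod 2) U}
    (ψ : Additive (J₀ J) ≃+ T) : Subgroup (BigGroup ρ k) where
  carrier := {g | ∃ v : J₀ J, g.right = v ∧ ∃ u : Fin k → U, (∀ j, u j ∈ T) ∧ u i = 0 ∧
    g.left.toAdd = Pi.single i (ψ (Additive.ofMul v) : U) + u}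
  one_mem' := ⟨1, rfl, 0, fun _ => T.zero_mem, rfl, by simp⟩
  mul_mem' := by
    rintro a b ⟨v, hv, u, hu, hui, ha⟩ ⟨w, hw, u', hu', hui', hb⟩
    have hρa : ρ a.right = 1 := by rw [hv]; exact J₀_le_ker hρ v.2
    refine ⟨v * w, by simp [hv, hw], u + u', fun j => T.add_mem (hu j) (hu' j), by simp [hui, hui'],
      ?_⟩
    have : (a * b).left.toAdd = a.left.toAdd + b.left.toAdd := by
      simp [act, hρa]
    rw [this, ha, hb, ofMul_mul, map_add, Submodule.coe_add, Pi.single_add]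
    abel
  inv_mem' := by
    rintro a ⟨v, hv, u, hu, hui, ha⟩
    have hρa : ρ a.right = 1 := by rw [hv]; exact J₀_le_ker hρ v.2
    refine ⟨v⁻¹, by simp [hv], -u, fun j => T.neg_mem (hu j), by simp [hui], ?_⟩
    have : (a⁻¹).left.toAdd = - a.left.toAdd := by
      simp [act, hρa]
    rw [this, ha, ofMul_inv, map_neg, Submodule.coe_neg, Pi.single_neg]
    abel

/-- The subgroup `𝓗 = H ⋉ 𝓣_ψ` of `𝓖`, generated by `H ≤ G` and `𝓣_ψ`. -/
def bigH (H : Subgroup G) {J : Subgroup G} (hρ : ρ.ker = J) (i : Fin k)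
    {T : Submodule (ZMod 2) U} (ψ : Additive (J₀ J) ≃+ T) : Subgroup (BigGroup ρ k) :=
  H.map SemidirectProduct.inr ⊔ twistedT hρ i ψ

/-- `(𝓦 \ W*) ∪ S*` in `U ^ k`, where `𝓦 = W ^ k` and `W*`, `S*` are the copies of `W` and `S` in the
`i`-th summand. -/
def tildeW (i : Fin k) : Set (Fin k → U) :=
  ({w | ∀ j, w j ∈ U.W} \ Pi.single i '' (U.W : Set U)) ∪ Pi.single i '' U.S

variable (ρ) in
/-- The set `𝓚 = c^𝓖 ∪ (J₀ + ((𝓦 \ W*) ∪ S*))`. -/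
def bigK (c : G) (J : Subgroup G) (i : Fin k) : Set (BigGroup ρ k) :=
  conjugatesOf (SemidirectProduct.inr c) ∪
    {g | ∃ v ∈ J₀ J, ∃ w ∈ tildeW i,
      g = SemidirectProduct.inr v * SemidirectProduct.inl (Multiplicative.ofAdd w)}

end Construction

end BolLoops

open scoped MatrixGroups LinearAlgebra.Projectivization
namespace BolLoops

/-! ### The action of `S₅` on its six Sylow `5`-subgroups -/

/-! The group `J` is `𝔽₂ ^ 6` modulo constants, its subgroup `J₀` consists of the even vectors, and
the points of the projective line are the six Sylow `5`-subgroups of `S₅` (`exists_equiv_fin_six`,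
`IsNonsplitS5Extension.nonempty_extData`). Thus statements about `G` become statements about `S₅`,
`𝔽₂ ^ 6` and `U`, which are finite checks.

Folder. `|𝓖| = 3840 · 256 ^ k = (40 · 16 ^ k)(96 · 16 ^ k)`, and the two factors bound `|𝓗|` and
`|𝓚|` from below. As `𝓚` is invariant under conjugation, it is enough that `x y⁻¹ ∈ 𝓗` forces `x =
y` for `x, y ∈ 𝓚` (`IsTwist.injective`, `IsTwist.card_eq`). The class `c^𝓖` is the set of all
involutions over odd permutations (`conjugatesOf_inr_of_odd`). If `x, y` are two of these and `s = x
y ∈ 𝓗`, then `s²` lies over `1` and commutes with `x`. A transposition fixes no nonzero vector of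
`T`, so `s² = 1`. Since `-1` is the only involution of `SL(2, 5)`, `s` itself lies over `1`, and the
same argument gives `s = 1`. An odd involution and an element of `J₀ + ((𝓦 \ W*) ∪ S*)` are never in
one coset because `F₂₀` contains no transposition. For two elements of the latter set, `T` is a
complement both to `W` and to the nonlinear set `S`, and `ψ` is injective.

Bol identity. `𝓚` consists of `1` and involutions and is closed under conjugation, hence under `z ↦
y z y` (`IsLoopFolder.isBol`).

Simplicity. A normal subloop yields a normal subgroup `M` such that, for `x, y ∈ 𝓚`, `x y⁻¹ ∈ 𝓗 M`
implies `x y⁻¹ ∈ M` (`IsLoopFolder.exists_normal`). Suppose that `M` contains a nontrivial element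
of `𝓚`. If this is a vector of `U ^ k`, then `M` contains a nonzero vector of `W ^ k`. Some `s ∈ S \
W` has a nonzero component `t` in `T`, which `𝓗` ties to `ψ⁻¹(t) ∈ J₀`; this puts an element with
nontrivial `J₀`-component into `M` (`IsTwist.exists_even_of_mem_W`). An element of the group algebra
of `A₅` kills `U` but not `J₀`, so `J₀ ≤ M` (`even_mem_moduleOf`). Then `M` successively contains
`J`, a preimage of `A₅`, and `c` (`IsTwist.odd_mem_of_even_mem`), and the odd involutions generate
`𝓖` (`eq_top_of_odd_mem`).

Existence. A group `G` is realized by affine maps of `(ℤ/4) ^ 4` whose linear parts come from a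
double cover of `S₅` and which permute six points modulo `2`. -/

/-- The six `5`-cycles that send `0` to `1`, one in each Sylow `5`-subgroup of `S₅`. -/
def fiveCycle : Fin 6 → Equiv.Perm (Fin 5) :=
  ![c[0, 1, 2, 3, 4], c[0, 1, 2, 4, 3], c[0, 1, 3, 2, 4], c[0, 1, 3, 4, 2], c[0, 1, 4, 2, 3],
    c[0, 1, 4, 3, 2]]

/-- The number of the Sylow `5`-subgroup that contains a given `5`-cycle. -/
def sylowIndex (σ : Equiv.Perm (Fin 5)) : Fin 6 :=
  -- The default `0` concerns only permutations that are not `5`-cycles, to which the lemmas below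
  -- do not apply.
  ((List.finRange 6).find? fun j =>
    σ ∈ [fiveCycle j, fiveCycle j ^ 2, fiveCycle j ^ 3, fiveCycle j ^ 4]).getD 0

theorem fiveCycle_pow_five (i : Fin 6) : fiveCycle i ^ 5 = 1 := by
  revert i; decide +kernel

theorem fiveCycle_ne_one (i : Fin 6) : fiveCycle i ≠ 1 := by
  revert i; decide +kernel

theorem exists_fiveCycle_pow (σ : Equiv.Perm (Fin 5)) (h : σ ^ 5 = 1) (h1 : σ ≠ 1) :
    ∃ k : Fin 4, fiveCycle (sylowIndex σ) ^ (k.val + 1) = σ := by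
  revert σ; decide +kernel

theorem sylowIndex_fiveCycle_pow (i : Fin 6) (k : Fin 4) :
    sylowIndex (fiveCycle i ^ (k.val + 1)) = i := by
  revert i k; decide +kernel

theorem sylowIndex_pow (σ : Equiv.Perm (Fin 5)) (k : Fin 4) (h : σ ^ 5 = 1) (h1 : σ ≠ 1) :
    sylowIndex (σ ^ (k.val + 1)) = sylowIndex σ := by
  revert σ k; decide +kernel

theorem exists_pow_fiveCycle_pow (i : Fin 6) (k : Fin 4) :
    ∃ m : Fin 5, (fiveCycle i ^ (k.val + 1)) ^ m.val = fiveCycle i := by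
  revert i k; decide +kernel

theorem conj_fiveCycle_pow_five (σ : Equiv.Perm (Fin 5)) (i : Fin 6) :
    (σ * fiveCycle i * σ⁻¹) ^ 5 = 1 := by
  rw [conj_pow, fiveCycle_pow_five]; simp

theorem conj_fiveCycle_ne_one (σ : Equiv.Perm (Fin 5)) (i : Fin 6) :
    σ * fiveCycle i * σ⁻¹ ≠ 1 := by
  intro h
  exact fiveCycle_ne_one i (conj_eq_one_iff.1 h)

/-- The action of `S₅` on its six Sylow `5`-subgroups. -/
def act6 : Equiv.Perm (Fin 5) →* Equiv.Perm (Fin 6) :=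
  MonoidHom.toHomPerm
    { toFun := fun σ i => sylowIndex (σ * fiveCycle i * σ⁻¹)
      map_one' := by
        funext i
        change sylowIndex (1 * fiveCycle i * 1⁻¹) = i
        simpa using sylowIndex_fiveCycle_pow i 0
      map_mul' := by
        intro σ τ
        funext i
        obtain ⟨k, hk⟩ := exists_fiveCycle_pow _ (conj_fiveCycle_pow_five τ i)
          (conj_fiveCycle_ne_one τ i)
        have : σ * τ * fiveCycle i * (σ * τ)⁻¹ =
            (σ * fiveCycle (sylowIndex (τ * fiveCycle i * τ⁻¹)) * σ⁻¹) ^ (k.val + 1) := by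
          rw [conj_pow, hk]; group
        rw [this]
        exact sylowIndex_pow _ k (conj_fiveCycle_pow_five σ _) (conj_fiveCycle_ne_one σ _) }

theorem act6_apply (σ : Equiv.Perm (Fin 5)) (i : Fin 6) :
    act6 σ i = sylowIndex (σ * fiveCycle i * σ⁻¹) := rfl

theorem exists_conj_fiveCycle (σ : Equiv.Perm (Fin 5)) (i : Fin 6) :
    ∃ k : Fin 4, fiveCycle (act6 σ i) ^ (k.val + 1) = σ * fiveCycle i * σ⁻¹ :=
  exists_fiveCycle_pow _ (conj_fiveCycle_pow_five σ i) (conj_fiveCycle_ne_one σ i)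

theorem act6_transitive (i j : Fin 6) : ∃ σ, act6 σ i = j := by
  revert i j; decide +kernel

/-- Distinct Sylow `5`-subgroups meet trivially, so their product set has 25 elements. A subgroup of
order 20 therefore contains only one of them. -/
theorem fiveCycle_mul_injective (i j : Fin 6) (h : i ≠ j) :
    Function.Injective fun a : Fin 5 × Fin 5 => fiveCycle i ^ a.1.val * fiveCycle j ^ a.2.val := by
  revert i j; decide +kernel

theorem fiveCycle_index_unique {A : Subgroup (Equiv.Perm (Fin 5))} (hA : Nat.card A = 20)
    {i j : Fin 6} (hi : fiveCycle i ∈ A) (hj : fiveCycle j ∈ A) : i = j := by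
  by_contra h
  have hinj := fiveCycle_mul_injective i j h
  have := Nat.card_le_card_of_injective
    (fun a : Fin 5 × Fin 5 => (⟨fiveCycle i ^ a.1.val * fiveCycle j ^ a.2.val,
      A.mul_mem (A.pow_mem hi _) (A.pow_mem hj _)⟩ : A))
    (fun a b hab => hinj (congrArg Subtype.val hab))
  rw [hA] at this
  simp at this

/-- A transitive action on six points of a group over `S₅` is the action on the six Sylow
`5`-subgroups of `S₅`. -/
theorem exists_equiv_fin_six {G X : Type*} [Group G] [MulAction G X] [MulAction.IsPretransitive G X]
    (hX : Nat.card X = 6) (ρ : G →* Equiv.Perm (Fin 5)) (hρ : Function.Surjective ρ)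
    (hker : ∀ g, ρ g = 1 → ∀ x : X, g • x = x) :
    ∃ ε : X ≃ Fin 6, ∀ g x, ε (g • x) = act6 (ρ g) (ε x) := by
  have hcard : ∀ x : X, Nat.card ((MulAction.stabilizer G x).map ρ) = 20 := by
    intro x
    have h1 : ((MulAction.stabilizer G x).map ρ).index = 6 := by
      rw [Subgroup.index_map, MonoidHom.range_eq_top.2 hρ, Subgroup.index_top, mul_one,
        sup_eq_left.2 (fun g hg => hker g hg x), MulAction.index_stabilizer_of_transitive, hX]
    have h2 := ((MulAction.stabilizer G x).map ρ).card_mul_index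
    rw [h1, Nat.card_eq_fintype_card (α := Equiv.Perm (Fin 5)), Fintype.card_perm,
      Fintype.card_fin] at h2
    have h3 : Nat.factorial 5 = 20 * 6 := rfl
    rw [h3] at h2
    exact Nat.eq_of_mul_eq_mul_right (by norm_num) h2
  have hex : ∀ x : X, ∃ i, fiveCycle i ∈ (MulAction.stabilizer G x).map ρ := by
    intro x
    obtain ⟨⟨y, hy⟩, h5⟩ := exists_prime_orderOf_dvd_card' (G := (MulAction.stabilizer G x).map ρ) 5
      (by rw [hcard]; norm_num)
    rw [Subgroup.orderOf_mk] at h5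
    have hy5 : y ^ 5 = 1 := orderOf_dvd_iff_pow_eq_one.1 h5.dvd
    have hy1 : y ≠ 1 := by rintro rfl; simp at h5
    obtain ⟨k, hk⟩ := exists_fiveCycle_pow y hy5 hy1
    obtain ⟨m, hm⟩ := exists_pow_fiveCycle_pow (sylowIndex y) k
    exact ⟨sylowIndex y, by rw [← hm, hk]; exact Subgroup.pow_mem _ hy _⟩
  -- A point is labelled by the unique Sylow `5`-subgroup in the image of its stabilizer. Uniqueness
  -- makes the labelling equivariant.
  choose e he using hex
  have heq : ∀ g x, e (g • x) = act6 (ρ g) (e x) := by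
    intro g x
    refine fiveCycle_index_unique (hcard (g • x)) (he _) ?_
    obtain ⟨k, hk⟩ := exists_conj_fiveCycle (ρ g) (e x)
    obtain ⟨m, hm⟩ := exists_pow_fiveCycle_pow (act6 (ρ g) (e x)) k
    rw [← hm, hk]
    refine Subgroup.pow_mem _ ?_ _
    obtain ⟨s, hs, hs'⟩ := he x
    refine ⟨g * s * g⁻¹, ?_, by simp [hs']⟩
    have hs : s • x = x := hs
    simp [MulAction.mem_stabilizer_iff, mul_smul, hs]
  have hsurj : Function.Surjective e := by
    intro j
    have : Nonempty X := by
      by_contra h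
      rw [not_nonempty_iff] at h
      simp at hX
    obtain ⟨x⟩ := this
    obtain ⟨σ, hσ⟩ := act6_transitive (e x) j
    obtain ⟨g, rfl⟩ := hρ σ
    exact ⟨g • x, by rw [heq, hσ]⟩
  have : Finite X := Nat.finite_of_card_ne_zero (by rw [hX]; norm_num)
  refine ⟨Equiv.ofBijective e (hsurj.bijective_of_nat_card_le (by simp [hX])), heq⟩

end BolLoops
namespace BolLoops

/-! ### A model of the extension over `S₅` -/

theorem card_projectiveLine : Nat.card (ℙ (ZMod 5) (Fin 2 → ZMod 5)) = 6 := by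
  rw [Projectivization.card_of_finrank_two (ZMod 5) (Fin 2 → ZMod 5) (by simp)]
  simp

instance : MulAction.IsPretransitive PGL(2, ZMod 5) (ℙ (ZMod 5) (Fin 2 → ZMod 5)) := by
  have h : MulAction.IsPretransitive SL(2, ZMod 5) (ℙ (ZMod 5) (Fin 2 → ZMod 5)) :=
    MulAction.isPretransitive_of_is_two_pretransitive
  refine ⟨fun x y => ?_⟩
  obtain ⟨s, rfl⟩ := h.exists_smul_eq x y
  refine ⟨Matrix.ProjGenLinGroup.mk (Matrix.SpecialLinearGroup.toGL s), ?_⟩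
  induction x using Projectivization.ind with
  | h v hv => rfl

/-- It suffices to commute with three 3-cycles that generate `A₅`. -/
theorem alternating_center (σ : Equiv.Perm (Fin 5))
    (h : ∀ τ : Equiv.Perm (Fin 5), Equiv.Perm.sign τ = 1 → σ * τ = τ * σ) : σ = 1 := by
  have : σ * c[0, 1, 2] = c[0, 1, 2] * σ ∧ σ * c[1, 2, 3] = c[1, 2, 3] * σ ∧
      σ * c[2, 3, 4] = c[2, 3, 4] * σ :=
    ⟨h _ (by decide +kernel), h _ (by decide +kernel), h _ (by decide +kernel)⟩
  clear h
  revert σ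
  decide +kernel

/-- Such a matrix equals its adjugate, so in odd characteristic it is scalar. That `-1` is the only
involution is the source of `ExtData.sq_mem`. -/
theorem SL_sq_eq_one (A : SL(2, ZMod 5)) (h : A * A = 1) : A = 1 ∨ A = -1 := by
  have h1 : A = A⁻¹ := eq_inv_of_mul_eq_one_left h
  have h2 : (A : Matrix (Fin 2) (Fin 2) (ZMod 5)) = Matrix.adjugate A := by
    rw [← Matrix.SpecialLinearGroup.coe_inv, ← h1]
  have h3 := A.det_coe
  rw [Matrix.adjugate_fin_two] at h2
  rw [Matrix.det_fin_two] at h3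
  have h00 := congrFun (congrFun h2 0) 0
  have h01 := congrFun (congrFun h2 0) 1
  have h10 := congrFun (congrFun h2 1) 0
  simp only [Matrix.of_apply, Matrix.cons_val', Matrix.cons_val_zero, Matrix.cons_val_one,
    Matrix.empty_val', Matrix.cons_val_fin_one] at h00 h01 h10
  have key : ∀ a b c d : ZMod 5, a * d - b * c = 1 → a = d → b = -b → c = -c →
      (a = 1 ∧ b = 0 ∧ c = 0 ∧ d = 1) ∨ (a = -1 ∧ b = 0 ∧ c = 0 ∧ d = -1) := by decide +kernel
  rcases key _ _ _ _ h3 h00 h01 h10 with ⟨ha, hb, hc, hd⟩ | ⟨ha, hb, hc, hd⟩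
  · left; ext i j; fin_cases i <;> fin_cases j <;> simp [ha, hb, hc, hd]
  · right; ext i j; fin_cases i <;> fin_cases j <;> simp [ha, hb, hc, hd]

/-- The data of the extension `G` of `S₅` by the permutation module of degree `6` modulo constants
that the construction uses. -/
structure ExtData {G : Type*} [Group G] (J : Subgroup G) (ρ : G →* Equiv.Perm (Fin 5)) where
  surj : Function.Surjective ρ
  ker : ρ.ker = J
  card_J : Nat.card J = 32
  j : (Fin 6 → ZMod 2) → G
  j_add : ∀ v w, j (v + w) = j v * j w
  j_eq_one : ∀ v, j v = 1 ↔ ∃ a, ∀ p, v p = a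
  j_conj : ∀ g v, g * j v * g⁻¹ = j (fun p => v ((act6 (ρ g))⁻¹ p))
  mem_ker : ∀ x, ρ x = 1 ↔ ∃ v, j v = x
  mem_J₀ : ∀ x, x ∈ J₀ J ↔ ∃ v, ∑ p, v p = 0 ∧ j v = x
  sq_mem : ∀ g, Equiv.Perm.sign (ρ g) = 1 → g * g ∈ J₀ J → ρ g = 1
  mem_iff : ∀ g, g ∈ commutator G ⊔ J ↔ Equiv.Perm.sign (ρ g) = 1

theorem even_eq_sum (v : Fin 6 → ZMod 2) (h : ∑ p, v p = 0) :
    v = ∑ p, v p • (Pi.single p 1 + Pi.single 0 1 : Fin 6 → ZMod 2) := by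
  revert v; decide +kernel

/-- The commutator subgroup with the whole group of a quotient of the permutation module consists
of the images of the even vectors. -/
theorem mem_commutator_iff_even {G : Type*} [Group G] {J : Subgroup G}
    {ρ : G →* Equiv.Perm (Fin 5)} (hρ : Function.Surjective ρ) {j : (Fin 6 → ZMod 2) → G}
    (j_add : ∀ v w, j (v + w) = j v * j w)
    (j_conj : ∀ g v, g * j v * g⁻¹ = j (fun p => v ((act6 (ρ g))⁻¹ p)))
    (mem_J : ∀ x, x ∈ J ↔ ∃ v, j v = x) (x : G) :
    x ∈ J₀ J ↔ ∃ v, ∑ p, v p = 0 ∧ j v = x := by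
  have j_zero : j 0 = 1 := by
    have := j_add 0 0
    rw [add_zero] at this
    exact left_eq_mul.1 this
  have hself : ∀ v : Fin 6 → ZMod 2, v + v = 0 := fun v => CharTwo.add_self_eq_zero v
  have j_inv : ∀ v, (j v)⁻¹ = j v := fun v => inv_eq_of_mul_eq_one_left (by
    rw [← j_add, hself, j_zero])
  constructor
  · let E : Subgroup G :=
      { carrier := {x | ∃ v, ∑ p, v p = 0 ∧ j v = x}
        one_mem' := ⟨0, by simp, j_zero⟩
        mul_mem' := by
          rintro _ _ ⟨v, hv, rfl⟩ ⟨w, hw, rfl⟩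
          exact ⟨v + w, by simp [Finset.sum_add_distrib, hv, hw], j_add v w⟩
        inv_mem' := by
          rintro _ ⟨v, hv, rfl⟩
          exact ⟨v, hv, (j_inv v).symm⟩ }
    suffices h : J₀ J ≤ E from fun hx => h hx
    rw [Subgroup.commutator_le]
    intro g _ y hy
    obtain ⟨v, rfl⟩ := (mem_J y).1 hy
    refine ⟨(fun p => v ((act6 (ρ g))⁻¹ p)) + v, ?_, ?_⟩
    · simp only [Pi.add_apply, Finset.sum_add_distrib]
      rw [Equiv.sum_comp (act6 (ρ g))⁻¹ v]
      exact CharTwo.add_self_eq_zero _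
    · rw [j_add, ← j_conj, commutatorElement_def, j_inv]
  · rintro ⟨v, hv, rfl⟩
    let E : AddSubgroup (Fin 6 → ZMod 2) :=
      { carrier := {v | j v ∈ J₀ J}
        zero_mem' := by
          change j 0 ∈ J₀ J
          rw [j_zero]; exact Subgroup.one_mem _
        add_mem' := by
          intro v w hv hw
          change j (v + w) ∈ J₀ J
          rw [j_add]; exact Subgroup.mul_mem _ hv hw
        neg_mem' := by
          intro v hv
          change j (-v) ∈ J₀ J
          rw [neg_eq_of_add_eq_zero_left (hself v)]; exact hv }
    -- `e_p + e_0` is the commutator of `e_0` with an element that moves the point `0` to `p`.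
    have hE : ∀ p, (Pi.single p 1 + Pi.single 0 1 : Fin 6 → ZMod 2) ∈ E := by
      intro p
      obtain ⟨σ, hσ⟩ := act6_transitive 0 p
      obtain ⟨g, rfl⟩ := hρ σ
      have : (Pi.single p 1 : Fin 6 → ZMod 2) =
          fun q => (Pi.single 0 1 : Fin 6 → ZMod 2) ((act6 (ρ g))⁻¹ q) := by
        funext q
        simp only [Pi.single_apply, ← hσ]
        congr 1
        rw [Equiv.Perm.inv_eq_iff_eq]
      change j _ ∈ J₀ J
      rw [j_add, this, ← j_conj, ← j_inv (Pi.single 0 1)]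
      have := Subgroup.commutator_mem_commutator (Subgroup.mem_top g)
        ((mem_J _).2 ⟨(Pi.single 0 1), rfl⟩)
      rw [commutatorElement_def] at this
      simpa [j_inv] using this
    change v ∈ E
    rw [even_eq_sum v hv]
    refine E.sum_mem fun p _ => ?_
    have : v p = 0 ∨ v p = 1 := by
      generalize v p = a; revert a; decide
    rcases this with h | h
    · rw [h, zero_smul]; exact E.zero_mem
    · rw [h, one_smul]; exact hE p

/-- The decisive point is a preimage `s ∈ [G, G]` of `-1 ∈ SL(2, 5)`: it is central modulo `J₀`, so
its image in `S₅` centralizes `A₅` and is trivial. Hence `s ∈ J \ J₀`, which gives `J ≤ [G, G]`, and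
`[G, G]` is the full preimage of `A₅`. If `g` is even and `g² ∈ J₀`, then `g` maps to `±1`, so `g`
or `g s` lies in `J₀`. -/
theorem IsNonsplitS5Extension.nonempty_extData {G : Type*} [Group G] {J : Subgroup G}
    (hG : IsNonsplitS5Extension J) {ρ : G →* Equiv.Perm (Fin 5)} (hρ : Function.Surjective ρ)
    (hker : ρ.ker = J) : Nonempty (ExtData J ρ) := by
  obtain ⟨π, hπ, hπJ, f, hf, hf0, hfc⟩ := hG.perm_module
  obtain ⟨q, hq, hqker⟩ := hG.quotient_SL
  let _ : MulAction G (ℙ (ZMod 5) (Fin 2 → ZMod 5)) := MulAction.compHom _ π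
  have hsm : ∀ (g : G) (x : ℙ (ZMod 5) (Fin 2 → ZMod 5)), g • x = π g • x := fun _ _ => rfl
  have _ : MulAction.IsPretransitive G (ℙ (ZMod 5) (Fin 2 → ZMod 5)) := by
    refine ⟨fun x y => ?_⟩
    obtain ⟨s, hs⟩ := MulAction.exists_smul_eq PGL(2, ZMod 5) x y
    obtain ⟨g, rfl⟩ := hπ s
    exact ⟨g, hs⟩
  obtain ⟨ε, hε⟩ := exists_equiv_fin_six card_projectiveLine ρ hρ (by
    intro g hg x
    have : g ∈ π.ker := by rw [hπJ, ← hker]; exact hg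
    rw [hsm, MonoidHom.mem_ker.1 this, one_smul])
  let j : (Fin 6 → ZMod 2) → G := fun v => ((f fun x => v (ε x)).toMul : G)
  have j_add : ∀ v w, j (v + w) = j v * j w := by
    intro v w
    have : (fun x => (v + w) (ε x)) = (fun x => v (ε x)) + fun x => w (ε x) := rfl
    simp only [j]
    rw [this, map_add]
    rfl
  have j_conj : ∀ g v, g * j v * g⁻¹ = j (fun p => v ((act6 (ρ g))⁻¹ p)) := by
    intro g v
    simp only [j]
    rw [← hfc]
    have : ∀ p, ε ((π g)⁻¹ • p) = (act6 (ρ g))⁻¹ (ε p) := by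
      intro p
      rw [← map_inv, ← hsm, hε, map_inv, map_inv]
    simp only [this]
  have mem_J : ∀ x, x ∈ J ↔ ∃ v, j v = x := by
    intro x
    constructor
    · intro hx
      obtain ⟨u, hu⟩ := hf (Additive.ofMul ⟨x, hx⟩)
      refine ⟨fun p => u (ε.symm p), ?_⟩
      simp only [j, Equiv.symm_apply_apply]
      rw [hu]; rfl
    · rintro ⟨v, rfl⟩
      exact (f fun x => v (ε x)).toMul.2
  have mem_ker : ∀ x, ρ x = 1 ↔ ∃ v, j v = x := fun x => by
    rw [← mem_J, ← hker, MonoidHom.mem_ker]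
  have mem_J₀ := mem_commutator_iff_even hρ j_add j_conj mem_J
  have hcomm : (commutator G).map ρ = alternatingGroup (Fin 5) := by
    rw [commutator_def, Subgroup.map_commutator, ← MonoidHom.range_eq_map,
      MonoidHom.range_eq_top.2 hρ, ← commutator_def]
    exact alternatingGroup.commutator_perm_eq (by simp)
  have hsign : ∀ g ∈ commutator G, Equiv.Perm.sign (ρ g) = 1 := by
    intro g hg
    have : ρ g ∈ (commutator G).map ρ := ⟨g, hg, rfl⟩
    rw [hcomm] at this
    exact this
  have hqk : ∀ g : commutator G, q g = 1 ↔ (g : G) ∈ J₀ J := by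
    intro g
    rw [← MonoidHom.mem_ker, hqker, Subgroup.mem_subgroupOf]
  -- a preimage of `-1` lies in `J` but not in `J₀`
  obtain ⟨s, hs⟩ := hq (-1)
  have hsρ : ρ s = 1 := by
    refine alternating_center _ fun τ hτ => ?_
    have : τ ∈ (commutator G).map ρ := by rw [hcomm]; exact hτ
    obtain ⟨t, ht, rfl⟩ := this
    have h1 : q (s * ⟨t, ht⟩ * s⁻¹ * (⟨t, ht⟩ : commutator G)⁻¹) = 1 := by
      simp [hs]
    rw [hqk] at h1
    have h2 := J₀_le_ker hker h1
    rw [MonoidHom.mem_ker] at h2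
    simp only [Subgroup.coe_mul, Subgroup.coe_inv, map_mul, map_inv] at h2
    rwa [mul_inv_eq_one, mul_inv_eq_iff_eq_mul] at h2
  have hsJ₀ : (s : G) ∉ J₀ J := by
    rw [← hqk, hs]
    decide +kernel
  have hJ₀G : J₀ J ≤ commutator G := Subgroup.commutator_mono le_rfl le_top
  -- `J₀` has index `2` in `J`, so besides `J₀` the single element `s` is enough.
  have hJG : J ≤ commutator G := by
    intro x hx
    obtain ⟨v, rfl⟩ := (mem_J x).1 hx
    obtain ⟨w, hw⟩ := (mem_ker _).1 hsρ
    have h2 : ∀ a : ZMod 2, a = 0 ∨ a = 1 := by decide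
    have hw1 : ∑ p, w p = 1 := by
      rcases h2 (∑ p, w p) with h | h
      · exact absurd ((mem_J₀ _).2 ⟨w, h, hw⟩) hsJ₀
      · exact h
    rcases h2 (∑ p, v p) with h | h
    · exact hJ₀G ((mem_J₀ _).2 ⟨v, h, rfl⟩)
    · have : v = (v + w) + w := by
        rw [add_assoc, CharTwo.add_self_eq_zero, add_zero]
      rw [this, j_add, hw]
      refine Subgroup.mul_mem _ (hJ₀G ((mem_J₀ _).2 ⟨v + w, ?_, rfl⟩)) s.2
      simp only [Pi.add_apply, Finset.sum_add_distrib, h, hw1]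
      decide
  have hmem : ∀ g, g ∈ commutator G ↔ Equiv.Perm.sign (ρ g) = 1 := by
    refine fun g => ⟨hsign g, fun h => ?_⟩
    have : ρ g ∈ (commutator G).map ρ := by rw [hcomm]; exact h
    obtain ⟨t, ht, htg⟩ := this
    have : t⁻¹ * g ∈ commutator G := hJG (by
      rw [← hker, MonoidHom.mem_ker, map_mul, map_inv, htg, inv_mul_cancel])
    simpa using Subgroup.mul_mem _ ht this
  refine ⟨{ surj := hρ, ker := hker, card_J := hG.card, j := j, j_add := j_add, j_eq_one := ?_, j_conj := j_conj,
            mem_ker := mem_ker, mem_J₀ := mem_J₀, sq_mem := ?_, mem_iff := ?_ }⟩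
  · intro v
    have : j v = 1 ↔ f (fun x => v (ε x)) = 0 := by
      simp only [j]
      rw [OneMemClass.coe_eq_one]
      rfl
    rw [this, hf0]
    exact exists_congr fun a => ε.forall_congr_left.trans (by simp)
  · intro g hg hgg
    have hg' := (hmem g).2 hg
    have h1 : q ⟨g, hg'⟩ * q ⟨g, hg'⟩ = 1 := by
      rw [← map_mul, hqk]; exact hgg
    rcases SL_sq_eq_one _ h1 with h | h
    · rw [hqk] at h
      exact J₀_le_ker hker h
    · have : q (⟨g, hg'⟩ * s) = 1 := by rw [map_mul, h, hs]; simp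
      rw [hqk] at this
      have := J₀_le_ker hker this
      rw [MonoidHom.mem_ker] at this
      simpa [hsρ] using this
  · intro g
    rw [sup_eq_left.2 hJG, hmem]
end BolLoops
namespace BolLoops

/-! ### Involutions of the extension -/

theorem exists_swap_of_odd_involution (σ : Equiv.Perm (Fin 5)) (h : σ * σ = 1)
    (h1 : Equiv.Perm.sign σ = -1) : ∃ a b, a ≠ b ∧ σ = Equiv.swap a b := by
  revert σ; decide +kernel

theorem isConj_of_odd_involution {σ τ : Equiv.Perm (Fin 5)} (h : σ * σ = 1)
    (h1 : Equiv.Perm.sign σ = -1) (h' : τ * τ = 1) (h1' : Equiv.Perm.sign τ = -1) :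
    IsConj σ τ := by
  obtain ⟨a, b, hab, rfl⟩ := exists_swap_of_odd_involution σ h h1
  obtain ⟨c, d, hcd, rfl⟩ := exists_swap_of_odd_involution τ h' h1'
  exact Equiv.Perm.isConj_swap hab hcd

/-- A transposition has three orbits of length `2` on the six points. If `a = 1`, then `v` has
exactly one `1` in each orbit and is odd. So `a = 0`, and `v` is constant on the orbits. -/
theorem exists_eq_add_of_even (v : Fin 6 → ZMod 2) (hv : ∑ p, v p = 0)
    (h : ∃ a, ∀ p, v ((act6 (Equiv.swap 0 1))⁻¹ p) + v p = a) :
    ∃ w : Fin 6 → ZMod 2, v = (fun p => w ((act6 (Equiv.swap 0 1))⁻¹ p)) + w := by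
  revert v; decide +kernel

/-- This is the number of involutions of `G` over a given transposition. The condition `v 0 = 0`
picks one vector in each class modulo constants. -/
theorem card_fixed_vectors (σ : Equiv.Perm (Fin 5)) (h : σ * σ = 1)
    (h1 : Equiv.Perm.sign σ = -1) :
    Fintype.card {v : Fin 6 → ZMod 2 // v 0 = 0 ∧ ∃ a, ∀ p, v ((act6 σ)⁻¹ p) + v p = a} = 8 := by
  revert σ; decide +kernel

namespace ExtData

variable {G : Type*} [Group G] {J : Subgroup G} {ρ : G →* Equiv.Perm (Fin 5)} (E : ExtData J ρ)
include E

theorem j_zero : E.j 0 = 1 := (E.j_eq_one 0).2 ⟨0, fun _ => rfl⟩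

theorem j_sq (v) : E.j v * E.j v = 1 := by
  rw [← E.j_add, CharTwo.add_self_eq_zero, E.j_zero]

theorem j_inv (v) : (E.j v)⁻¹ = E.j v := inv_eq_of_mul_eq_one_left (E.j_sq v)

theorem j_eq_iff (v w) : E.j v = E.j w ↔ ∃ a, ∀ p, v p + w p = a := by
  rw [← mul_inv_eq_one, E.j_inv, ← E.j_add, E.j_eq_one]
  rfl

theorem ρ_j (v) : ρ (E.j v) = 1 := (E.mem_ker _).2 ⟨v, rfl⟩

theorem card_eq : Nat.card G = 3840 := by
  have h := J.card_eq_card_quotient_mul_card_subgroup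
  have h2 : Nat.card (G ⧸ J) = 120 := by
    change J.index = 120
    rw [← E.ker, Subgroup.index_ker, MonoidHom.range_eq_top.2 E.surj, Subgroup.card_top,
      Nat.card_eq_fintype_card, Fintype.card_perm, Fintype.card_fin]
    rfl
  rw [h, h2, E.card_J]

theorem finite : Finite G := Nat.finite_of_card_ne_zero (by rw [E.card_eq]; norm_num)

theorem j_conj_of_sq {c : G} (hc : c * c = 1) (v) :
    c * E.j v * c = E.j (fun p => v ((act6 (ρ c))⁻¹ p)) := by
  rw [← E.j_conj, inv_eq_of_mul_eq_one_left hc]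

/-- `c * j v` is an involution if and only if the involution `c` fixes `j v`. -/
theorem mul_j_sq {c : G} (hc : c * c = 1) (v) : (c * E.j v) * (c * E.j v) = 1 ↔
    ∃ a, ∀ p, v ((act6 (ρ c))⁻¹ p) + v p = a := by
  rw [← mul_assoc, E.j_conj_of_sq hc, ← E.j_add, E.j_eq_one]
  rfl

theorem exists_j_of_ρ_eq {a c : G} (h : ρ a = ρ c) : ∃ v, a = c * E.j v := by
  obtain ⟨v, hv⟩ := (E.mem_ker (c⁻¹ * a)).1 (by rw [map_mul, map_inv, h, inv_mul_cancel])
  exact ⟨v, by rw [hv, mul_inv_cancel_left]⟩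

theorem isConj_mul_j_of_even {c : G} (hc : c * c = 1) (hρ : ρ c = Equiv.swap 0 1)
    (v) (hv : ∑ p, v p = 0) (h : (c * E.j v) * (c * E.j v) = 1) : IsConj c (c * E.j v) := by
  rw [E.mul_j_sq hc, hρ] at h
  obtain ⟨w, rfl⟩ := exists_eq_add_of_even v hv h
  refine isConj_iff.2 ⟨E.j w, ?_⟩
  rw [E.j_inv, E.j_add, ← hρ, ← E.j_conj_of_sq hc]
  simp only [← mul_assoc, hc, one_mul]

/-- Involutions that differ by an even vector are conjugate under `J`. To pass to an odd vector, `c`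
is conjugated by an involution `b` over the disjoint transposition `(2 3)`. The vector `v'` that
arises is odd, since otherwise `sq_mem` would apply to `c b`, which lies over `(0 1)(2 3) ≠ 1`. -/
theorem isConj_of_swap {a c : G} (ha : a * a = 1) (hc : c * c = 1)
    (hρa : ρ a = Equiv.swap 0 1) (hρc : ρ c = Equiv.swap 0 1) : IsConj c a := by
  obtain ⟨v, rfl⟩ := E.exists_j_of_ρ_eq (hρa.trans hρc.symm)
  have h2 : ∀ a : ZMod 2, a = 0 ∨ a = 1 := by decide
  rcases h2 (∑ p, v p) with h | h
  · exact E.isConj_mul_j_of_even hc hρc v h ha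
  · obtain ⟨g, hg⟩ := E.surj (Equiv.swap 0 2 * Equiv.swap 1 3)
    let b := g * c * g⁻¹
    have hb : b * b = 1 := by
      have : b * b = g * (c * c) * g⁻¹ := by simp only [b]; group
      rw [this, hc]; simp
    have hρb : ρ b = Equiv.swap 2 3 := by
      simp only [b, map_mul, map_inv, hg, hρc]; decide +kernel
    have hρ' : ρ (b * c * b⁻¹) = Equiv.swap 0 1 := by
      rw [map_mul, map_mul, map_inv, hρb, hρc]; decide +kernel
    obtain ⟨v', hv'⟩ := E.exists_j_of_ρ_eq (hρ'.trans hρc.symm)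
    have hcc' : IsConj c (c * E.j v') := isConj_iff.2 ⟨b, hv'⟩
    have hc' : (c * E.j v') * (c * E.j v') = 1 := by
      rw [← hv', conj_mul, hc]; simp
    have hodd : ∑ p, v' p = 1 := by
      rcases h2 (∑ p, v' p) with h | h
      · exfalso
        have h3 : (c * b) * (c * b) = E.j v' := by
          have : c * (b * c * b⁻¹) = E.j v' := by rw [hv', ← mul_assoc, hc, one_mul]
          rw [← this, inv_eq_of_mul_eq_one_left hb]; group
        have h4 : ρ (c * b) = Equiv.swap 0 1 * Equiv.swap 2 3 := by rw [map_mul, hρb, hρc]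
        have h5 := E.sq_mem (c * b) (by rw [h4]; decide +kernel)
          (by rw [h3, E.mem_J₀]; exact ⟨v', h, rfl⟩)
        rw [h4] at h5
        revert h5
        decide +kernel
      · exact h
    have hvv : c * E.j v = (c * E.j v') * E.j (v' + v) := by
      rw [mul_assoc, ← E.j_add, ← add_assoc, CharTwo.add_self_eq_zero, zero_add]
    refine hcc'.trans ?_
    rw [hvv]
    refine E.isConj_mul_j_of_even hc' (by rw [← hv', hρ']) _ ?_ (by rw [← hvv]; exact ha)
    simp only [Pi.add_apply, Finset.sum_add_distrib, h, hodd]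
    decide

/-- All involutions of `G` over odd permutations are conjugate. -/
theorem isConj_of_odd {a c : G} (ha : a * a = 1) (hc : c * c = 1)
    (hρa : Equiv.Perm.sign (ρ a) = -1) (hρc : Equiv.Perm.sign (ρ c) = -1) : IsConj c a := by
  have key : ∀ x : G, x * x = 1 → Equiv.Perm.sign (ρ x) = -1 →
      ∃ y, IsConj x y ∧ y * y = 1 ∧ ρ y = Equiv.swap 0 1 := by
    intro x hx hρx
    obtain ⟨s, hs⟩ := isConj_iff.1 (isConj_of_odd_involution (σ := ρ x) (τ := Equiv.swap 0 1)
      (by rw [← map_mul, hx, map_one]) hρx (by simp) (by decide +kernel))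
    obtain ⟨g, rfl⟩ := E.surj s
    refine ⟨g * x * g⁻¹, isConj_iff.2 ⟨g, rfl⟩, ?_, by simpa using hs⟩
    rw [conj_mul, hx]; simp
  obtain ⟨a', h1, h2, h3⟩ := key a ha hρa
  obtain ⟨c', h4, h5, h6⟩ := key c hc hρc
  exact (h4.trans (E.isConj_of_swap h2 h5 h3 h6)).trans h1.symm

/-- Every transposition lifts to an involution. -/
theorem exists_lift {c : G} (hc : c * c = 1) (hρc : Equiv.Perm.sign (ρ c) = -1)
    {τ : Equiv.Perm (Fin 5)} (h : τ * τ = 1) (h1 : Equiv.Perm.sign τ = -1) :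
    ∃ a, a * a = 1 ∧ ρ a = τ := by
  obtain ⟨s, hs⟩ := isConj_iff.1 (isConj_of_odd_involution (σ := ρ c) (τ := τ)
      (by rw [← map_mul, hc, map_one]) hρc h h1)
  obtain ⟨g, rfl⟩ := E.surj s
  refine ⟨g * c * g⁻¹, ?_, by simpa using hs⟩
  rw [conj_mul, hc]; simp

end ExtData

/-! ### The normalizer of a Sylow `5`-subgroup -/

/-- The `5`-cycle fixes the point `i`, which forces `a = 0`, and it permutes the other five points
cyclically. So the fixed space modulo constants is spanned by `e_i`. -/
theorem fixed_by_fiveCycle (i : Fin 6) (v : Fin 6 → ZMod 2)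
    (h : ∃ a, ∀ p, v p + v ((act6 (fiveCycle i))⁻¹ p) = a) :
    (∃ a, ∀ p, v p = a) ∨ ∃ a, ∀ p, v p + (Pi.single i 1 : Fin 6 → ZMod 2) p = a := by
  revert i v; decide +kernel

theorem act6_fiveCycle (i : Fin 6) : act6 (fiveCycle i) i = i := by
  revert i; decide +kernel

theorem card_fixing (i : Fin 6) : Fintype.card {σ // act6 σ i = i} = 20 := by
  revert i; decide +kernel

/-- A subgroup `H` that maps onto the stabilizer of the `i`-th Sylow `5`-subgroup, with kernel
generated by the vector `e i`. -/
structure IsPointNormalizer {G : Type*} [Group G] {J : Subgroup G} {ρ : G →* Equiv.Perm (Fin 5)}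
    (E : ExtData J ρ) (H : Subgroup G) (i : Fin 6) : Prop where
  fix : ∀ h ∈ H, act6 (ρ h) i = i
  surj : ∀ σ, act6 σ i = i → ∃ h ∈ H, ρ h = σ
  mem_of_fix : ∀ h ∈ H, ρ h = 1 → h = 1 ∨ h = E.j (Pi.single i 1)
  single_mem : E.j (Pi.single i 1) ∈ H

-- `|P| = 5` because `3840 = 5 · 768`. Surjectivity is a Frattini argument: `P` and its conjugate by
-- `g` are Sylow in the preimage of `⟨fiveCycle i⟩`, hence conjugate there. An element of `J` that
-- normalizes `P` centralizes it, because the commutators lie in `J ∩ P = 1`, and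
-- `fixed_by_fiveCycle` applies.
open Subgroup in
theorem ExtData.exists_isPointNormalizer {G : Type*} [Group G] {J : Subgroup G}
    {ρ : G →* Equiv.Perm (Fin 5)} (E : ExtData J ρ) (P : Sylow 5 G) :
    ∃ i, IsPointNormalizer E (normalizer (P : Set G)) i ∧ ∃ y ∈ P, ρ y = fiveCycle i := by
  classical
  have := E.finite
  have hP : Nat.card P = 5 := by
    have h := P.card_eq_multiplicity
    have h3840 : 3840 = 5 ^ 1 * 768 := by norm_num
    rw [E.card_eq, h3840, Nat.factorization_mul (by norm_num) (by norm_num),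
      Nat.Prime.factorization_pow Nat.prime_five] at h
    rw [Finsupp.add_apply, Finsupp.single_eq_same,
      Nat.factorization_eq_zero_of_not_dvd (by norm_num)] at h
    simpa using h
  have hpow : ∀ x ∈ P, x ^ 5 = 1 := by
    intro x hx
    have : (⟨x, hx⟩ : P) ^ Nat.card P = 1 := pow_card_eq_one'
    rw [hP] at this
    exact congrArg Subtype.val this
  have hker : ∀ x ∈ P, x * x = 1 → x = 1 := by
    intro x hx h
    have h5 := hpow x hx
    have : x ^ 5 = x * x * (x * x) * x := by
      simp only [pow_succ, pow_zero, one_mul, mul_assoc]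
    rw [this, h] at h5
    simpa using h5
  have hρ1 : ∀ x ∈ P, ρ x = 1 → x = 1 := by
    intro x hx h
    obtain ⟨v, rfl⟩ := (E.mem_ker x).1 h
    exact hker _ hx (E.j_sq v)
  obtain ⟨⟨y₀, hy₀⟩, hy₀5⟩ := exists_prime_orderOf_dvd_card' (G := P) 5 (by rw [hP])
  have hy₀1 : y₀ ≠ 1 := by
    rintro rfl
    rw [Subgroup.orderOf_mk] at hy₀5
    simp at hy₀5
  have hρy₀ : ρ y₀ ≠ 1 := fun h => hy₀1 (hρ1 _ hy₀ h)
  obtain ⟨k, hk⟩ := exists_fiveCycle_pow (ρ y₀) (by rw [← map_pow, hpow _ hy₀, map_one]) hρy₀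
  obtain ⟨m, hm⟩ := exists_pow_fiveCycle_pow (sylowIndex (ρ y₀)) k
  rw [hk, ← map_pow] at hm
  generalize sylowIndex (ρ y₀) = i at hm
  obtain ⟨y, hy, hyi⟩ : ∃ y ∈ P, ρ y = fiveCycle i := ⟨_, pow_mem hy₀ m.val, hm⟩
  have hy1 : y ≠ 1 := by
    rintro rfl
    rw [map_one] at hyi
    exact fiveCycle_ne_one i hyi.symm
  have hord : orderOf y = 5 := orderOf_eq_prime (hpow y hy) hy1
  have hgen : (P : Subgroup G) = zpowers y :=
    (eq_of_le_of_card_ge (zpowers_le.2 hy) (by rw [Nat.card_zpowers, hord, hP])).symm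
  have hgen' : ∀ x ∈ P, ∃ n < 5, x = y ^ n := by
    intro x hx
    have : x ∈ zpowers y := hgen ▸ hx
    rw [← (isOfFinOrder_of_finite y).mem_powers_iff_mem_zpowers,
      (isOfFinOrder_of_finite y).mem_powers_iff_mem_range_orderOf] at this
    simp only [Finset.mem_image, Finset.mem_range, hord] at this
    obtain ⟨n, hn, rfl⟩ := this
    exact ⟨n, hn, rfl⟩
  refine ⟨i, ⟨?_, ?_, ?_, ?_⟩, y, hy, hyi⟩
  · intro h hh
    obtain ⟨n, hn, hn'⟩ := hgen' _ ((mem_set_normalizer_iff.1 hh y).1 hy)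
    have h1 : ρ h * fiveCycle i * (ρ h)⁻¹ = fiveCycle i ^ n := by
      rw [← hyi, ← map_inv, ← map_mul, ← map_mul, hn', map_pow]
    rw [act6_apply, h1]
    obtain _ | n := n
    · rw [pow_zero] at h1
      exact absurd h1 (conj_fiveCycle_ne_one _ _)
    · exact sylowIndex_fiveCycle_pow i ⟨n, by omega⟩
  · intro σ hσ
    obtain ⟨g, rfl⟩ := E.surj σ
    let A : Subgroup G := (zpowers (fiveCycle i)).comap ρ
    have hPA : (P : Subgroup G) ≤ A := by
      rw [hgen, zpowers_le]
      change ρ y ∈ zpowers (fiveCycle i)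
      rw [hyi]
      exact mem_zpowers _
    have hgA : ((g • P : Sylow 5 G) : Subgroup G) ≤ A := by
      intro x hx
      obtain ⟨z, hz, rfl⟩ := hx
      obtain ⟨n, hn, rfl⟩ := hgen' z hz
      obtain ⟨k, hk⟩ := exists_conj_fiveCycle (ρ g) i
      rw [hσ] at hk
      change ρ (g * y ^ n * g⁻¹) ∈ zpowers (fiveCycle i)
      rw [map_mul, map_mul, map_pow, map_inv, hyi, ← conj_pow, ← hk, ← pow_mul]
      exact pow_mem (mem_zpowers _) _
    obtain ⟨x, hx⟩ := MulAction.exists_smul_eq A ((g • P).subtype hgA) (P.subtype hPA)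
    rw [Sylow.smul_subtype] at hx
    have hx' := Sylow.subtype_injective hx
    have hxg : (x : G) * g ∈ normalizer (P : Set G) := by
      rw [← Sylow.smul_eq_iff_mem_normalizer, mul_smul]
      exact hx'
    obtain ⟨m, hm⟩ := mem_zpowers_iff.1 x.2
    refine ⟨(y ^ m)⁻¹ * (x * g), mul_mem (inv_mem (zpow_mem (le_normalizer hy) m)) hxg, ?_⟩
    rw [map_mul, map_mul, map_inv, map_zpow, hyi, hm]
    simp
  · intro h hh hρ
    obtain ⟨v, rfl⟩ := (E.mem_ker h).1 hρ
    have h1 : E.j v * y * (E.j v)⁻¹ * y⁻¹ ∈ P :=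
      mul_mem ((mem_set_normalizer_iff.1 hh y).1 hy) (inv_mem hy)
    have h2 : E.j v * y * (E.j v)⁻¹ * y⁻¹ =
        E.j (v + fun p => v ((act6 (fiveCycle i))⁻¹ p)) := by
      rw [E.j_add, ← hyi, ← E.j_conj, E.j_inv]; group
    rw [h2] at h1
    have h3 := hker _ h1 (E.j_sq _)
    rw [E.j_eq_one] at h3
    rcases fixed_by_fiveCycle i v h3 with h | h
    · left; exact (E.j_eq_one v).2 h
    · right; exact (E.j_eq_iff _ _).2 h
  · rw [mem_set_normalizer_iff]
    have hc : y * E.j (Pi.single i 1) * y⁻¹ = E.j (Pi.single i 1) := by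
      rw [E.j_conj, hyi]
      congr 1
      funext p
      simp only [Pi.single_apply, Equiv.Perm.inv_eq_iff_eq, act6_fiveCycle]
    have hc' : ∀ x ∈ P, E.j (Pi.single i 1) * x * (E.j (Pi.single i 1))⁻¹ = x := by
      intro x hx
      obtain ⟨n, hn, rfl⟩ := hgen' x hx
      have : Commute (E.j (Pi.single i 1)) (y ^ n) :=
        Commute.pow_right (mul_inv_eq_iff_eq_mul.1 hc).symm n
      rw [this.eq, mul_inv_cancel_right]
    intro x
    refine ⟨fun hx => by rw [SetLike.mem_coe, hc' x hx]; exact hx, fun hx => ?_⟩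
    have h4 := hc' _ hx
    have h5 := mul_left_cancel (mul_right_cancel h4)
    rw [h5] at hx
    exact hx
end BolLoops
namespace BolLoops

/-! ### The module `U` -/

instance : DecidablePred (· ∈ N) := fun v => inferInstanceAs (Decidable (∑ x, v x = 0))

instance : DecidableEq U := inferInstanceAs (DecidableEq (N × N))

instance : Fintype U := inferInstanceAs (Fintype (N × N))

theorem N.add_self (n : N) : n + n = 0 :=
  Subtype.ext (CharTwo.add_self_eq_zero (n : Fin 5 → ZMod 2))

theorem N.add_eq_zero {n m : N} : n + m = 0 ↔ n = m :=
  ⟨fun h => by rw [← add_left_inj m, h, N.add_self], fun h => by rw [h, N.add_self]⟩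

namespace U

/-- The element of `U` with given components. -/
def mk (n m : N) : U := (n, m)

@[simp] theorem mk_fst (n m : N) : (mk n m).1 = n := rfl
@[simp] theorem mk_snd (n m : N) : (mk n m).2 = m := rfl
@[simp] theorem zero_fst : (0 : U).1 = 0 := rfl
@[simp] theorem zero_snd : (0 : U).2 = 0 := rfl
@[simp] theorem add_fst (u v : U) : (u + v).1 = u.1 + v.1 := rfl
@[simp] theorem add_snd (u v : U) : (u + v).2 = u.2 + v.2 := rfl

theorem ext {u v : U} (h1 : u.1 = v.1) (h2 : u.2 = v.2) : u = v := Prod.ext h1 h2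

theorem add_self (u : U) : u + u = 0 := ext (N.add_self u.1) (N.add_self u.2)

theorem neg_eq (u : U) : -u = u := neg_eq_of_add_eq_zero_left (add_self u)

theorem sub_eq (u v : U) : u - v = u + v := by rw [sub_eq_add_neg, neg_eq]

theorem mem_W {u : U} : u ∈ W ↔ u.1 = u.2 := Iff.rfl

theorem smul_of_even {σ : Equiv.Perm (Fin 5)} (h : Equiv.Perm.sign σ = 1) (u : U) :
    σ • u = mk (σ • u.1) (σ • u.2) := by
  apply ext <;> simp [smul_fst, smul_snd, h]

theorem smul_of_odd {σ : Equiv.Perm (Fin 5)} (h : Equiv.Perm.sign σ = -1) (u : U) :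
    σ • u = mk (σ • u.2) (σ • u.1) := by
  apply ext <;> simp [smul_fst, smul_snd, h]

theorem smul_mem_W (σ : Equiv.Perm (Fin 5)) {u : U} (h : u ∈ W) : σ • u ∈ W := by
  rw [mem_W] at *
  simp [smul_fst, smul_snd, h]

theorem card_eq : Fintype.card U = 256 := by decide +kernel

theorem card_N : Fintype.card N = 16 := by decide +kernel

instance : DecidablePred (· ∈ W) := fun u => inferInstanceAs (Decidable (u.1 = u.2))
instance : DecidablePred (· ∈ U₁) := fun u => inferInstanceAs (Decidable (u.2 = 0))
instance : DecidablePred (· ∈ U₂) := fun u => inferInstanceAs (Decidable (u.1 = 0))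

/-- The vector of weight `4` that vanishes at `p`. -/
def compl (p : Fin 5) : N := ⟨fun x => if x = p then 0 else 1, by
  change ∑ x, (if x = p then (0 : ZMod 2) else 1) = 0
  revert p; decide⟩

theorem altOrbit_eq (u : U) : altOrbit u =
    (((Finset.univ.filter fun σ : Equiv.Perm (Fin 5) => Equiv.Perm.sign σ = 1).image
      fun σ => σ • u : Finset U) : Set U) := by
  ext w
  simp only [altOrbit, Set.mem_ofPred_eq, Finset.coe_image, Set.mem_image, Finset.mem_coe,
    Finset.mem_filter, Finset.mem_univ, true_and, Equiv.Perm.mem_alternatingGroup]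
  exact exists_congr fun σ => and_congr_right fun _ => eq_comm

/-- In `N` the five vectors of weight `4` form an `A₅`-orbit, and the ten of weight `2` form
another. So `S` has `1 + 3 · 5 = 16` elements, as many as `W`. -/
theorem mem_S_iff (u : U) : u ∈ S ↔ u = 0 ∨
    ∃ p, u = mk (compl p) (compl p) ∨ u = mk (compl p) 0 ∨ u = mk 0 (compl p) := by
  change (u = 0 ∨ ((u ∈ W ∨ u ∈ U₁ ∨ u ∈ U₂) ∧ (altOrbit u).ncard = 5)) ↔ _
  rw [altOrbit_eq, Set.ncard_coe_finset]
  revert u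
  decide +kernel

theorem smul_mem_S (σ : Equiv.Perm (Fin 5)) {u : U} (h : u ∈ S) : σ • u ∈ S := by
  have key : ∀ p, σ • compl p = compl (σ p) := by
    intro p
    apply Subtype.ext
    funext x
    change (if σ⁻¹ x = p then (0 : ZMod 2) else 1) = if x = σ p then 0 else 1
    simp only [Equiv.Perm.inv_eq_iff_eq]
  rw [mem_S_iff] at *
  rcases Int.units_eq_one_or (Equiv.Perm.sign σ) with hσ | hσ
  · rcases h with rfl | ⟨p, rfl | rfl | rfl⟩
    · left; exact smul_zero σ
    all_goals
      refine Or.inr ⟨σ p, ?_⟩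
      rw [smul_of_even hσ]
      simp [key]
  · rcases h with rfl | ⟨p, rfl | rfl | rfl⟩
    · left; exact smul_zero σ
    all_goals
      refine Or.inr ⟨σ p, ?_⟩
      rw [smul_of_odd hσ]
      simp [key]

/-- An injection of `N` into `S`. -/
theorem exists_embedding_S : ∃ s : N → U, Function.Injective s ∧ ∀ n, s n ∈ S := by
  let e : Option (Fin 5 × Fin 3) → U := fun o => match o with
    | none => 0
    | some (p, 0) => mk (compl p) (compl p)
    | some (p, 1) => mk (compl p) 0
    | some (p, 2) => mk 0 (compl p)
  have he : Function.Injective e := by decide +kernel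
  have hS : ∀ o, e o ∈ S := by
    intro o
    rw [mem_S_iff]
    rcases o with _ | ⟨p, q⟩
    · left; rfl
    · right; fin_cases q
      · exact ⟨p, Or.inl rfl⟩
      · exact ⟨p, Or.inr (Or.inl rfl)⟩
      · exact ⟨p, Or.inr (Or.inr rfl)⟩
  let f : N ≃ Option (Fin 5 × Fin 3) := Fintype.equivOfCardEq (by rw [card_N]; rfl)
  exact ⟨fun n => e (f n), he.comp f.injective, fun n => hS _⟩

/-! ### The `F₂₀`-submodules of `U` -/

/-- The union of the two `F₂₀`-submodules other than `W` that are diagonals of `U₁ ⊕ U₂`. -/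
def InDiagonal (u : U) : Prop :=
  u.2 = fiveCycle 0 • u.1 + (fiveCycle 0) ^ 4 • u.1 ∨
    u.2 = (fiveCycle 0) ^ 2 • u.1 + (fiveCycle 0) ^ 3 • u.1

instance : DecidablePred InDiagonal := fun u => by unfold InDiagonal; infer_instance

/-- The sum of the images of `n` under those powers of a `5`-cycle that `a` selects. -/
def cyclicSum {M : Type*} [AddCommGroup M] [DistribMulAction (Equiv.Perm (Fin 5)) M]
    (a : Fin 4 → Bool) (n : M) : M :=
  ∑ l, if a l then (fiveCycle 0) ^ l.val • n else 0

/-- The polynomial `x⁴ + x³ + x² + x + 1` is irreducible over `𝔽₂`. Hence the `5`-cycle makes `N` a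
one-dimensional space over `𝔽₁₆`, and four consecutive powers span this field. -/
theorem exists_cyclicSum (n m : N) (h : n ≠ 0) : ∃ a, cyclicSum a n = m := by
  revert n m; decide +kernel

/-- With `N` viewed as `𝔽₁₆` through the `5`-cycle `y`, the odd permutation `c[1, 2, 4, 3]`, which
conjugates `y` to `y²`, is Frobenius-semilinear and exchanges the components. So the graph of `u₂ =
λ u₁` is stable only if `λ³ = 1`; the values `1`, `y + y⁴`, `y² + y³` give `W` and the two
diagonals. Any other vector generates a submodule that meets `W`. -/
theorem exists_cyclicSum_mem_W (u : U) : InDiagonal u ∨ u ∈ W ∨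
    ∃ a, cyclicSum a u + c[(1 : Fin 5), 2, 4, 3] • u ∈ W ∧
      cyclicSum a u + c[(1 : Fin 5), 2, 4, 3] • u ≠ 0 := by
  revert u; decide +kernel

/-- This controls products of two odd involutions that lie in `𝓗`. -/
theorem eq_zero_of_inDiagonal (u : U) (h : InDiagonal u) (a b : Fin 5) (hab : a ≠ b)
    (h' : Equiv.swap a b • u = u) : u = 0 := by
  revert u a b; decide +kernel

/-- `S` represents cosets of `T` without repetition, as `W` does. The proof runs through the `16 ·
16` pairs of an explicit list of `S`. -/
theorem eq_of_mem_S_of_inDiagonal {s s' : U} (hs : s ∈ S) (hs' : s' ∈ S)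
    (h : InDiagonal (s + s')) : s = s' := by
  have key : ∀ o o' : Option (Fin 5 × Fin 3), InDiagonal
    ((match o with
      | none => 0
      | some (p, 0) => mk (compl p) (compl p)
      | some (p, 1) => mk (compl p) 0
      | some (p, 2) => mk 0 (compl p)) +
    (match o' with
      | none => 0
      | some (p, 0) => mk (compl p) (compl p)
      | some (p, 1) => mk (compl p) 0
      | some (p, 2) => mk 0 (compl p))) → o = o' := by decide +kernel
  have hex : ∀ s ∈ S, ∃ o : Option (Fin 5 × Fin 3), (match o with
      | none => 0
      | some (p, 0) => mk (compl p) (compl p)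
      | some (p, 1) => mk (compl p) 0
      | some (p, 2) => mk 0 (compl p)) = s := by
    intro s hs
    rcases (mem_S_iff s).1 hs with rfl | ⟨p, rfl | rfl | rfl⟩
    · exact ⟨none, rfl⟩
    · exact ⟨some (p, 0), rfl⟩
    · exact ⟨some (p, 1), rfl⟩
    · exact ⟨some (p, 2), rfl⟩
  obtain ⟨o, rfl⟩ := hex s hs
  obtain ⟨o', rfl⟩ := hex s' hs'
  rw [key o o' h]

theorem cyclicSum_mem {T : AddSubgroup U} (hT : ∀ u ∈ T, fiveCycle 0 • u ∈ T) (a) {u : U}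
    (hu : u ∈ T) : cyclicSum a u ∈ T := by
  refine T.sum_mem fun l _ => ?_
  have : ∀ n : ℕ, (fiveCycle 0) ^ n • u ∈ T := by
    intro n
    induction n with
    | zero => simpa using hu
    | succ n ih => rw [pow_succ', mul_smul]; exact hT _ ih
  split_ifs
  · exact this _
  · exact T.zero_mem

theorem cyclicSum_fst (a) (u : U) : (cyclicSum a u).1 = cyclicSum a u.1 := by
  have h : ∀ l, Equiv.Perm.sign (fiveCycle 0 ^ l) = 1 := fun l => by
    rw [map_pow, show Equiv.Perm.sign (fiveCycle 0) = 1 by decide +kernel, one_pow]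
  have := map_sum (AddMonoidHom.fst N N) (fun l : Fin 4 =>
    if a l then (fiveCycle 0) ^ l.val • u else (0 : U)) Finset.univ
  refine this.trans (Finset.sum_congr rfl fun l _ => ?_)
  split_ifs
  · rw [smul_of_even (h _)]; rfl
  · rfl

theorem cyclicSum_snd (a) (u : U) : (cyclicSum a u).2 = cyclicSum a u.2 := by
  have h : ∀ l, Equiv.Perm.sign (fiveCycle 0 ^ l) = 1 := fun l => by
    rw [map_pow, show Equiv.Perm.sign (fiveCycle 0) = 1 by decide +kernel, one_pow]
  have := map_sum (AddMonoidHom.snd N N) (fun l : Fin 4 =>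
    if a l then (fiveCycle 0) ^ l.val • u else (0 : U)) Finset.univ
  refine this.trans (Finset.sum_congr rfl fun l _ => ?_)
  split_ifs
  · rw [smul_of_even (h _)]; rfl
  · rfl

theorem cyclicSum_zero (a) : cyclicSum a (0 : N) = 0 := by
  simp [cyclicSum]

/-- The properties of the `F₂₀`-submodule `T` that the construction uses. -/
structure IsAdmissible (T : AddSubgroup U) : Prop where
  eq_zero_of_mem_W : ∀ u ∈ T, u ∈ W → u = 0
  eq_zero_of_swap : ∀ u ∈ T, ∀ a b : Fin 5, a ≠ b → Equiv.swap a b • u = u → u = 0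
  eq_of_mem_S : ∀ s ∈ S, ∀ s' ∈ S, s + s' ∈ T → s = s'

/-- `W` is irreducible under the `5`-cycle, so if `T` meets `W` then `W ≤ T`. In that case a vector
of `T` outside `W` yields a nonzero vector of `0 ⊕ N`, hence all of `0 ⊕ N`, and `T = U`. So `T ∩ W
= 0`, and `exists_cyclicSum_mem_W` places `T` in the union of the diagonals. -/
theorem isAdmissible_zero {T : AddSubgroup U} (hT : ∀ σ, act6 σ 0 = 0 → ∀ u ∈ T, σ • u ∈ T)
    (h1 : T ≠ ⊤) (h2 : T ≠ W.toAddSubgroup) : IsAdmissible T := by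
  have hy : ∀ u ∈ T, fiveCycle 0 • u ∈ T := hT _ (act6_fiveCycle 0)
  have hW : ∀ u ∈ T, u ∈ W → u = 0 := by
    intro u hu huW
    by_contra hu0
    have hu1 : u.1 ≠ 0 := fun h => hu0 (ext h (by rw [← mem_W.1 huW, h]; rfl))
    have hWT : ∀ w ∈ W, w ∈ T := by
      intro w hw
      obtain ⟨a, ha⟩ := exists_cyclicSum u.1 w.1 hu1
      have : cyclicSum a u = w := by
        apply ext
        · rw [cyclicSum_fst, ha]
        · rw [cyclicSum_snd, ← mem_W.1 huW, ha, mem_W.1 hw]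
      exact this ▸ cyclicSum_mem hy a hu
    have hex : ∃ t ∈ T, t ∉ W := by
      by_contra! h
      exact h2 (le_antisymm h hWT)
    obtain ⟨t, ht, htW⟩ := hex
    have hmem : mk 0 (t.2 + t.1) ∈ T := by
      have : t + mk t.1 t.1 = mk 0 (t.2 + t.1) := by
        apply ext
        · exact N.add_self t.1
        · rfl
      rw [← this]
      exact T.add_mem ht (hWT _ rfl)
    have hne : t.2 + t.1 ≠ 0 := by
      intro h
      exact htW (N.add_eq_zero.1 h).symm
    refine h1 (top_unique fun v _ => ?_)
    obtain ⟨a, ha⟩ := exists_cyclicSum (t.2 + t.1) (v.2 + v.1) hne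
    have : v = mk v.1 v.1 + cyclicSum a (mk 0 (t.2 + t.1)) := by
      apply ext
      · rw [add_fst, cyclicSum_fst]; simp [cyclicSum_zero]
      · rw [add_snd, cyclicSum_snd, mk_snd, mk_snd, ha]
        have h3 : ∀ n m : N, n = m + (n + m) := fun n m => by
          rw [add_left_comm, N.add_self, add_zero]
        exact h3 _ _
    rw [this]
    exact T.add_mem (hWT _ rfl) (cyclicSum_mem hy a hmem)
  have hD : ∀ u ∈ T, InDiagonal u := by
    intro u hu
    rcases exists_cyclicSum_mem_W u with h | h | ⟨a, h, h0⟩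
    · exact h
    · rw [hW u hu h]; decide +kernel
    · exact absurd (hW _ (T.add_mem (cyclicSum_mem hy a hu)
        (hT _ (by decide +kernel) u hu)) h) h0
  exact ⟨hW, fun u hu => eq_zero_of_inDiagonal u (hD u hu),
    fun s hs s' hs' h => eq_of_mem_S_of_inDiagonal hs hs' (hD _ h)⟩

theorem isAdmissible {T : AddSubgroup U} (i : Fin 6)
    (hT : ∀ σ, act6 σ i = i → ∀ u ∈ T, σ • u ∈ T)
    (h1 : T ≠ ⊤) (h2 : T ≠ W.toAddSubgroup) : IsAdmissible T := by
  obtain ⟨τ, rfl⟩ := act6_transitive 0 i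
  have hcancel : ∀ u : U, τ • τ⁻¹ • u = u := fun u => smul_inv_smul τ u
  have h := isAdmissible_zero (T := T.comap (DistribSMul.toAddMonoidHom U τ)) ?_ ?_ ?_
  · have hmem : ∀ u ∈ T, τ⁻¹ • u ∈ T.comap (DistribSMul.toAddMonoidHom U τ) := by
      intro u hu
      change τ • τ⁻¹ • u ∈ T
      rwa [hcancel]
    refine ⟨fun u hu huW => ?_, fun u hu a b hab hfix => ?_, fun s hs s' hs' hss => ?_⟩
    · have := h.eq_zero_of_mem_W _ (hmem u hu) (smul_mem_W _ huW)
      rwa [smul_eq_zero_iff_eq] at this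
    · have := h.eq_zero_of_swap _ (hmem u hu) (τ⁻¹ a) (τ⁻¹ b) (by simpa using hab) (by
        rw [Equiv.swap_apply_apply, inv_inv, mul_smul, mul_smul, hcancel, hfix])
      rwa [smul_eq_zero_iff_eq] at this
    · have := h.eq_of_mem_S _ (smul_mem_S τ⁻¹ hs) _ (smul_mem_S τ⁻¹ hs') (by
        rw [← smul_add]; exact hmem _ hss)
      exact smul_left_cancel _ this
  · intro σ hσ u hu
    change τ • σ • u ∈ T
    have hu : τ • u ∈ T := hu
    have := hT (τ * σ * τ⁻¹) (by simp [hσ]) _ hu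
    simpa [mul_smul] using this
  · intro h
    refine h1 (top_unique fun u _ => ?_)
    have : τ⁻¹ • u ∈ T.comap (DistribSMul.toAddMonoidHom U τ) := by rw [h]; trivial
    have : τ • τ⁻¹ • u ∈ T := this
    rwa [hcancel] at this
  · intro h
    refine h2 (le_antisymm (fun u hu => ?_) fun u hu => ?_)
    · have : τ⁻¹ • u ∈ T.comap (DistribSMul.toAddMonoidHom U τ) := by
        change τ • τ⁻¹ • u ∈ T
        rwa [hcancel]
      rw [h] at this
      have := smul_mem_W τ this
      rwa [hcancel] at this
    · have : τ⁻¹ • u ∈ T.comap (DistribSMul.toAddMonoidHom U τ) := by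
        rw [h]; exact smul_mem_W _ hu
      have : τ • τ⁻¹ • u ∈ T := this
      rwa [hcancel] at this

/-- `T ∩ W = 0`, and `16 · 16 = 256` is the order of `U`. -/
theorem IsAdmissible.exists_add {T : AddSubgroup U} (h : IsAdmissible T) (hT : Nat.card T = 16)
    (u : U) : ∃ t ∈ T, ∃ w ∈ W, u = t + w := by
  let f : T × N → U := fun x => x.1 + U.mk x.2 x.2
  have hinj : Function.Injective f := by
    rintro ⟨⟨t, ht⟩, n⟩ ⟨⟨t', ht'⟩, n'⟩ hf
    have hf : t + U.mk n n = t' + U.mk n' n' := hf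
    have h1 : t - t' = U.mk n' n' - U.mk n n := by
      rw [sub_eq_sub_iff_add_eq_add, hf, add_comm]
    have h2 : t - t' = 0 := h.eq_zero_of_mem_W _ (T.sub_mem ht ht') (by
      rw [h1]; exact W.sub_mem rfl rfl)
    have h3 : t = t' := sub_eq_zero.1 h2
    subst h3
    have h4 : U.mk n n = U.mk n' n' := add_left_cancel hf
    have h5 : n = n' := congrArg Prod.fst h4
    rw [h5]
  obtain ⟨⟨t, n⟩, rfl⟩ := (hinj.bijective_of_nat_card_le (by
    rw [Nat.card_prod, hT, Nat.card_eq_fintype_card, Nat.card_eq_fintype_card, card_eq,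
      card_N])).2 u
  exact ⟨t, t.2, U.mk n n, rfl, rfl⟩

end U
end BolLoops
namespace BolLoops

/-! ### The group `𝓖` -/

namespace BigGroup

variable {G : Type*} [Group G] {ρ : G →* Equiv.Perm (Fin 5)} {k : ℕ}

/-- The component of an element of `𝓖` in `U ^ k`. -/
def vec (x : BigGroup ρ k) : Fin k → U := x.left.toAdd

/-- The element of `𝓖` with given components. -/
def el (ρ : G →* Equiv.Perm (Fin 5)) (u : Fin k → U) (g : G) : BigGroup ρ k :=
  ⟨Multiplicative.ofAdd u, g⟩

@[simp] theorem vec_el (u : Fin k → U) (g : G) : vec (el ρ u g) = u := rfl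
@[simp] theorem right_el (u : Fin k → U) (g : G) : (el ρ u g).right = g := rfl
@[simp] theorem vec_mul (x y : BigGroup ρ k) : vec (x * y) = vec x + ρ x.right • vec y := rfl
@[simp] theorem vec_one : vec (1 : BigGroup ρ k) = 0 := rfl
@[simp] theorem vec_inv (x : BigGroup ρ k) : vec x⁻¹ = (ρ x.right)⁻¹ • -vec x := by
  rw [← map_inv]; rfl
@[simp] theorem vec_inr (g : G) : vec (SemidirectProduct.inr g : BigGroup ρ k) = 0 := rfl

theorem ext' {x y : BigGroup ρ k} (h1 : vec x = vec y) (h2 : x.right = y.right) : x = y :=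
  SemidirectProduct.ext h1 h2

theorem neg_vec (u : Fin k → U) : -u = u := funext fun j => U.neg_eq (u j)

theorem vec_add_self (u : Fin k → U) : u + u = 0 := funext fun j => U.add_self (u j)

/-- The elements of `𝓖` outside the subgroup of index `2` that are involutions. -/
def IsOddInvolution (x : BigGroup ρ k) : Prop :=
  x * x = 1 ∧ Equiv.Perm.sign (ρ x.right) = -1

theorem IsOddInvolution.conj {x : BigGroup ρ k} (hx : IsOddInvolution x) (g : BigGroup ρ k) :
    IsOddInvolution (g * x * g⁻¹) := by
  refine ⟨by rw [conj_mul, hx.1]; simp, ?_⟩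
  simp [hx.2]

theorem IsOddInvolution.right_sq {x : BigGroup ρ k} (hx : IsOddInvolution x) :
    x.right * x.right = 1 := by
  rw [← SemidirectProduct.mul_right, hx.1]; rfl

theorem IsOddInvolution.smul_vec {x : BigGroup ρ k} (hx : IsOddInvolution x) :
    ρ x.right • vec x = vec x := by
  have := congrArg vec hx.1
  rw [vec_mul, vec_one] at this
  rw [← neg_eq_of_add_eq_zero_right this, neg_vec]

theorem IsOddInvolution.exists_swap {x : BigGroup ρ k} (hx : IsOddInvolution x) :
    ∃ a b, a ≠ b ∧ ρ x.right = Equiv.swap a b :=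
  exists_swap_of_odd_involution _ (by rw [← map_mul, hx.right_sq, map_one]) hx.2

theorem conj_inr (u : Fin k → U) (g : G) :
    el ρ u 1 * SemidirectProduct.inr g * (el ρ u 1)⁻¹ = el ρ (u + ρ g • u) g := by
  apply ext'
  · simp [neg_vec]
  · simp

/-- An odd permutation `g` exchanges the two copies of `N`. A vector fixed by `g` is therefore `(n,
g n) = (n, 0) + g (n, 0)`, and conjugation by the vector `(n, 0)` in each coordinate removes it. The
rest is `ExtData.isConj_of_odd`. -/
theorem conjugatesOf_inr_of_odd {J : Subgroup G} (E : ExtData J ρ) {c : G} (hc : c * c = 1)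
    (hρc : Equiv.Perm.sign (ρ c) = -1) :
    conjugatesOf (SemidirectProduct.inr c : BigGroup ρ k) = {x | IsOddInvolution x} := by
  ext x
  constructor
  · intro hx
    obtain ⟨g, rfl⟩ := isConj_iff.1 hx
    have h1 : IsOddInvolution (SemidirectProduct.inr c : BigGroup ρ k) :=
      ⟨by rw [← map_mul, hc, map_one], hρc⟩
    exact h1.conj g
  · intro hx
    have hx : IsOddInvolution x := hx
    obtain ⟨g, hg⟩ := isConj_iff.1 (E.isConj_of_odd hx.right_sq hc hx.2 hρc)
    have h1 : IsConj (SemidirectProduct.inr c : BigGroup ρ k) (SemidirectProduct.inr x.right) :=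
      isConj_iff.2 ⟨SemidirectProduct.inr g, by rw [← map_mul, ← map_inv, ← map_mul, hg]⟩
    refine h1.trans (isConj_iff.2 ⟨el ρ (fun j => U.mk (vec x j).1 0) 1, ?_⟩)
    rw [conj_inr]
    refine ext' (funext fun j => ?_) rfl
    have h2 : ρ x.right • vec x j = vec x j := congrFun hx.smul_vec j
    rw [U.smul_of_odd hx.2] at h2
    have h3 : ρ x.right • (vec x j).1 = (vec x j).2 := congrArg Prod.snd h2
    rw [vec_el, Pi.add_apply, Pi.smul_apply, U.smul_of_odd hx.2]
    apply U.ext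
    · rw [U.add_fst, U.mk_fst, U.mk_fst, U.mk_snd, smul_zero, add_zero]
    · rw [U.add_snd, U.mk_snd, U.mk_snd, U.mk_fst, zero_add, h3]

/-- The elements over the kernel of `ρ` are involutions. -/
theorem mul_self_of_ker {J : Subgroup G} (E : ExtData J ρ) {x : BigGroup ρ k}
    (hx : ρ x.right = 1) : x * x = 1 := by
  refine ext' ?_ ?_
  · rw [vec_mul, hx, one_smul, vec_add_self, vec_one]
  · obtain ⟨v, hv⟩ := (E.mem_ker _).1 hx
    rw [SemidirectProduct.mul_right, ← hv, E.j_sq]; rfl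

end BigGroup

open BigGroup

/-! ### The set `𝓚` -/

/-- The coordinatewise form separates the two regimes: the `i`-th coordinate is taken from `S` if
all others vanish and from `W` otherwise. -/
theorem mem_tildeW_iff {k : ℕ} (i : Fin k) (w : Fin k → U) : w ∈ tildeW i ↔
    (∀ j, j ≠ i → w j ∈ U.W) ∧ ((∀ j, j ≠ i → w j = 0) → w i ∈ U.S) ∧
      ((∃ j, j ≠ i ∧ w j ≠ 0) → w i ∈ U.W) := by
  have hsingle : (∀ j, j ≠ i → w j = 0) → w = Pi.single i (w i) := by
    intro h
    funext j
    by_cases hj : j = i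
    · subst hj; simp
    · rw [h j hj, Pi.single_eq_of_ne hj]
  constructor
  · rintro (⟨hw, hw'⟩ | ⟨s, hs, rfl⟩)
    · refine ⟨fun j _ => hw j, fun h => ?_, fun _ => hw i⟩
      exact absurd ⟨w i, hw i, (hsingle h).symm⟩ hw'
    · refine ⟨fun j hj => ?_, fun _ => by simpa using hs, ?_⟩
      · rw [Pi.single_eq_of_ne hj]; exact U.W.zero_mem
      · rintro ⟨j, hj, h⟩
        exact absurd (Pi.single_eq_of_ne hj _) h
  · rintro ⟨h1, h2, h3⟩
    by_cases h : ∀ j, j ≠ i → w j = 0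
    · right
      exact ⟨w i, h2 h, (hsingle h).symm⟩
    · left
      push Not at h
      refine ⟨fun j => ?_, ?_⟩
      · by_cases hj : j = i
        · subst hj; exact h3 h
        · exact h1 j hj
      · rintro ⟨s, hs, rfl⟩
        obtain ⟨j, hj, hj'⟩ := h
        exact hj' (Pi.single_eq_of_ne hj _)

theorem smul_mem_tildeW {k : ℕ} {i : Fin k} {w : Fin k → U} (σ : Equiv.Perm (Fin 5))
    (h : w ∈ tildeW i) : σ • w ∈ tildeW i := by
  rw [mem_tildeW_iff] at *
  obtain ⟨h1, h2, h3⟩ := h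
  refine ⟨fun j hj => U.smul_mem_W σ (h1 j hj), fun h => U.smul_mem_S σ (h2 fun j hj => ?_), ?_⟩
  · have := h j hj
    rwa [Pi.smul_apply, smul_eq_zero_iff_eq] at this
  · rintro ⟨j, hj, hj'⟩
    refine U.smul_mem_W σ (h3 ⟨j, hj, fun h => hj' ?_⟩)
    rw [Pi.smul_apply, h, smul_zero]

theorem zero_mem_tildeW {k : ℕ} (i : Fin k) : (0 : Fin k → U) ∈ tildeW i := by
  rw [mem_tildeW_iff]
  exact ⟨fun j _ => U.W.zero_mem, fun _ => Or.inl rfl, fun _ => U.W.zero_mem⟩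

section Folder

variable {G : Type*} [Group G] {J : Subgroup G} {ρ : G →* Equiv.Perm (Fin 5)} {k : ℕ}

theorem ExtData.normal (E : ExtData J ρ) : J.Normal := by
  rw [← E.ker]; infer_instance

theorem ExtData.conj_mem_J₀ (E : ExtData J ρ) {v : G} (hv : v ∈ J₀ J) (g : G) :
    g * v * g⁻¹ ∈ J₀ J := by
  have := E.normal
  exact Subgroup.Normal.conj_mem inferInstance v hv g

theorem ExtData.ρ_of_mem_J₀ (E : ExtData J ρ) {v : G} (hv : v ∈ J₀ J) : ρ v = 1 :=
  J₀_le_ker E.ker hv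

theorem mem_bigK_iff (E : ExtData J ρ) {c : G} (hc : c * c = 1)
    (hρc : Equiv.Perm.sign (ρ c) = -1) (i : Fin k) (x : BigGroup ρ k) :
    x ∈ bigK ρ c J i ↔ IsOddInvolution x ∨ (x.right ∈ J₀ J ∧ vec x ∈ tildeW i) := by
  rw [bigK, conjugatesOf_inr_of_odd E hc hρc]
  refine or_congr_right ?_
  have hel : ∀ v ∈ J₀ J, ∀ w : Fin k → U,
      (SemidirectProduct.inr v * SemidirectProduct.inl (Multiplicative.ofAdd w) : BigGroup ρ k) =
        el ρ w v := by
    intro v hv w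
    apply ext'
    · rw [vec_mul, vec_inr, zero_add]
      change ρ v • w = w
      rw [E.ρ_of_mem_J₀ hv, one_smul]
    · simp
  constructor
  · rintro ⟨v, hv, w, hw, rfl⟩
    rw [hel v hv]
    exact ⟨hv, hw⟩
  · rintro ⟨h1, h2⟩
    exact ⟨_, h1, _, h2, (hel _ h1 _).symm⟩

theorem conj_mem_bigK (E : ExtData J ρ) {c : G} (hc : c * c = 1)
    (hρc : Equiv.Perm.sign (ρ c) = -1) {i : Fin k} {x : BigGroup ρ k}
    (hx : x ∈ bigK ρ c J i) (g : BigGroup ρ k) : g * x * g⁻¹ ∈ bigK ρ c J i := by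
  rw [mem_bigK_iff E hc hρc] at *
  rcases hx with hx | ⟨h1, h2⟩
  · exact Or.inl (hx.conj g)
  · refine Or.inr ⟨E.conj_mem_J₀ h1 g.right, ?_⟩
    have : vec (g * x * g⁻¹) = ρ g.right • vec x := by
      rw [vec_mul, vec_mul, vec_inv, SemidirectProduct.mul_right, map_mul, E.ρ_of_mem_J₀ h1,
        mul_one, smul_inv_smul, neg_vec, add_right_comm, vec_add_self, zero_add]
    rw [this]
    exact smul_mem_tildeW _ h2

theorem mul_self_of_mem_bigK (E : ExtData J ρ) {c : G} (hc : c * c = 1)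
    (hρc : Equiv.Perm.sign (ρ c) = -1) {i : Fin k} {x : BigGroup ρ k}
    (hx : x ∈ bigK ρ c J i) : x * x = 1 := by
  rw [mem_bigK_iff E hc hρc] at hx
  rcases hx with hx | ⟨h1, h2⟩
  · exact hx.1
  · exact mul_self_of_ker E (E.ρ_of_mem_J₀ h1)

theorem one_mem_bigK (E : ExtData J ρ) {c : G} (hc : c * c = 1)
    (hρc : Equiv.Perm.sign (ρ c) = -1) (i : Fin k) : (1 : BigGroup ρ k) ∈ bigK ρ c J i := by
  rw [mem_bigK_iff E hc hρc]
  exact Or.inr ⟨Subgroup.one_mem _, zero_mem_tildeW i⟩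

theorem isUnionOfInvolutionClasses_bigK (E : ExtData J ρ) {c : G} (hc : c * c = 1)
    (hρc : Equiv.Perm.sign (ρ c) = -1) (i : Fin k) :
    IsUnionOfInvolutionClasses (bigK ρ c J i) := by
  refine ⟨bigK ρ c J i \ {1}, fun a ha => ?_, ?_⟩
  · exact orderOf_eq_prime (by rw [sq, mul_self_of_mem_bigK E hc hρc ha.1]) ha.2
  · ext x
    simp only [Set.mem_union, Set.mem_singleton_iff, Set.mem_iUnion]
    constructor
    · intro hx
      by_cases h : x = 1
      · exact Or.inl h
      · exact Or.inr ⟨x, ⟨hx, h⟩, IsConj.refl x⟩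
    · rintro (rfl | ⟨a, ha, hx⟩)
      · exact one_mem_bigK E hc hρc i
      · obtain ⟨g, rfl⟩ := isConj_iff.1 hx
        exact conj_mem_bigK E hc hρc ha.1 g

/-! ### The subgroup `𝓗` -/

/-- The hypotheses on `H`, `T` and `ψ`. -/
structure IsTwist (E : ExtData J ρ) (H : Subgroup G) (q : Fin 6) (T : Submodule (ZMod 2) U)
    (ψ : Additive (J₀ J) ≃+ T) : Prop where
  point : IsPointNormalizer E H q
  admissible : U.IsAdmissible T.toAddSubgroup
  smul_mem : ∀ h ∈ H, ∀ u ∈ T, ρ h • u ∈ T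
  equivariant : ∀ h ∈ H, ∀ v v' : J₀ J, (v' : G) = h * v * h⁻¹ →
    (ψ (Additive.ofMul v') : U) = ρ h • (ψ (Additive.ofMul v) : U)

variable {E : ExtData J ρ} {H : Subgroup G} {q : Fin 6} {T : Submodule (ZMod 2) U}
  {ψ : Additive (J₀ J) ≃+ T}

theorem ψ_mul (ψ : Additive (J₀ J) ≃+ T) (v w : J₀ J) : (ψ (Additive.ofMul (v * w)) : U) =
    ψ (Additive.ofMul v) + ψ (Additive.ofMul w) := by
  rw [ofMul_mul, map_add]; rfl

theorem ψ_eq_zero (ψ : Additive (J₀ J) ≃+ T) (v : J₀ J) (h : (ψ (Additive.ofMul v) : U) = 0) :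
    v = 1 := by
  have : ψ (Additive.ofMul v) = 0 := Subtype.ext h
  rw [EmbeddingLike.map_eq_zero_iff] at this
  exact this

theorem ψ_inv (ψ : Additive (J₀ J) ≃+ T) (v : J₀ J) : (ψ (Additive.ofMul v⁻¹) : U) =
    ψ (Additive.ofMul v) := by
  rw [ofMul_inv, map_neg, Submodule.coe_neg, U.neg_eq]

/-- Every element of `𝓗` is one of `𝓣_ψ` times one of `H`. Such products form a subgroup because `H`
stabilizes `T` and `ψ` is equivariant. -/
theorem IsTwist.mem_bigH (A : IsTwist E H q T ψ) (i : Fin k) (x : BigGroup ρ k) :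
    x ∈ bigH H E.ker i ψ ↔ ∃ v : J₀ J, ∃ h ∈ H, x.right = v * h ∧
      (∀ j, j ≠ i → vec x j ∈ T) ∧ vec x i = ψ (Additive.ofMul v) := by
  constructor
  · let S : Subgroup (BigGroup ρ k) :=
      { carrier := {x | ∃ v : J₀ J, ∃ h ∈ H, x.right = v * h ∧
          (∀ j, j ≠ i → vec x j ∈ T) ∧ vec x i = ψ (Additive.ofMul v)}
        one_mem' := ⟨1, 1, H.one_mem, by simp, fun j _ => T.zero_mem, by simp⟩
        mul_mem' := by
          rintro x y ⟨v, h, hh, h1, h2, h3⟩ ⟨v', h', hh', h1', h2', h3'⟩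
          have hρ : ρ x.right = ρ h := by rw [h1, map_mul, E.ρ_of_mem_J₀ v.2, one_mul]
          refine ⟨v * ⟨h * v' * h⁻¹, E.conj_mem_J₀ v'.2 h⟩, h * h', H.mul_mem hh hh', ?_,
            fun j hj => ?_, ?_⟩
          · rw [SemidirectProduct.mul_right, h1, h1', Subgroup.coe_mul]; group
          · rw [vec_mul, hρ]
            exact T.add_mem (h2 j hj) (A.smul_mem h hh _ (h2' j hj))
          · rw [vec_mul, hρ, ψ_mul, A.equivariant h hh v' ⟨h * v' * h⁻¹, E.conj_mem_J₀ v'.2 h⟩ rfl, Pi.add_apply, Pi.smul_apply,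
              h3, h3']
        inv_mem' := by
          rintro x ⟨v, h, hh, h1, h2, h3⟩
          have hρ : (ρ x.right)⁻¹ = ρ h⁻¹ := by
            rw [h1, map_mul, E.ρ_of_mem_J₀ v.2, one_mul, map_inv]
          refine ⟨⟨h⁻¹ * (v : G)⁻¹ * h⁻¹⁻¹, E.conj_mem_J₀ (Subgroup.inv_mem _ v.2) h⁻¹⟩, h⁻¹, H.inv_mem hh, ?_,
            fun j hj => ?_, ?_⟩
          · rw [SemidirectProduct.inv_right, h1]; group
          · rw [vec_inv, hρ, neg_vec]
            exact A.smul_mem _ (H.inv_mem hh) _ (h2 j hj)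
          · rw [vec_inv, hρ, neg_vec, A.equivariant h⁻¹ (H.inv_mem hh) v⁻¹
              ⟨h⁻¹ * (v : G)⁻¹ * h⁻¹⁻¹, E.conj_mem_J₀ (Subgroup.inv_mem _ v.2) h⁻¹⟩ rfl, Pi.smul_apply,
              h3, ψ_inv] }
    suffices h : bigH H E.ker i ψ ≤ S from fun hx => h hx
    refine sup_le ?_ ?_
    · rintro _ ⟨h, hh, rfl⟩
      exact ⟨1, h, hh, by simp, fun j _ => T.zero_mem, by simp⟩
    · rintro x ⟨v, hv, u, hu, hui, hx⟩
      have hx : vec x = Pi.single i (ψ (Additive.ofMul v) : U) + u := hx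
      refine ⟨v, 1, H.one_mem, by simpa using hv, fun j hj => ?_, ?_⟩
      · rw [hx, Pi.add_apply, Pi.single_eq_of_ne hj, zero_add]; exact hu j
      · rw [hx, Pi.add_apply, Pi.single_eq_same, hui, add_zero]
  · rintro ⟨v, h, hh, h1, h2, h3⟩
    have hx : x = el ρ (vec x) v * SemidirectProduct.inr h := by
      apply ext'
      · simp
      · simp [h1]
    rw [hx]
    refine mul_mem (Subgroup.mem_sup_right ?_) (Subgroup.mem_sup_left ⟨h, hh, rfl⟩)
    refine ⟨v, rfl, vec x - Pi.single i (ψ (Additive.ofMul v) : U), fun j => ?_, ?_, ?_⟩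
    · by_cases hj : j = i
      · subst hj
        rw [Pi.sub_apply, Pi.single_eq_same, h3, sub_self]; exact T.zero_mem
      · rw [Pi.sub_apply, Pi.single_eq_of_ne hj, sub_zero]; exact h2 j hj
    · rw [Pi.sub_apply, Pi.single_eq_same, h3, sub_self]
    · rw [add_sub_cancel]; rfl

theorem IsTwist.act6_of_mem_bigH (A : IsTwist E H q T ψ) {i : Fin k} {x : BigGroup ρ k}
    (hx : x ∈ bigH H E.ker i ψ) : act6 (ρ x.right) q = q := by
  obtain ⟨v, h, hh, h1, -, -⟩ := (A.mem_bigH i x).1 hx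
  rw [h1, map_mul, E.ρ_of_mem_J₀ v.2, one_mul]
  exact A.point.fix h hh

theorem swap_not_fix_single (a b : Fin 5) (hab : a ≠ b) (q : Fin 6) :
    ¬ ∃ e, ∀ p, (Pi.single q 1 : Fin 6 → ZMod 2) ((act6 (Equiv.swap a b))⁻¹ p) +
      (Pi.single q 1 : Fin 6 → ZMod 2) p = e := by
  revert a b q; decide +kernel

/-- The odd elements of `F₂₀` are `4`-cycles. -/
theorem act6_swap_ne (a b : Fin 5) (hab : a ≠ b) (q : Fin 6) : act6 (Equiv.swap a b) q ≠ q := by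
  revert a b q; decide +kernel

theorem sq_or_pow_five_of_fix (σ : Equiv.Perm (Fin 5)) (q : Fin 6) (h : act6 σ q = q)
    (h1 : Equiv.Perm.sign σ = 1) : σ * σ = 1 ∨ σ ^ 5 = 1 := by
  revert σ q; decide +kernel

/-- The even part of `F₂₀` is dihedral of order `10`, and a product of two transpositions moves at
most four points, so it is no `5`-cycle. -/
theorem swap_mul_swap_sq (a b c d : Fin 5) (hab : a ≠ b) (hcd : c ≠ d) (q : Fin 6)
    (h : act6 (Equiv.swap a b * Equiv.swap c d) q = q) :
    (Equiv.swap a b * Equiv.swap c d) * (Equiv.swap a b * Equiv.swap c d) = 1 := by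
  refine (sq_or_pow_five_of_fix _ q h ?_).elim id fun h5 => ?_
  · rw [map_mul, Equiv.Perm.sign_swap hab, Equiv.Perm.sign_swap hcd]; rfl
  · clear h hab hcd
    revert a b c d; decide +kernel

/-- An element of `𝓗` over the kernel of `ρ` that commutes with an odd involution is trivial. -/
theorem IsTwist.eq_one_of_commute (A : IsTwist E H q T ψ) {i : Fin k} {x a : BigGroup ρ k}
    (hx : x ∈ bigH H E.ker i ψ) (hρ : ρ x.right = 1) (ha : IsOddInvolution a)
    (hax : a * x = x * a) : x = 1 := by
  obtain ⟨v, h, hh, h1, h2, h3⟩ := (A.mem_bigH i x).1 hx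
  obtain ⟨b, d, hbd, hτ⟩ := ha.exists_swap
  have hfix : ρ a.right • vec x = vec x := by
    have := congrArg vec hax
    rw [vec_mul, vec_mul, hρ, one_smul, add_comm] at this
    exact add_right_cancel this
  have hT : ∀ j, vec x j ∈ T := by
    intro j
    by_cases hj : j = i
    · subst hj; rw [h3]; exact (ψ _).2
    · exact h2 j hj
  have h0 : vec x = 0 := funext fun j =>
    A.admissible.eq_zero_of_swap _ (hT j) b d hbd (by rw [← hτ]; exact congrFun hfix j)
  have hv : v = 1 := ψ_eq_zero ψ v (by rw [← h3, h0]; rfl)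
  rw [hv, Subgroup.coe_one, one_mul] at h1
  refine ext' h0 (h1.trans ?_)
  -- Only `e_q` remains to be excluded. The transposition moves the point `q` and hence does not fix
  -- `e_q` modulo constants.
  rcases A.point.mem_of_fix h hh (h1 ▸ hρ) with rfl | rfl
  · rfl
  · exfalso
    have h4 := congrArg SemidirectProduct.right hax
    rw [SemidirectProduct.mul_right, SemidirectProduct.mul_right, ← mul_inv_eq_iff_eq_mul, h1,
      E.j_conj, E.j_eq_iff, hτ] at h4
    exact swap_not_fix_single b d hbd q h4

/-- `e_q` is odd, and on six points adding a constant does not change the parity. -/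
theorem IsTwist.eq_one_of_mem_J₀ (A : IsTwist E H q T ψ) {h : G} (hh : h ∈ H)
    (hJ : h ∈ J₀ J) : h = 1 := by
  rcases A.point.mem_of_fix h hh (E.ρ_of_mem_J₀ hJ) with rfl | rfl
  · rfl
  · exfalso
    obtain ⟨v, hv, h⟩ := (E.mem_J₀ _).1 hJ
    obtain ⟨a, ha⟩ := (E.j_eq_iff _ _).1 h
    have h1 : ∑ p, (v p + (Pi.single q 1 : Fin 6 → ZMod 2) p) = ∑ _p : Fin 6, a :=
      Finset.sum_congr rfl fun p _ => ha p
    rw [Finset.sum_add_distrib, hv, zero_add, Finset.sum_pi_single', Finset.sum_const] at h1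
    rw [if_pos (Finset.mem_univ q), Finset.card_univ, Fintype.card_fin] at h1
    have h2 : ∀ a : ZMod 2, 1 ≠ 6 • a := by decide
    exact h2 a h1

/-- The core of the folder property: different elements of `𝓚` lie in different cosets of `𝓗`. The
cases are distinguished by which of `x, y` are odd involutions. -/
theorem IsTwist.injective (A : IsTwist E H q T ψ) {c : G} (hc : c * c = 1)
    (hρc : Equiv.Perm.sign (ρ c) = -1) {i : Fin k} {x y : BigGroup ρ k}
    (hx : x ∈ bigK ρ c J i) (hy : y ∈ bigK ρ c J i) (hxy : x * y⁻¹ ∈ bigH H E.ker i ψ) :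
    x = y := by
  have hfix := A.act6_of_mem_bigH hxy
  rw [mem_bigK_iff E hc hρc] at hx hy
  rcases hx with hx | ⟨hx1, hx2⟩ <;> rcases hy with hy | ⟨hy1, hy2⟩
  · have hy' : y⁻¹ = y := inv_eq_of_mul_eq_one_left hy.1
    rw [hy'] at hxy hfix
    obtain ⟨a, b, hab, hτ⟩ := hx.exists_swap
    obtain ⟨c, d, hcd, hτ'⟩ := hy.exists_swap
    have hρs : ρ (x * y).right = Equiv.swap a b * Equiv.swap c d := by
      rw [SemidirectProduct.mul_right, map_mul, hτ, hτ']
    have hρss : ρ ((x * y) * (x * y)).right = 1 := by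
      rw [SemidirectProduct.mul_right, map_mul, hρs]
      rw [hρs] at hfix
      exact swap_mul_swap_sq a b c d hab hcd q hfix
    have hss : (x * y) * (x * y) = 1 := by
      refine A.eq_one_of_commute (mul_mem hxy hxy) hρss hx ?_
      -- The involution `x` inverts `x y`, and `(x y)²` is its own inverse, so `x` commutes with `(x
      -- y)²`.
      have h4 := mul_self_of_ker E hρss
      have h5 : (x * y * (x * y)) = (y * x) * (y * x) := by
        rw [eq_inv_of_mul_eq_one_left h4]
        simp only [mul_inv_rev, hy', inv_eq_of_mul_eq_one_left hx.1]
      calc x * (x * y * (x * y)) = x * (y * x * (y * x)) := by rw [h5]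
        _ = x * y * (x * y) * x := by simp only [mul_assoc]
    -- Nonsplitness enters here: an even element whose square lies in `J₀` lies over `1`.
    have hρ1 : ρ (x * y).right = 1 := by
      refine E.sq_mem _ ?_ ?_
      · rw [SemidirectProduct.mul_right, map_mul, map_mul, hx.2, hy.2]; decide
      · have := congrArg SemidirectProduct.right hss
        rw [SemidirectProduct.mul_right] at this
        rw [this]; exact Subgroup.one_mem _
    have h1 : x * y = 1 := by
      refine A.eq_one_of_commute hxy hρ1 hx ?_
      have h6 : x * y = y * x := by
        rw [eq_inv_of_mul_eq_one_left hss, mul_inv_rev, hy', inv_eq_of_mul_eq_one_left hx.1]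
      rw [h6]
      simp only [mul_assoc]
      rw [← mul_assoc, h6, mul_assoc]
    rw [eq_inv_of_mul_eq_one_left h1, hy']
  · exfalso
    obtain ⟨a, b, hab, hτ⟩ := hx.exists_swap
    rw [SemidirectProduct.mul_right, SemidirectProduct.inv_right, map_mul, map_inv,
      E.ρ_of_mem_J₀ hy1, inv_one, mul_one, hτ] at hfix
    exact act6_swap_ne a b hab q hfix
  · exfalso
    obtain ⟨a, b, hab, hτ⟩ := hy.exists_swap
    rw [SemidirectProduct.mul_right, SemidirectProduct.inv_right, map_mul, map_inv,
      E.ρ_of_mem_J₀ hx1, one_mul, hτ, Equiv.swap_inv] at hfix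
    exact act6_swap_ne a b hab q hfix
  · obtain ⟨v, h, hh, h1, h2, h3⟩ := (A.mem_bigH i _).1 hxy
    have hvec : vec (x * y⁻¹) = vec x + vec y := by
      rw [vec_mul, vec_inv, E.ρ_of_mem_J₀ hx1, E.ρ_of_mem_J₀ hy1, inv_one, one_smul, one_smul,
        neg_vec]
    rw [SemidirectProduct.mul_right, SemidirectProduct.inv_right] at h1
    have hh1 : h = 1 := by
      refine A.eq_one_of_mem_J₀ hh ?_
      have : h = (v : G)⁻¹ * (x.right * y.right⁻¹) := by rw [h1, inv_mul_cancel_left]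
      rw [this]
      exact Subgroup.mul_mem _ (Subgroup.inv_mem _ v.2)
        (Subgroup.mul_mem _ hx1 (Subgroup.inv_mem _ hy1))
    rw [hvec] at h2 h3
    rw [mem_tildeW_iff] at hx2 hy2
    obtain ⟨p1, p2, p3⟩ := hx2
    obtain ⟨r1, r2, r3⟩ := hy2
    have heq : ∀ u v : U, u + v = 0 → u = v := fun u v h => by
      rw [← U.sub_eq] at h; exact sub_eq_zero.1 h
    have hne : ∀ j, j ≠ i → vec x j = vec y j := fun j hj =>
      heq _ _ (A.admissible.eq_zero_of_mem_W _ (h2 j hj) (U.W.add_mem (p1 j hj) (r1 j hj)))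
    have hiT : vec x i + vec y i ∈ T := by
      have : vec x i + vec y i = ψ (Additive.ofMul v) := h3
      rw [this]; exact (ψ _).2
    -- By `hne` the other coordinates agree, so both `i`-th coordinates lie in `S` or both in `W`.
    -- Neither set has two elements that differ by a nonzero vector of `T`.
    have hi : vec x i = vec y i := by
      by_cases h0 : ∀ j, j ≠ i → vec x j = 0
      · exact A.admissible.eq_of_mem_S _ (p2 h0) _
          (r2 fun j hj => by rw [← hne j hj, h0 j hj]) hiT
      · push Not at h0
        have h0' : ∃ j, j ≠ i ∧ vec y j ≠ 0 := by
          obtain ⟨j, hj, h⟩ := h0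
          exact ⟨j, hj, by rwa [← hne j hj]⟩
        exact heq _ _ (A.admissible.eq_zero_of_mem_W _ hiT (U.W.add_mem (p3 h0) (r3 h0')))
    have hall : vec x = vec y := funext fun j => by
      by_cases hj : j = i
      · subst hj; exact hi
      · exact hne j hj
    refine ext' hall ?_
    have hv : v = 1 := ψ_eq_zero ψ v (by rw [← h3, hall, vec_add_self]; rfl)
    rw [hh1, hv, Subgroup.coe_one, one_mul, mul_inv_eq_one] at h1
    exact h1

end Folder

end BolLoops
namespace BolLoops
open BigGroup

/-! ### The loop folder -/

section Folder

variable {G : Type*} [Group G] {J : Subgroup G} {ρ : G →* Equiv.Perm (Fin 5)} {k : ℕ}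
  {E : ExtData J ρ} {H : Subgroup G} {q : Fin 6} {T : Submodule (ZMod 2) U}
  {ψ : Additive (J₀ J) ≃+ T}

theorem ExtData.j_injOn (E : ExtData J ρ) {v w : Fin 6 → ZMod 2} (hv : v 0 = 0) (hw : w 0 = 0)
    (h : E.j v = E.j w) : v = w := by
  obtain ⟨a, ha⟩ := (E.j_eq_iff v w).1 h
  funext p
  have h0 := ha 0
  rw [hv, hw, add_zero] at h0
  exact CharTwo.add_eq_zero.1 ((ha p).trans h0.symm)

theorem ExtData.card_J₀ (E : ExtData J ρ) : Nat.card (J₀ J) = 16 := by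
  let f : {v : Fin 6 → ZMod 2 // v 0 = 0 ∧ ∑ p, v p = 0} → J₀ J := fun v =>
    ⟨E.j v, (E.mem_J₀ _).2 ⟨v, v.2.2, rfl⟩⟩
  have hf : Function.Bijective f := by
    refine ⟨fun v w h => Subtype.ext (E.j_injOn v.2.1 w.2.1 (congrArg Subtype.val h)), ?_⟩
    rintro ⟨x, hx⟩
    obtain ⟨v, hv, rfl⟩ := (E.mem_J₀ x).1 hx
    refine ⟨⟨v + fun _ => v 0, CharTwo.add_self_eq_zero _, ?_⟩, Subtype.ext ?_⟩
    · simp only [Pi.add_apply, Finset.sum_add_distrib, hv, zero_add, Finset.sum_const]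
      generalize v 0 = a
      revert a; decide
    · refine (E.j_eq_iff _ _).2 ⟨v 0, fun p => ?_⟩
      change v p + v 0 + v p = v 0
      rw [add_right_comm, CharTwo.add_self_eq_zero, zero_add]
  rw [← Nat.card_eq_of_bijective f hf, Nat.card_eq_fintype_card]
  decide +kernel

theorem ExtData.finite_bigGroup (E : ExtData J ρ) (k : ℕ) : Finite (BigGroup ρ k) := by
  have := E.finite
  have : Finite (Multiplicative (Fin k → U)) := inferInstanceAs (Finite (Fin k → U))
  exact Finite.of_equiv _ SemidirectProduct.equivProd.symm

theorem ExtData.card_bigGroup (E : ExtData J ρ) (k : ℕ) :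
    Nat.card (BigGroup ρ k) = 3840 * 256 ^ k := by
  rw [SemidirectProduct.card, E.card_eq, mul_comm]
  congr 1
  change Nat.card (Fin k → U) = _
  rw [Nat.card_eq_fintype_card, Fintype.card_pi, Finset.prod_const, U.card_eq, Finset.card_univ,
    Fintype.card_fin]

theorem card_fun_N (k : ℕ) : Nat.card (Fin k → N) = 16 ^ k := by
  rw [Nat.card_eq_fintype_card, Fintype.card_pi, Finset.prod_const, U.card_N, Finset.card_univ,
    Fintype.card_fin]

/-- An injection into `(𝓦 \ W*) ∪ S*`. -/
theorem exists_embedding_tildeW {k : ℕ} (i : Fin k) :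
    ∃ f : (Fin k → N) → Fin k → U, Function.Injective f ∧ ∀ n, f n ∈ tildeW i := by
  classical
  obtain ⟨s, hs, hsS⟩ := U.exists_embedding_S
  let f : (Fin k → N) → Fin k → U := fun n =>
    if ∀ j, j ≠ i → n j = 0 then Pi.single i (s (n i)) else fun j => U.mk (n j) (n j)
  have hf : ∀ n j, j ≠ i → f n j = U.mk (n j) (n j) := by
    intro n j hj
    simp only [f]
    split_ifs with h
    · rw [Pi.single_eq_of_ne hj, h j hj]; rfl
    · rfl
  refine ⟨f, fun n n' h => ?_, fun n => ?_⟩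
  · have h1 : ∀ j, j ≠ i → n j = n' j := fun j hj => by
      have := congrFun h j
      rw [hf n j hj, hf n' j hj] at this
      exact congrArg Prod.fst this
    funext j
    by_cases hj : j = i
    · subst hj
      have h2 := congrFun h j
      simp only [f] at h2
      by_cases h0 : ∀ l, l ≠ j → n l = 0
      · have h0' : ∀ l, l ≠ j → n' l = 0 := fun l hl => by rw [← h1 l hl, h0 l hl]
        rw [if_pos h0, if_pos h0', Pi.single_eq_same, Pi.single_eq_same] at h2
        exact hs h2
      · have h0' : ¬ ∀ l, l ≠ j → n' l = 0 := fun h => h0 fun l hl => by rw [h1 l hl, h l hl]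
        rw [if_neg h0, if_neg h0'] at h2
        exact congrArg Prod.fst h2
    · exact h1 j hj
  · rw [mem_tildeW_iff]
    refine ⟨fun j hj => by rw [hf n j hj]; rfl, fun h => ?_, ?_⟩
    · have : ∀ j, j ≠ i → n j = 0 := fun j hj => by
        have := h j hj
        rw [hf n j hj] at this
        exact congrArg Prod.fst this
      simp only [f]
      rw [if_pos this, Pi.single_eq_same]
      exact hsS _
    · rintro ⟨j, hj, hj'⟩
      have : ¬ ∀ j, j ≠ i → n j = 0 := fun h => hj' (by rw [hf n j hj, h j hj]; rfl)
      simp only [f]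
      rw [if_neg this]
      rfl

theorem card_odd_involutions :
    Fintype.card {τ : Equiv.Perm (Fin 5) // τ * τ = 1 ∧ Equiv.Perm.sign τ = -1} = 10 := by
  decide +kernel

/-- There are `10` transpositions, `8` involutions of `G` over each, and `16 ^ k` fixed vectors `(n,
τ n)`; the other part contributes `16 · 16 ^ k`. Lower bounds suffice, since `IsTwist.injective`
supplies the reverse inequality. -/
theorem le_card_bigK (E : ExtData J ρ) {c : G} (hc : c * c = 1)
    (hρc : Equiv.Perm.sign (ρ c) = -1) (i : Fin k) :
    96 * 16 ^ k ≤ Nat.card (bigK ρ c J i) := by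
  have := E.finite_bigGroup k
  have := E.finite
  have hlift := fun τ : {τ : Equiv.Perm (Fin 5) // τ * τ = 1 ∧ Equiv.Perm.sign τ = -1} =>
    E.exists_lift hc hρc τ.2.1 τ.2.2
  choose a ha haρ using hlift
  obtain ⟨w, hw, hwW⟩ := exists_embedding_tildeW i
  let A := Σ τ : {τ : Equiv.Perm (Fin 5) // τ * τ = 1 ∧ Equiv.Perm.sign τ = -1},
    {v : Fin 6 → ZMod 2 // v 0 = 0 ∧ ∃ a, ∀ p, v ((act6 τ.1)⁻¹ p) + v p = a} × (Fin k → N)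
  have hρv : ∀ x : A, ρ (a x.1 * E.j x.2.1) = x.1 := fun x => by
    rw [map_mul, haρ, E.ρ_j, mul_one]
  let f : A → BigGroup ρ k := fun x =>
    el ρ (fun l => U.mk (x.2.2 l) (x.1.1 • x.2.2 l)) (a x.1 * E.j x.2.1)
  have hfD : ∀ x, IsOddInvolution (f x) := by
    intro x
    refine ⟨ext' ?_ ?_, ?_⟩
    · change _ + ρ (a x.1 * E.j x.2.1) • _ = (0 : Fin k → U)
      rw [hρv]
      funext l
      rw [Pi.add_apply, Pi.smul_apply]
      change U.mk _ _ + x.1.1 • U.mk _ _ = 0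
      rw [U.smul_of_odd x.1.2.2, U.mk_fst, U.mk_snd, ← mul_smul, x.1.2.1, one_smul, U.add_self]
    · change (a x.1 * E.j x.2.1) * (a x.1 * E.j x.2.1) = 1
      rw [E.mul_j_sq (ha _), haρ]
      exact x.2.1.2.2
    · change Equiv.Perm.sign (ρ (a x.1 * E.j x.2.1)) = -1
      rw [hρv]; exact x.1.2.2
  have hf : Function.Injective f := by
    rintro x y h
    have h1 : a x.1 * E.j x.2.1 = a y.1 * E.j y.2.1 := congrArg SemidirectProduct.right h
    have h2 : x.1 = y.1 := Subtype.ext (by rw [← hρv x, ← hρv y, h1])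
    have h3 := congrArg vec h
    rcases x with ⟨τ, ⟨v, hv⟩, n⟩
    rcases y with ⟨τ', ⟨v', hv'⟩, n'⟩
    obtain rfl : τ = τ' := h2
    have h4 := E.j_injOn hv.1 hv'.1 (mul_left_cancel h1)
    subst h4
    have h5 : n = n' := funext fun l => congrArg Prod.fst (congrFun h3 l)
    rw [h5]
  let g : A ⊕ (J₀ J × (Fin k → N)) → bigK ρ c J i := Sum.elim
    (fun x => ⟨f x, (mem_bigK_iff E hc hρc i _).2 (Or.inl (hfD x))⟩)
    (fun y => ⟨el ρ (w y.2) y.1, (mem_bigK_iff E hc hρc i _).2 (Or.inr ⟨y.1.2, hwW _⟩)⟩)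
  have hg : Function.Injective g := by
    refine Function.Injective.sumElim (fun x y h => hf (congrArg Subtype.val h)) ?_ ?_
    · rintro ⟨v, n⟩ ⟨v', n'⟩ h
      have h1 := congrArg Subtype.val h
      have h2 : v = v' := Subtype.ext (congrArg SemidirectProduct.right h1)
      have h3 : n = n' := hw (congrArg vec h1)
      rw [h2, h3]
    · rintro x ⟨v, n⟩ h
      have h1 := (hfD x).2
      have h2 : f x = el ρ (w n) v := congrArg Subtype.val h
      rw [h2, right_el, E.ρ_of_mem_J₀ v.2] at h1
      exact absurd h1 (by decide)
  have hcard := Nat.card_le_card_of_injective g hg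
  rw [Nat.card_sum, Nat.card_prod, E.card_J₀, card_fun_N, Nat.card_sigma] at hcard
  have hfib : ∀ τ : {τ : Equiv.Perm (Fin 5) // τ * τ = 1 ∧ Equiv.Perm.sign τ = -1},
      Nat.card ({v : Fin 6 → ZMod 2 // v 0 = 0 ∧ ∃ a, ∀ p, v ((act6 τ.1)⁻¹ p) + v p = a} ×
        (Fin k → N)) = 8 * 16 ^ k := fun τ => by
    rw [Nat.card_prod, card_fun_N, Nat.card_eq_fintype_card, card_fixed_vectors τ.1 τ.2.1 τ.2.2]
  simp only [hfib, Finset.sum_const, Finset.card_univ, card_odd_involutions, smul_eq_mul] at hcard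
  omega

theorem IsTwist.card_T (_ : IsTwist E H q T ψ) : Nat.card T = 16 := by
  rw [← E.card_J₀]
  exact (Nat.card_congr ψ.toEquiv).symm

theorem single_not_const (q : Fin 6) :
    ¬ ∃ a, ∀ p, (Pi.single q 1 : Fin 6 → ZMod 2) p = a := by
  revert q; decide +kernel

/-- The count is `20 · 2` for `H`, `16` for `J₀`, and `16 ^ (k - 1)` for the other summands. -/
theorem IsTwist.le_card_bigH (A : IsTwist E H q T ψ) (i : Fin k) :
    40 * 16 ^ k ≤ Nat.card (bigH H E.ker i ψ) := by
  have := E.finite_bigGroup k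
  choose h hH hρ using fun σ : {σ // act6 σ q = q} => A.point.surj σ.1 σ.2
  have hz : E.j (Pi.single q 1) ≠ 1 := fun h => single_not_const q ((E.j_eq_one _).1 h)
  let z : Bool → G := fun b => if b then E.j (Pi.single q 1) else 1
  have hzH : ∀ b, z b ∈ H := by
    intro b
    cases b
    · exact H.one_mem
    · exact A.point.single_mem
  have hρz : ∀ b, ρ (z b) = 1 := by
    intro b
    cases b
    · exact map_one ρ
    · exact E.ρ_j _
  let f : ({σ // act6 σ q = q} × Bool) × J₀ J × ({l : Fin k // l ≠ i} → T) →
      bigH H E.ker i ψ := fun x =>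
    ⟨el ρ (fun l => if hl : l = i then (ψ (Additive.ofMul x.2.1) : U) else x.2.2 ⟨l, hl⟩)
      (x.2.1 * (h x.1.1 * z x.1.2)), (A.mem_bigH i _).2 ⟨x.2.1, _, H.mul_mem (hH _) (hzH _), rfl,
        fun l hl => by rw [vec_el, dif_neg hl]; exact (x.2.2 _).2,
        by rw [vec_el, dif_pos rfl]⟩⟩
  have hf : Function.Injective f := by
    rintro ⟨⟨σ, b⟩, v, u⟩ ⟨⟨σ', b'⟩, v', u'⟩ hxy
    have h1 := congrArg Subtype.val hxy
    have h2 : (v : G) * (h σ * z b) = v' * (h σ' * z b') := congrArg SemidirectProduct.right h1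
    have h3 := congrArg vec h1
    obtain rfl : σ = σ' := by
      have := congrArg ρ h2
      simp only [map_mul, E.ρ_of_mem_J₀ v.2, E.ρ_of_mem_J₀ v'.2, hρ, hρz, one_mul, mul_one] at this
      exact Subtype.ext this
    obtain rfl : v = v' := by
      have := congrFun h3 i
      simp only [f, vec_el, dif_pos] at this
      have := ψ.injective (Subtype.ext this)
      exact this
    have hb : z b = z b' := mul_left_cancel (mul_left_cancel h2)
    obtain rfl : b = b' := by
      cases b <;> cases b'
      · rfl
      · exact absurd hb.symm hz
      · exact absurd hb hz
      · rfl
    obtain rfl : u = u' := by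
      funext ⟨l, hl⟩
      have := congrFun h3 l
      simp only [f, vec_el, dif_neg hl] at this
      exact Subtype.ext this
    rfl
  have hcard := Nat.card_le_card_of_injective f hf
  rw [Nat.card_prod, Nat.card_prod, Nat.card_prod, E.card_J₀, Nat.card_eq_fintype_card,
    card_fixing, Nat.card_eq_fintype_card, Fintype.card_bool, Nat.card_fun, A.card_T,
    Nat.card_eq_fintype_card, Fintype.card_subtype_compl, Fintype.card_fin,
    Fintype.card_unique] at hcard
  have hk : 16 ^ k = 16 * 16 ^ (k - 1) := by
    rw [← pow_succ', Nat.sub_add_cancel (Nat.one_le_iff_ne_zero.2 (Fin.pos i).ne')]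
  rw [hk]
  omega

theorem IsTwist.card_eq (A : IsTwist E H q T ψ) {c : G} (hc : c * c = 1)
    (hρc : Equiv.Perm.sign (ρ c) = -1) (i : Fin k) :
    (∀ g : BigGroup ρ k, Subgroup.IsComplement
      ((bigH H E.ker i ψ).map (MulAut.conj g).toMonoidHom : Set (BigGroup ρ k))
      (bigK ρ c J i)) ∧ Nat.card (bigK ρ c J i) = 96 * 16 ^ k := by
  have := E.finite_bigGroup k
  have hinj : ∀ g : BigGroup ρ k, Function.Injective
      fun x : ((bigH H E.ker i ψ).map (MulAut.conj g).toMonoidHom : Set (BigGroup ρ k)) ×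
        bigK ρ c J i => (x.1 : BigGroup ρ k) * x.2 := by
    rintro g ⟨⟨_, a, ha, rfl⟩, x, hx⟩ ⟨⟨_, b, hb, rfl⟩, y, hy⟩ h
    simp only [MulEquiv.coe_toMonoidHom, MulAut.conj_apply] at h
    have h1 : x = y := by
      -- Conjugation by `g⁻¹` preserves `𝓚` and brings the conjugate of `𝓗` back to `𝓗`.
      have h2 : g⁻¹ * x * g = g⁻¹ * y * g := by
        have hx' := conj_mem_bigK E hc hρc hx g⁻¹
        have hy' := conj_mem_bigK E hc hρc hy g⁻¹
        rw [inv_inv] at hx' hy'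
        refine A.injective hc hρc hx' hy' ?_
        have : g⁻¹ * x * g * (g⁻¹ * y * g)⁻¹ = a⁻¹ * b := by
          have h3 : x = (g * a * g⁻¹)⁻¹ * (g * b * g⁻¹ * y) := by rw [← h, inv_mul_cancel_left]
          rw [h3]; group
        rw [this]
        exact mul_mem (inv_mem ha) hb
      exact mul_left_cancel (mul_right_cancel h2)
    subst h1
    have h2 := mul_right_cancel h
    exact Prod.ext (Subtype.ext h2) rfl
  have hcardH : ∀ g : BigGroup ρ k,
      Nat.card ((bigH H E.ker i ψ).map (MulAut.conj g).toMonoidHom : Set (BigGroup ρ k)) =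
        Nat.card (bigH H E.ker i ψ) := fun g =>
    (Nat.card_congr ((bigH H E.ker i ψ).equivMapOfInjective _
      (MulAut.conj g).injective).toEquiv).symm
  have h1 := A.le_card_bigH (k := k) i
  have h2 := le_card_bigK E hc hρc i
  have h3 : 3840 * 256 ^ k = (40 * 16 ^ k) * (96 * 16 ^ k) := by
    rw [show (256 : ℕ) = 16 * 16 by norm_num, mul_pow]; ring
  refine ⟨fun g => (hinj g).bijective_of_nat_card_le ?_, ?_⟩
  · rw [Nat.card_prod, hcardH, E.card_bigGroup, h3]
    exact Nat.mul_le_mul h1 h2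
  · refine le_antisymm ?_ h2
    have h4 := Nat.card_le_card_of_injective _ (hinj 1)
    rw [Nat.card_prod, hcardH, E.card_bigGroup, h3] at h4
    have h5 : 0 < 40 * 16 ^ k := by positivity
    exact Nat.le_of_mul_le_mul_left ((Nat.mul_le_mul_right _ h1).trans h4) h5

theorem IsTwist.isLoopFolder (A : IsTwist E H q T ψ) {c : G} (hc : c * c = 1)
    (hρc : Equiv.Perm.sign (ρ c) = -1) (i : Fin k) :
    IsLoopFolder (bigH H E.ker i ψ) (bigK ρ c J i) :=
  ⟨one_mem_bigK E hc hρc i, (A.card_eq hc hρc i).1⟩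

end Folder

/-! ### Bol loops from loop folders -/

namespace IsLoopFolder

variable {G : Type*} [Group G] {H : Subgroup G} {K : Set G} (F : IsLoopFolder H K)

theorem val_injective : Function.Injective F.val := Subtype.val_injective

theorem val_mem (x : F.Q) : F.val x ∈ K := Subtype.property (p := (· ∈ K)) x

theorem val_one : F.val 1 = 1 := rfl

theorem mul_eq_iff (x y z : F.Q) : x * y = z ↔ F.val z * (F.val x * F.val y)⁻¹ ∈ H :=
  F.op_eq_iff x y z

theorem val_mul_mem (x y : F.Q) : F.val (x * y) * (F.val x * F.val y)⁻¹ ∈ H :=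
  (F.mul_eq_iff x y _).1 rfl

/-- The element of the loop that represents the coset `H g`. -/
noncomputable def rep (g : G) : F.Q := (F.existsUnique g).choose

theorem rep_spec (g : G) : F.val (F.rep g) * g⁻¹ ∈ H := (F.existsUnique g).choose_spec.1

theorem rep_eq_iff (g : G) (z : F.Q) : F.rep g = z ↔ F.val z * g⁻¹ ∈ H :=
  ⟨fun h => h ▸ F.rep_spec g, fun h => ((F.existsUnique g).choose_spec.2 z h).symm⟩

theorem rep_val (x : F.Q) : F.rep (F.val x) = x := by
  rw [rep_eq_iff, mul_inv_cancel]; exact H.one_mem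

theorem rep_mul_of_mem {h : G} (hh : h ∈ H) (g : G) : F.rep (h * g) = F.rep g := by
  rw [rep_eq_iff, mul_inv_rev, ← mul_assoc]
  exact H.mul_mem (F.rep_spec g) (H.inv_mem hh)

/-- Under the identification of the loop with the right cosets of `H`, right multiplication in the
loop is the action of elements of `K` on cosets. -/
theorem rep_mul_val (g : G) (x : F.Q) : F.rep (g * F.val x) = F.rep g * x := by
  rw [rep_eq_iff]
  have h1 := F.val_mul_mem (F.rep g) x
  have h2 := F.rep_spec g
  have : F.val (F.rep g * x) * (g * F.val x)⁻¹ =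
      (F.val (F.rep g * x) * (F.val (F.rep g) * F.val x)⁻¹) * (F.val (F.rep g) * g⁻¹) := by group
  rw [this]
  exact H.mul_mem h1 h2

theorem rep_mem_eq {g : G} (hg : g ∈ K) : F.val (F.rep g) = g := by
  have h : F.rep g = ⟨g, hg⟩ := (F.rep_eq_iff g _).2 (by
    change g * g⁻¹ ∈ H
    rw [mul_inv_cancel]; exact H.one_mem)
  exact congrArg F.val h

theorem rep_mul_of_mem_K (g : G) {x : G} (hx : x ∈ K) : F.rep (g * x) = F.rep g * F.rep x := by
  rw [← F.rep_mul_val, F.rep_mem_eq hx]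

/-- Both sides of the identity are right actions of `y z y`. This product lies in `K` because it is
the conjugate `y z y⁻¹`. -/
theorem isBol (hconj : ∀ x ∈ K, ∀ y ∈ K, y * x * y⁻¹ ∈ K) (hsq : ∀ x ∈ K, x * x = 1) :
    Loop.IsBol F.Q := by
  intro x y z
  have hy : (F.val y)⁻¹ = F.val y := inv_eq_of_mul_eq_one_left (hsq _ (F.val_mem y))
  have hm : F.val y * F.val z * F.val y ∈ K := by
    have := hconj _ (F.val_mem z) _ (F.val_mem y)
    rwa [hy] at this
  have h1 : (y * z) * y = F.rep (F.val y * F.val z * F.val y) := by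
    rw [F.rep_mul_val, F.rep_mul_val, F.rep_val]
  rw [h1, ← F.rep_val x, ← F.rep_mul_of_mem_K _ hm, ← F.rep_mul_val, ← F.rep_mul_val,
    ← F.rep_mul_val]
  simp only [mul_assoc]

theorem hasExponent_two (hsq : ∀ x ∈ K, x * x = 1) (hK : ∃ x ∈ K, x ≠ 1) :
    Loop.HasExponent F.Q 2 := by
  refine ⟨⟨two_pos, fun x => ?_⟩, ?_⟩
  · change (1 * x) * x = 1
    rw [one_mul, F.mul_eq_iff, hsq _ (F.val_mem x), F.val_one]
    simp [H.one_mem]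
  · rintro m ⟨hm, h⟩
    by_contra! hlt
    obtain rfl : m = 1 := by omega
    obtain ⟨x, hx, hx1⟩ := hK
    have h1 : (1 : F.Q) * F.rep x = 1 := h (F.rep x)
    rw [one_mul] at h1
    have := congrArg F.val h1
    rw [F.rep_mem_eq hx, F.val_one] at this
    exact hx1 this

end IsLoopFolder
end BolLoops
namespace BolLoops
open BigGroup

/-! ### Normal subloops -/

namespace Loop.IsNormalSubloop

variable {Q : Type*} [Loop Q] {N : Set Q} (hN : IsNormalSubloop N)

/-- The coset `N x`. -/
def coset (N : Set Q) (x : Q) : Set Q := (fun n => n * x) '' N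

theorem coset_one (N : Set Q) : coset N 1 = N := by
  simp [coset]

include hN

theorem coset_mul_right (x y : Q) : coset N (x * y) = (fun a => a * y) '' coset N x := by
  rw [coset, ← hN.assoc_right, coset, Set.image_image]

theorem coset_mul_left (x y : Q) : coset N (x * y) = (fun a => x * a) '' coset N y := by
  rw [coset, ← hN.comm, ← hN.assoc_left, coset, ← hN.comm, Set.image_image]

theorem coset_eq_one_iff (x : Q) : coset N x = coset N 1 ↔ x ∈ N := by
  rw [coset_one]
  constructor
  · intro h
    rw [← h]
    exact ⟨1, hN.one_mem, one_mul x⟩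
  · intro hx
    ext y
    constructor
    · rintro ⟨n, hn, rfl⟩
      exact hN.mul_mem n hn x hx
    · intro hy
      obtain ⟨m, hm, -⟩ := Loop.existsUnique_left x y
      exact ⟨m, hN.left_div_mem x hx m (by rwa [hm]), hm⟩

theorem coset_mul_right_iff (x x' y : Q) :
    coset N (x * y) = coset N (x' * y) ↔ coset N x = coset N x' := by
  rw [hN.coset_mul_right, hN.coset_mul_right, Set.image_eq_image]
  intro a b h
  exact (Loop.existsUnique_left y (b * y)).unique h rfl

theorem coset_mul_left_iff (x y y' : Q) :
    coset N (x * y) = coset N (x * y') ↔ coset N y = coset N y' := by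
  rw [hN.coset_mul_left, hN.coset_mul_left, Set.image_eq_image]
  intro a b h
  exact (Loop.existsUnique_right x (x * b)).unique h rfl

end Loop.IsNormalSubloop

open Loop.IsNormalSubloop in
/-- A normal subloop of the loop of a folder comes from a normal subgroup. -/
theorem IsLoopFolder.exists_normal {G : Type*} [Group G] {H : Subgroup G} {K : Set G}
    (F : IsLoopFolder H K) (hK : Subgroup.closure K = ⊤) {N : Set F.Q}
    (hN : Loop.IsNormalSubloop N) :
    ∃ M : Subgroup G, M.Normal ∧ (∀ x ∈ K, x ∈ M ↔ F.rep x ∈ N) ∧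
      ∀ x ∈ K, ∀ y ∈ K, ∀ h ∈ H, ∀ m ∈ M, x * y⁻¹ = h * m → x * y⁻¹ ∈ M := by
  have hone : F.rep 1 = 1 := F.rep_val 1
  -- As `K` generates `G`, right multiplication by every element of `G` permutes the cosets of `N`.
  have hR : ∀ g a b : G, coset N (F.rep (a * g)) = coset N (F.rep (b * g)) ↔
      coset N (F.rep a) = coset N (F.rep b) := by
    intro g
    have hg : g ∈ Subgroup.closure K := by rw [hK]; trivial
    induction hg using Subgroup.closure_induction with
    | mem x hx =>
      intro a b
      rw [F.rep_mul_of_mem_K _ hx, F.rep_mul_of_mem_K _ hx, hN.coset_mul_right_iff]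
    | one => intro a b; rw [mul_one, mul_one]
    | mul x y _ _ hx hy => intro a b; rw [← mul_assoc, ← mul_assoc, hy, hx]
    | inv x _ hx => intro a b; rw [← hx, inv_mul_cancel_right, inv_mul_cancel_right]
  -- The kernel of the action of `G` on the quotient loop.
  let M : Subgroup G :=
    { carrier := {m | ∀ g, coset N (F.rep (g * m)) = coset N (F.rep g)}
      one_mem' := fun g => by rw [mul_one]
      mul_mem' := fun {a b} ha hb g => by rw [← mul_assoc, hb, ha]
      inv_mem' := fun {a} ha g => by rw [← ha, inv_mul_cancel_right] }
  have hmem : ∀ m, m ∈ M ↔ ∀ g, coset N (F.rep (g * m)) = coset N (F.rep g) := fun _ => Iff.rfl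
  refine ⟨M, ⟨fun m hm g a => ?_⟩, fun x hx => ⟨fun h => ?_, fun h g => ?_⟩,
    fun x hx y hy h hh m hm hxy => ?_⟩
  · have h1 := (hR g⁻¹ _ _).2 (hm (a * g))
    rw [mul_inv_cancel_right] at h1
    rw [← h1]
    simp only [mul_assoc]
  · have h1 := h 1
    rwa [one_mul, hone, hN.coset_eq_one_iff] at h1
  · rw [F.rep_mul_of_mem_K _ hx]
    have h1 := (hN.coset_mul_left_iff (F.rep g) (F.rep x) 1).2 ((hN.coset_eq_one_iff _).2 h)
    rw [h1, mul_one]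
  -- If `x y⁻¹ ∈ H M`, then `x` and `y` lie in the same coset of `N`, and so they act alike on the
  -- quotient loop.
  · have h1 : coset N (F.rep (x * y⁻¹)) = coset N (F.rep 1) := by
      rw [hxy, F.rep_mul_of_mem hh, ← hm 1, one_mul]
    have h2 := (hR y _ _).2 h1
    rw [inv_mul_cancel_right, one_mul] at h2
    intro g
    rw [← hR y, mul_assoc, inv_mul_cancel_right, F.rep_mul_of_mem_K _ hx,
      F.rep_mul_of_mem_K _ hy, hN.coset_mul_left_iff]
    exact h2

/-- `N` corresponds to `K ∩ M`. So it is trivial if `M` meets `K` only in `1`, and it is everything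
if `M` is the whole group. -/
theorem IsLoopFolder.isSimple {G : Type*} [Group G] {H : Subgroup G} {K : Set G}
    (F : IsLoopFolder H K) (hK : Subgroup.closure K = ⊤) (hK1 : ∃ x ∈ K, x ≠ 1)
    (hM : ∀ M : Subgroup G, M.Normal →
      (∀ x ∈ K, ∀ y ∈ K, ∀ h ∈ H, ∀ m ∈ M, x * y⁻¹ = h * m → x * y⁻¹ ∈ M) →
      (∃ x ∈ K, x ∈ M ∧ x ≠ 1) → M = ⊤) : Loop.IsSimple F.Q := by
  constructor
  · obtain ⟨x, hx, hx1⟩ := hK1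
    refine ⟨F.rep x, 1, fun h => hx1 ?_⟩
    rw [← F.rep_mem_eq hx, h, F.val_one]
  · intro N hN
    obtain ⟨M, hMn, hMN, hM2⟩ := F.exists_normal hK hN
    have hmem : ∀ z : F.Q, z ∈ N ↔ F.val z ∈ M := fun z => by
      rw [hMN _ (F.val_mem z), F.rep_val]
    by_cases h : ∃ x ∈ K, x ∈ M ∧ x ≠ 1
    · right
      have := hM M hMn hM2 h
      ext z
      rw [hmem, this]
      simp
    · left
      push Not at h
      ext z
      rw [hmem, Set.mem_singleton_iff]
      constructor
      · intro hz
        exact F.val_injective (h _ (F.val_mem z) hz)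
      · rintro rfl
        exact M.one_mem

/-! ### Normal subgroups of `𝓖` -/

/-- Even weights on six points are `0, 2, 4, 6`, and complementing a vector of weight `4` gives
weight `2`. -/
theorem exists_pair (v : Fin 6 → ZMod 2) (hv : ∑ p, v p = 0) (h : ¬ ∃ a, ∀ p, v p = a) :
    ∃ p p', p ≠ p' ∧ ∃ a : ZMod 2, ∀ l, v l =
      (Pi.single p 1 + Pi.single p' 1 : Fin 6 → ZMod 2) l + a := by
  revert v; decide +kernel

theorem act6_two_transitive (p p' r r' : Fin 6) (h : p ≠ p') (h' : r ≠ r') :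
    ∃ σ, act6 σ p = r ∧ act6 σ p' = r' := by
  have key : ∀ p p' : Fin 6, p ≠ p' → ∃ σ, act6 σ 0 = p ∧ act6 σ 1 = p' := by decide +kernel
  obtain ⟨σ, h1, h2⟩ := key p p' h
  obtain ⟨τ, h3, h4⟩ := key r r' h'
  exact ⟨τ * σ⁻¹, by simp [← h1, h3], by simp [← h2, h4]⟩

/-- The action on vectors of length `6`. -/
def perm6 (σ : Equiv.Perm (Fin 5)) (v : Fin 6 → ZMod 2) : Fin 6 → ZMod 2 :=
  fun p => v ((act6 σ)⁻¹ p)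

theorem perm6_single (σ : Equiv.Perm (Fin 5)) (p : Fin 6) :
    perm6 σ (Pi.single p 1) = Pi.single (act6 σ p) 1 := by
  funext l
  simp only [perm6, Pi.single_apply, Equiv.Perm.inv_eq_iff_eq]

/-- An element of the group algebra, as an operator, that annihilates `U`. -/
def annihilator {M : Type*} [Add M] (s : Equiv.Perm (Fin 5) → M → M) (z : M) : M :=
  let z₁ := s c[2, 3, 4] z + s c[2, 4, 3] z
  let z₂ := s c[0, 1, 2] z₁ + s c[0, 2, 1] z₁
  z₂ + s (Equiv.swap 0 1 * Equiv.swap 3 4) z₂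

/-- All permutations in the operator are even. It kills every copy of `N` but, by
`annihilator_single`, not `J₀`, so it separates the two modules inside a normal subgroup. -/
theorem annihilator_U (u : U) : annihilator (fun σ (u : U) => σ • u) u = 0 := by
  revert u; decide +kernel

theorem annihilator_mem {M M' : Type*} [AddGroup M] [AddGroup M'] {A : AddSubgroup (M × M')}
    {s : Equiv.Perm (Fin 5) → M → M} {s' : Equiv.Perm (Fin 5) → M' → M'}
    (hs : ∀ σ z z', (z, z') ∈ A → (s σ z, s' σ z') ∈ A) {z : M} {z' : M'} (h : (z, z') ∈ A) :
    (annihilator s z, annihilator s' z') ∈ A := by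
  have h1 := A.add_mem (hs c[2, 3, 4] _ _ h) (hs c[2, 4, 3] _ _ h)
  have h2 := A.add_mem (hs c[0, 1, 2] _ _ h1) (hs c[0, 2, 1] _ _ h1)
  exact A.add_mem h2 (hs (Equiv.swap 0 1 * Equiv.swap 3 4) _ _ h2)

theorem annihilator_single :
    ∃ p p', p ≠ p' ∧ (∑ l, annihilator perm6 (Pi.single p 1 + Pi.single p' 1) l = 0) ∧
      ¬ ∃ a, ∀ l, annihilator perm6 (Pi.single p 1 + Pi.single p' 1) l = a := by
  decide +kernel

section Normal

variable {G : Type*} [Group G] {J : Subgroup G} {ρ : G →* Equiv.Perm (Fin 5)} {k : ℕ}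

/-- The intersection of a subgroup of `𝓖` with the kernel of the map to `S₅`, as a module. -/
def ExtData.moduleOf (E : ExtData J ρ) (X : Subgroup (BigGroup ρ k)) :
    AddSubgroup ((Fin 6 → ZMod 2) × (Fin k → U)) where
  carrier := {z | el ρ z.2 (E.j z.1) ∈ X}
  zero_mem' := by
    change el ρ 0 (E.j 0) ∈ X
    rw [E.j_zero]; exact X.one_mem
  add_mem' := by
    intro y z hy hz
    have : el ρ (y.2 + z.2) (E.j (y.1 + z.1)) = el ρ y.2 (E.j y.1) * el ρ z.2 (E.j z.1) := by
      apply ext'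
      · simp [E.ρ_j]
      · simp [E.j_add]
    change el ρ (y.2 + z.2) (E.j (y.1 + z.1)) ∈ X
    rw [this]
    exact X.mul_mem hy hz
  neg_mem' := by
    intro z hz
    have h : -z = z := Prod.ext (neg_eq_of_add_eq_zero_left (CharTwo.add_self_eq_zero z.1))
      (neg_vec z.2)
    rw [h]; exact hz

variable {E : ExtData J ρ} {X : Subgroup (BigGroup ρ k)}

theorem mem_moduleOf (v : Fin 6 → ZMod 2) (u : Fin k → U) :
    (v, u) ∈ E.moduleOf X ↔ el ρ u (E.j v) ∈ X := Iff.rfl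

theorem const_mem_moduleOf (a : ZMod 2) : ((fun _ => a, 0) : (Fin 6 → ZMod 2) × (Fin k → U)) ∈
    E.moduleOf X := by
  rw [mem_moduleOf, (E.j_eq_one _).2 ⟨a, fun _ => rfl⟩]
  exact X.one_mem

theorem smul_mem_moduleOf (hX : X.Normal) (σ : Equiv.Perm (Fin 5)) {v : Fin 6 → ZMod 2}
    {u : Fin k → U} (h : (v, u) ∈ E.moduleOf X) : (perm6 σ v, σ • u) ∈ E.moduleOf X := by
  obtain ⟨g, rfl⟩ := E.surj σ
  rw [mem_moduleOf] at *
  have := hX.conj_mem _ h (SemidirectProduct.inr g)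
  convert this using 1
  apply ext'
  · rw [vec_mul, vec_mul, vec_inv, vec_inr, neg_zero, smul_zero, smul_zero, zero_add, add_zero]
    rfl
  · exact (E.j_conj g v).symm

/-- A normal subgroup that contains an element with a nontrivial component in `J₀` contains
`J₀`. -/
theorem even_mem_moduleOf (hX : X.Normal) {v : Fin 6 → ZMod 2} {u : Fin k → U}
    (hv : ∑ p, v p = 0) (hv' : ¬ ∃ a, ∀ p, v p = a) (h : (v, u) ∈ E.moduleOf X)
    (v' : Fin 6 → ZMod 2) (hv0 : ∑ p, v' p = 0) : (v', (0 : Fin k → U)) ∈ E.moduleOf X := by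
  -- By `exists_pair` and 2-transitivity every pair occurs, though accompanied by some vector of `U
  -- ^ k`.
  have hpair : ∀ {v : Fin 6 → ZMod 2} {u : Fin k → U}, ∑ p, v p = 0 → (¬ ∃ a, ∀ p, v p = a) →
      (v, u) ∈ E.moduleOf X → ∀ r r', r ≠ r' → ∃ σ : Equiv.Perm (Fin 5),
        (Pi.single r 1 + Pi.single r' 1, σ • u) ∈ E.moduleOf X := by
    intro v u hv hv' h r r' hr
    obtain ⟨p, p', hp, a, ha⟩ := exists_pair v hv hv'
    obtain ⟨σ, h1, h2⟩ := act6_two_transitive p p' r r' hp hr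
    refine ⟨σ, ?_⟩
    have h3 := smul_mem_moduleOf hX σ h
    have h4 := (E.moduleOf X).add_mem h3 (const_mem_moduleOf a)
    have h5 : perm6 σ v + (fun _ => a) = Pi.single r 1 + Pi.single r' 1 := by
      rw [← h1, ← h2, ← perm6_single, ← perm6_single]
      funext l
      simp only [perm6, Pi.add_apply]
      rw [ha, add_assoc, CharTwo.add_self_eq_zero, add_zero]
      rfl
    rwa [Prod.mk_add_mk, h5, add_zero] at h4
  obtain ⟨p, p', hp, hsum, hnc⟩ := annihilator_single
  obtain ⟨σ, hσ⟩ := hpair hv hv' h p p' hp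
  have hann : ∀ {v : Fin 6 → ZMod 2} {u : Fin k → U}, (v, u) ∈ E.moduleOf X →
      (annihilator perm6 v, (0 : Fin k → U)) ∈ E.moduleOf X := by
    intro v u h
    have h0 : annihilator (fun σ (u : Fin k → U) => σ • u) u = 0 :=
      funext fun l => annihilator_U (u l)
    rw [← h0]
    exact annihilator_mem (fun σ v u => smul_mem_moduleOf hX σ) h
  -- The vector of `U ^ k` is now gone, while an even nonconstant vector remains. A second use of
  -- `hpair` gives all pairs with zero component in `U ^ k`.
  have hann' := hann hσ
  have hall : ∀ r r', (Pi.single r 1 + Pi.single r' 1, (0 : Fin k → U)) ∈ E.moduleOf X := by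
    intro r r'
    by_cases hr : r = r'
    · subst hr
      rw [CharTwo.add_self_eq_zero]; exact (E.moduleOf X).zero_mem
    · obtain ⟨τ, hτ⟩ := hpair hsum hnc hann' r r' hr
      rwa [smul_zero] at hτ
  rw [even_eq_sum v' hv0]
  have hsum : (∑ p, v' p • (Pi.single p 1 + Pi.single 0 1), (0 : Fin k → U)) =
      ∑ p, ((v' p • (Pi.single p 1 + Pi.single 0 1), 0) : (Fin 6 → ZMod 2) × (Fin k → U)) := by
    apply Prod.ext
    · rw [Prod.fst_sum]
    · rw [Prod.snd_sum]; simp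
  rw [hsum]
  refine (E.moduleOf X).sum_mem fun p _ => ?_
  have : v' p = 0 ∨ v' p = 1 := by
    generalize v' p = a; revert a; decide
  rcases this with h | h
  · rw [h, zero_smul]; exact (E.moduleOf X).zero_mem
  · rw [h, one_smul]; exact hall p 0

theorem exists_fixed_vectors : (∃ v : Fin 6 → ZMod 2, ∑ p, v p = 1 ∧
      ∃ a, ∀ p, v ((act6 (Equiv.swap 0 1))⁻¹ p) + v p = a) ∧
    ∃ v : Fin 6 → ZMod 2, ∑ p, v p = 0 ∧ (¬ ∃ a, ∀ p, v p = a) ∧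
      ∃ a, ∀ p, v ((act6 (Equiv.swap 0 1))⁻¹ p) + v p = a := by
  decide +kernel

theorem mem_of_isOddInvolution (hX : X.Normal) {a b : BigGroup ρ k} (E : ExtData J ρ)
    (ha : IsOddInvolution a) (hb : IsOddInvolution b) (haX : a ∈ X) : b ∈ X := by
  have h1 := ha.right_sq
  have h2 : a ∈ conjugatesOf (SemidirectProduct.inr a.right : BigGroup ρ k) := by
    rw [conjugatesOf_inr_of_odd E h1 ha.2]; exact ha
  have h3 : b ∈ conjugatesOf (SemidirectProduct.inr a.right : BigGroup ρ k) := by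
    rw [conjugatesOf_inr_of_odd E h1 ha.2]; exact hb
  obtain ⟨g, rfl⟩ := isConj_iff.1 ((show IsConj _ a from h2).symm.trans h3)
  exact hX.conj_mem a haX g

theorem isOddInvolution_inr {a : G} (ha : a * a = 1) (hρ : Equiv.Perm.sign (ρ a) = -1) :
    IsOddInvolution (SemidirectProduct.inr a : BigGroup ρ k) :=
  ⟨by rw [← map_mul, ha, map_one], hρ⟩

theorem j_mem_of_odd {X : Subgroup (BigGroup ρ k)} (heven : ∀ v : Fin 6 → ZMod 2, ∑ p, v p = 0 →
    (SemidirectProduct.inr (E.j v) : BigGroup ρ k) ∈ X) {w : Fin 6 → ZMod 2} (hw : ∑ p, w p = 1)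
    (hwX : (SemidirectProduct.inr (E.j w) : BigGroup ρ k) ∈ X) (v : Fin 6 → ZMod 2) :
    (SemidirectProduct.inr (E.j v) : BigGroup ρ k) ∈ X := by
  have h2 : ∀ a : ZMod 2, a = 0 ∨ a = 1 := by decide
  rcases h2 (∑ p, v p) with h | h
  · exact heven v h
  · have : v = (v + w) + w := by rw [add_assoc, CharTwo.add_self_eq_zero, add_zero]
    rw [this, E.j_add, map_mul]
    refine X.mul_mem (heven _ ?_) hwX
    simp only [Pi.add_apply, Finset.sum_add_distrib, h, hw]
    decide

theorem exists_swap_smul_ne : ∃ n : N, (Equiv.swap (0 : Fin 5) 1) • n +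
    (Equiv.swap (3 : Fin 5) 4) • n ≠ 0 := by
  decide +kernel

/-- `𝓖` is generated by its odd involutions. -/
theorem eq_top_of_odd_mem (hX : X.Normal) {a : BigGroup ρ k} (E : ExtData J ρ)
    (ha : IsOddInvolution a) (haX : a ∈ X) : X = ⊤ := by
  have hodd : ∀ b : BigGroup ρ k, IsOddInvolution b → b ∈ X :=
    fun b hb => mem_of_isOddInvolution hX E ha hb haX
  have hlift : ∀ τ : Equiv.Perm (Fin 5), τ * τ = 1 → Equiv.Perm.sign τ = -1 →
      ∃ a, a * a = 1 ∧ ρ a = τ := fun τ => E.exists_lift ha.right_sq ha.2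
  -- the vectors that a transposition fixes
  obtain ⟨c₀, hc₀, hρc₀⟩ := hlift (Equiv.swap 0 1) (by decide +kernel) (by decide +kernel)
  have hsgn : Equiv.Perm.sign (ρ c₀) = -1 := by rw [hρc₀]; decide +kernel
  have hfix : ∀ v : Fin 6 → ZMod 2, (∃ a, ∀ p, v ((act6 (Equiv.swap 0 1))⁻¹ p) + v p = a) →
      (SemidirectProduct.inr (E.j v) : BigGroup ρ k) ∈ X := by
    intro v hv
    have h1 := hodd _ (isOddInvolution_inr (k := k) hc₀ hsgn)
    have h2 := hodd _ (isOddInvolution_inr (k := k) ((E.mul_j_sq hc₀ v).2 (by rwa [hρc₀]))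
      (by rw [map_mul, E.ρ_j, mul_one, hsgn]))
    have h3 := X.mul_mem h1 h2
    rwa [← map_mul, ← mul_assoc, hc₀, one_mul] at h3
  obtain ⟨⟨w, hw, hwf⟩, v, hv, hvn, hvf⟩ := exists_fixed_vectors
  have hJ := j_mem_of_odd (fun v' hv' => even_mem_moduleOf hX hv hvn (hfix v hvf) v' hv') hw
    (hfix w hwf)
  have hG : ∀ g : G, (SemidirectProduct.inr g : BigGroup ρ k) ∈ X := by
    have h1 : (X.comap SemidirectProduct.inr).map ρ = ⊤ := by
      rw [eq_top_iff, ← Equiv.Perm.closure_isSwap, Subgroup.closure_le]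
      rintro τ ⟨a, b, hab, rfl⟩
      obtain ⟨g, hg, hρg⟩ := hlift (Equiv.swap a b) (by simp) (Equiv.Perm.sign_swap hab)
      exact ⟨g, hodd _ (isOddInvolution_inr hg (by rw [hρg]; exact Equiv.Perm.sign_swap hab)), hρg⟩
    intro g
    have h2 : ρ g ∈ (X.comap SemidirectProduct.inr).map ρ := by rw [h1]; trivial
    obtain ⟨g', hg', hgg'⟩ := h2
    obtain ⟨v, rfl⟩ := E.exists_j_of_ρ_eq hgg'.symm
    rw [map_mul]
    exact X.mul_mem hg' (hJ v)
  have hU : ∀ (l : Fin k) (u : U), ((0, Pi.single l u) : (Fin 6 → ZMod 2) × (Fin k → U)) ∈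
      E.moduleOf X := by
    intro l
    let B : AddSubgroup U := (E.moduleOf X).comap
      ((AddMonoidHom.inr (Fin 6 → ZMod 2) (Fin k → U)).comp (AddMonoidHom.single (fun _ => U) l))
    have hB : ∀ u, u ∈ B ↔ ((0, Pi.single l u) : (Fin 6 → ZMod 2) × (Fin k → U)) ∈
      E.moduleOf X := fun _ => Iff.rfl
    have hBσ : ∀ (σ : Equiv.Perm (Fin 5)), ∀ u ∈ B, σ • u ∈ B := by
      intro σ u hu
      rw [hB] at *
      have := smul_mem_moduleOf hX σ hu
      have h1 : σ • (Pi.single l u : Fin k → U) = Pi.single l (σ • u) := by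
        funext m
        by_cases hm : m = l
        · subst hm; simp
        · simp [Pi.single_eq_of_ne hm]
      rw [h1] at this
      exact this
    -- A transposition `τ` fixes `(n, τ n)`. This vector times a lift of `τ` is therefore an odd
    -- involution, and multiplying by the lift again isolates the vector.
    have hBτ : ∀ a b : Fin 5, a ≠ b → ∀ n : N, U.mk n (Equiv.swap a b • n) ∈ B := by
      intro a b hab n
      obtain ⟨g, hg, hρg⟩ := hlift (Equiv.swap a b) (by simp) (Equiv.Perm.sign_swap hab)
      have hs : Equiv.Perm.sign (ρ g) = -1 := by rw [hρg]; exact Equiv.Perm.sign_swap hab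
      have hx : IsOddInvolution (el ρ (Pi.single l (U.mk n (Equiv.swap a b • n))) g) := by
        refine ⟨ext' ?_ hg, hs⟩
        rw [vec_mul, vec_el, right_el, vec_one]
        funext m
        rw [Pi.add_apply, Pi.smul_apply]
        by_cases hm : m = l
        · subst hm
          rw [Pi.single_eq_same, U.smul_of_odd hs, U.mk_fst, U.mk_snd, hρg, ← mul_smul,
            Equiv.swap_mul_self, one_smul, U.add_self]; rfl
        · rw [Pi.single_eq_of_ne hm, smul_zero, add_zero]; rfl
      have h1 := X.mul_mem (hodd _ hx) (hG g)
      rw [hB, mem_moduleOf, E.j_zero]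
      convert h1 using 1
      apply ext'
      · rw [vec_mul, vec_inr, smul_zero, add_zero]; rfl
      · exact hg.symm
    obtain ⟨n, hn⟩ := exists_swap_smul_ne
    -- Two transpositions give vectors with the same first component; their difference lies in `0 ⊕
    -- N` and generates it under the `5`-cycle.
    have h0 : U.mk 0 (Equiv.swap (0 : Fin 5) 1 • n + Equiv.swap (3 : Fin 5) 4 • n) ∈ B := by
      have := B.add_mem (hBτ 0 1 (by decide) n) (hBτ 3 4 (by decide) n)
      convert this using 1
      apply U.ext
      · exact (N.add_self n).symm
      · rfl
    have h1 : ∀ m : N, U.mk 0 m ∈ B := by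
      intro m
      obtain ⟨a, ha⟩ := U.exists_cyclicSum _ m hn
      have := U.cyclicSum_mem (T := B) (fun u hu => hBσ _ u hu) a h0
      convert this using 1
      apply U.ext
      · rw [U.cyclicSum_fst]; exact (U.cyclicSum_zero a).symm
      · rw [U.cyclicSum_snd, U.mk_snd, U.mk_snd, ha]
    intro u
    rw [← hB]
    have h2 := B.add_mem (hBτ 0 1 (by decide) u.1) (h1 (u.2 + Equiv.swap (0 : Fin 5) 1 • u.1))
    convert h2 using 1
    apply U.ext
    · rw [U.add_fst, U.mk_fst, U.mk_fst, add_zero]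
    · rw [U.add_snd, U.mk_snd, U.mk_snd]
      have h3 : ∀ n m : N, n = m + (n + m) := fun n m => by
        rw [add_left_comm, N.add_self, add_zero]
      exact h3 _ _
  refine eq_top_iff.2 fun x _ => ?_
  have hx : x = el ρ (vec x) 1 * SemidirectProduct.inr x.right := by
    apply ext' <;> simp
  rw [hx]
  refine X.mul_mem ?_ (hG _)
  have h1 : ((0, vec x) : (Fin 6 → ZMod 2) × (Fin k → U)) ∈ E.moduleOf X := by
    have h2 : ((0, vec x) : (Fin 6 → ZMod 2) × (Fin k → U)) =
        ∑ l, ((0, Pi.single l (vec x l)) : (Fin 6 → ZMod 2) × (Fin k → U)) := by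
      apply Prod.ext
      · rw [Prod.fst_sum]; simp
      · rw [Prod.snd_sum]; exact (Finset.univ_sum_single (vec x)).symm
    rw [h2]
    exact (E.moduleOf X).sum_mem fun l _ => hU l _
  rw [mem_moduleOf, E.j_zero] at h1
  exact h1

end Normal
end BolLoops
namespace BolLoops
open BigGroup

/-! ### Normal subgroups compatible with the folder, and simplicity -/

/-- The operator `(1 + (0 1)) (1 + (2 3))`, which maps `U` into `W`. -/
def toW {M : Type*} [Add M] [SMul (Equiv.Perm (Fin 5)) M] (u : M) : M :=
  (u + Equiv.swap (2 : Fin 5) 3 • u) +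
    Equiv.swap (0 : Fin 5) 1 • (u + Equiv.swap (2 : Fin 5) 3 • u)

/-- The two components of the result differ by `(1 + (0 1)) (1 + (2 3))` applied to `u₁ + u₂`. This
vanishes: `1 + (2 3)` maps `N` to multiples of `e₂ + e₃`, which `(0 1)` fixes. -/
theorem toW_mem (u : U) : toW u ∈ U.W := by
  revert u; decide +kernel

theorem exists_toW_ne (u : U) (hu : u ∉ U.W) : ∃ σ : Equiv.Perm (Fin 5), toW (σ • u) ≠ 0 := by
  revert u; decide +kernel

theorem exists_swaps_fix (q : Fin 6) : ∃ a b c d : Fin 5, a ≠ b ∧ c ≠ d ∧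
    act6 (Equiv.swap a b * Equiv.swap c d) q = q ∧ Equiv.swap a b * Equiv.swap c d ≠ 1 := by
  revert q; decide +kernel

theorem exists_odd_fix (q : Fin 6) : ∃ σ, act6 σ q = q ∧ Equiv.Perm.sign σ = -1 := by
  revert q; decide +kernel

theorem alternatingGroup_le_of_normal {S : Subgroup (Equiv.Perm (Fin 5))} (hS : S.Normal)
    {σ : Equiv.Perm (Fin 5)} (h : σ ∈ S) (h1 : Equiv.Perm.sign σ = 1) (h2 : σ ≠ 1) :
    alternatingGroup (Fin 5) ≤ S := by
  have := alternatingGroup.isSimpleGroup (α := Fin 5) (by simp)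
  rcases (inferInstance : (S.subgroupOf (alternatingGroup (Fin 5))).Normal).eq_bot_or_eq_top
    with h0 | h0
  · have h3 : (⟨σ, h1⟩ : alternatingGroup (Fin 5)) ∈ S.subgroupOf (alternatingGroup (Fin 5)) := h
    rw [h0, Subgroup.mem_bot] at h3
    exact absurd (congrArg Subtype.val h3) h2
  · exact Subgroup.subgroupOf_eq_top.1 h0

section Simple

variable {G : Type*} [Group G] {J : Subgroup G} {ρ : G →* Equiv.Perm (Fin 5)} {k : ℕ}
  {E : ExtData J ρ} {X : Subgroup (BigGroup ρ k)}

theorem exists_mem_moduleOf_W (hX : X.Normal) {w : Fin k → U}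
    (h : ((0, w) : (Fin 6 → ZMod 2) × (Fin k → U)) ∈ E.moduleOf X) (hw : w ≠ 0) :
    ∃ w' : Fin k → U, ((0, w') : (Fin 6 → ZMod 2) × (Fin k → U)) ∈ E.moduleOf X ∧ w' ≠ 0 ∧
      ∀ l, w' l ∈ U.W := by
  by_cases hW : ∀ l, w l ∈ U.W
  · exact ⟨w, h, hw, hW⟩
  · push Not at hW
    obtain ⟨l, hl⟩ := hW
    obtain ⟨σ, hσ⟩ := exists_toW_ne _ hl
    have hs : ∀ (τ : Equiv.Perm (Fin 5)) {u : Fin k → U},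
        ((0, u) : (Fin 6 → ZMod 2) × (Fin k → U)) ∈ E.moduleOf X →
        ((0, u + τ • u) : (Fin 6 → ZMod 2) × (Fin k → U)) ∈ E.moduleOf X := by
      intro τ u hu
      have := (E.moduleOf X).add_mem hu (smul_mem_moduleOf hX τ hu)
      rwa [Prod.mk_add_mk, zero_add] at this
    refine ⟨toW (σ • w), hs _ (hs _ (smul_mem_moduleOf hX σ h)), fun h0 => hσ ?_,
      fun m => toW_mem (σ • w m)⟩
    exact congrFun h0 l

theorem smul_single (σ : Equiv.Perm (Fin 5)) (l : Fin k) (u : U) :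
    σ • (Pi.single l u : Fin k → U) = Pi.single l (σ • u) := by
  funext m
  by_cases hm : m = l
  · subst hm; simp
  · simp [Pi.single_eq_of_ne hm]

theorem single_cyclicSum_mem (hX : X.Normal) {l : Fin k} {u : U} (a)
    (h : ((0, Pi.single l u) : (Fin 6 → ZMod 2) × (Fin k → U)) ∈ E.moduleOf X) :
    ((0, Pi.single l (U.cyclicSum a u)) : (Fin 6 → ZMod 2) × (Fin k → U)) ∈ E.moduleOf X := by
  let B : AddSubgroup U := (E.moduleOf X).comap
    ((AddMonoidHom.inr (Fin 6 → ZMod 2) (Fin k → U)).comp (AddMonoidHom.single (fun _ => U) l))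
  have hB : ∀ u, u ∈ B ↔ ((0, Pi.single l u) : (Fin 6 → ZMod 2) × (Fin k → U)) ∈
    E.moduleOf X := fun _ => Iff.rfl
  rw [← hB] at *
  refine U.cyclicSum_mem (T := B) (fun u hu => ?_) a h
  have := smul_mem_moduleOf hX (fiveCycle 0) ((hB u).1 hu)
  rw [smul_single] at this
  exact this

variable {H : Subgroup G} {q : Fin 6} {T : Submodule (ZMod 2) U} {ψ : Additive (J₀ J) ≃+ T}

theorem inr_mem_bigH {hρ : ρ.ker = J} {h : G} (hh : h ∈ H) (i : Fin k) :
    (SemidirectProduct.inr h : BigGroup ρ k) ∈ bigH H hρ i ψ :=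
  Subgroup.mem_sup_left (Subgroup.mem_map_of_mem _ hh)

theorem inr_mem_bigK_of_odd {c : G} (hc : c * c = 1) (hρc : Equiv.Perm.sign (ρ c) = -1)
    (E : ExtData J ρ) (i : Fin k) {a : G} (ha : a * a = 1) (hρa : Equiv.Perm.sign (ρ a) = -1) :
    (SemidirectProduct.inr a : BigGroup ρ k) ∈ bigK ρ c J i :=
  (mem_bigK_iff E hc hρc i _).2 (Or.inl (isOddInvolution_inr ha hρa))

/-- A normal subgroup of `𝓖` that satisfies `hM` and contains a nonzero vector of `W ^ k` has an
element with a nontrivial component in `J₀`. -/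
theorem IsTwist.exists_even_of_mem_W (A : IsTwist E H q T ψ) {c : G} (hc : c * c = 1)
    (hρc : Equiv.Perm.sign (ρ c) = -1) (i : Fin k) (hX : X.Normal)
    (hM : ∀ x ∈ bigK ρ c J i, ∀ y ∈ bigK ρ c J i, ∀ h ∈ bigH H E.ker i ψ, ∀ m ∈ X,
      x * y⁻¹ = h * m → x * y⁻¹ ∈ X) {w : Fin k → U} (hw : w ≠ 0) (hwW : ∀ l, w l ∈ U.W)
    (h : ((0, w) : (Fin 6 → ZMod 2) × (Fin k → U)) ∈ E.moduleOf X) :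
    ∃ v u, ∑ p, v p = 0 ∧ (¬ ∃ a, ∀ p, v p = a) ∧ (v, u) ∈ E.moduleOf X := by
  -- The vector `(compl 0, 0)` lies in `S` but not in `W`, so its component `t` in `T` is nonzero.
  -- With `W*` in place of `S*` no such vector would be available.
  obtain ⟨t, ht, w', hw', hs⟩ := A.admissible.exists_add A.card_T (U.mk (U.compl 0) 0)
  have hS : U.mk (U.compl 0) 0 ∈ U.S := (U.mem_S_iff _).2 (by decide +kernel)
  have ht0 : t ≠ 0 := by
    rintro rfl
    rw [zero_add] at hs
    rw [← hs, U.mem_W] at hw'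
    revert hw'
    decide +kernel
  obtain ⟨v₀, hv₀⟩ : ∃ v₀ : J₀ J, (ψ (Additive.ofMul v₀) : U) = t :=
    ⟨(ψ.symm ⟨t, ht⟩).toMul, by simp⟩
  have hρv : ρ v₀ = 1 := E.ρ_of_mem_J₀ v₀.2
  obtain ⟨v, hv, hjv⟩ := (E.mem_J₀ _).1 v₀.2
  -- If `w` has support outside `i`, then `w₁ = w` moves `w'` out of `W*`. Otherwise `w` generates
  -- all of `W*`, and `w₁ = w'` moves it to `0`.
  obtain ⟨w₁, hw₁, hw₂⟩ : ∃ w₁ : Fin k → U,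
      ((0, w₁) : (Fin 6 → ZMod 2) × (Fin k → U)) ∈ E.moduleOf X ∧
      Pi.single i w' + w₁ ∈ tildeW i := by
    by_cases hj : ∃ l, l ≠ i ∧ w l ≠ 0
    · refine ⟨w, h, (mem_tildeW_iff i _).2 ⟨fun l hl => ?_, fun h0 => ?_, fun _ => ?_⟩⟩
      · rw [Pi.add_apply, Pi.single_eq_of_ne hl, zero_add]; exact hwW l
      · obtain ⟨l, hl, hl0⟩ := hj
        have := h0 l hl
        rw [Pi.add_apply, Pi.single_eq_of_ne hl, zero_add] at this
        exact absurd this hl0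
      · rw [Pi.add_apply, Pi.single_eq_same]; exact U.W.add_mem hw' (hwW i)
    · push Not at hj
      have hwi : w = Pi.single i (w i) := by
        funext l
        by_cases hl : l = i
        · subst hl; rw [Pi.single_eq_same]
        · rw [Pi.single_eq_of_ne hl, hj l hl]
      have hne : (w i).1 ≠ 0 := by
        intro h0
        refine hw ?_
        rw [hwi, U.ext (u := w i) (v := 0) h0 ((U.mem_W.1 (hwW i)).symm.trans h0),
          Pi.single_zero]
      obtain ⟨a, ha⟩ := U.exists_cyclicSum _ w'.1 hne
      have h1 : U.cyclicSum a (w i) = w' := by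
        apply U.ext
        · rw [U.cyclicSum_fst, ha]
        · rw [U.cyclicSum_snd, ← U.mem_W.1 (hwW i), ha, U.mem_W.1 hw']
      rw [hwi] at h
      have h2 := single_cyclicSum_mem hX a h
      rw [h1] at h2
      refine ⟨_, h2, ?_⟩
      rw [vec_add_self]; exact zero_mem_tildeW i
  have hx : el ρ (Pi.single i (U.mk (U.compl 0) 0)) (v₀ : G) ∈ bigK ρ c J i := by
    refine (mem_bigK_iff E hc hρc i _).2 (Or.inr ⟨v₀.2, (mem_tildeW_iff i _).2
      ⟨fun l hl => ?_, fun _ => ?_, fun h0 => ?_⟩⟩)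
    · rw [vec_el, Pi.single_eq_of_ne hl]; exact U.W.zero_mem
    · rw [vec_el, Pi.single_eq_same]; exact hS
    · obtain ⟨l, hl, hl0⟩ := h0
      rw [vec_el, Pi.single_eq_of_ne hl] at hl0
      exact absurd rfl hl0
  have hy : el ρ (Pi.single i w' + w₁) (1 : G) ∈ bigK ρ c J i :=
    (mem_bigK_iff E hc hρc i _).2 (Or.inr ⟨Subgroup.one_mem _, hw₂⟩)
  -- The twist: `𝓗` contains `t` together with `v₀ = ψ⁻¹(t)`. So `x y⁻¹ ∈ 𝓗 X`, and its
  -- `J₀`-component `v₀` is nontrivial.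
  have hh : el ρ (Pi.single i t) (v₀ : G) ∈ bigH H E.ker i ψ := by
    refine (A.mem_bigH i _).2 ⟨v₀, 1, H.one_mem, (mul_one _).symm, fun l hl => ?_, ?_⟩
    · rw [vec_el, Pi.single_eq_of_ne hl]; exact T.zero_mem
    · rw [vec_el, Pi.single_eq_same, hv₀]
  have hm : el ρ w₁ (1 : G) ∈ X := by
    rw [mem_moduleOf, E.j_zero] at hw₁; exact hw₁
  have hxy : el ρ (Pi.single i (U.mk (U.compl 0) 0)) (v₀ : G) *
      (el ρ (Pi.single i w' + w₁) (1 : G))⁻¹ = el ρ (Pi.single i t + w₁) (v₀ : G) := by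
    apply ext'
    · rw [vec_mul, vec_inv, vec_el, vec_el, vec_el, right_el, right_el, hρv, map_one, inv_one,
        one_smul, one_smul, neg_vec, hs, Pi.single_add, ← add_assoc, add_assoc (Pi.single i t : Fin k → U),
        vec_add_self, add_zero]
    · simp
  have hhm : el ρ (Pi.single i t) (v₀ : G) * el ρ w₁ (1 : G) =
      el ρ (Pi.single i t + w₁) (v₀ : G) := by
    apply ext'
    · rw [vec_mul, vec_el, vec_el, vec_el, right_el, hρv, one_smul]
    · simp
  have := hM _ hx _ hy _ hh _ hm (hxy.trans hhm.symm)
  rw [hxy] at this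
  refine ⟨v, Pi.single i t + w₁, hv, fun hconst => ht0 ?_, ?_⟩
  · have h1 : v₀ = 1 := Subtype.ext (hjv.symm.trans ((E.j_eq_one v).2 hconst))
    rw [← hv₀, h1, ofMul_one, map_zero]; rfl
  · rw [mem_moduleOf, hjv]; exact this

/-- A normal subgroup of `𝓖` that satisfies `hM` and contains `J₀` contains the odd
involutions of `G`. -/
theorem IsTwist.odd_mem_of_even_mem (A : IsTwist E H q T ψ) {c : G} (hc : c * c = 1)
    (hρc : Equiv.Perm.sign (ρ c) = -1) (i : Fin k) (hX : X.Normal)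
    (hM : ∀ x ∈ bigK ρ c J i, ∀ y ∈ bigK ρ c J i, ∀ h ∈ bigH H E.ker i ψ, ∀ m ∈ X,
      x * y⁻¹ = h * m → x * y⁻¹ ∈ X)
    (heven : ∀ v : Fin 6 → ZMod 2, ∑ p, v p = 0 →
      (SemidirectProduct.inr (E.j v) : BigGroup ρ k) ∈ X) :
    (SemidirectProduct.inr c : BigGroup ρ k) ∈ X := by
  have hlift : ∀ τ : Equiv.Perm (Fin 5), τ * τ = 1 → Equiv.Perm.sign τ = -1 →
      ∃ a, a * a = 1 ∧ ρ a = τ := fun τ => E.exists_lift hc hρc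
  have hK := fun {a : G} => inr_mem_bigK_of_odd (a := a) hc hρc E i
  have hJ : ∀ v, (SemidirectProduct.inr (E.j v) : BigGroup ρ k) ∈ X := by
    obtain ⟨c₀, hc₀, hρc₀⟩ := hlift (Equiv.swap 0 1) (by decide +kernel) (by decide +kernel)
    have hsgn : Equiv.Perm.sign (ρ c₀) = -1 := by rw [hρc₀]; decide +kernel
    obtain ⟨⟨w, hw, hwf⟩, -⟩ := exists_fixed_vectors
    refine j_mem_of_odd heven hw ?_
    have h1 := (E.mul_j_sq hc₀ w).2 (by rwa [hρc₀])
    have h2 : (SemidirectProduct.inr (c₀ * E.j w) : BigGroup ρ k) *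
        (SemidirectProduct.inr c₀)⁻¹ = SemidirectProduct.inr (E.j w) := by
      rw [← map_inv, ← map_mul, inv_eq_of_mul_eq_one_left hc₀]
      congr 1
      exact (eq_inv_of_mul_eq_one_left (by rw [mul_assoc]; exact h1)).trans (E.j_inv w)
    -- `w` and `e_q` are both odd, so `w` is the sum of `e_q`, which lies in `H`, and an even
    -- vector, which lies in `X`.
    have h3 : (SemidirectProduct.inr (E.j w) : BigGroup ρ k) =
        SemidirectProduct.inr (E.j (Pi.single q 1)) *
          SemidirectProduct.inr (E.j (Pi.single q 1 + w)) := by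
      rw [← map_mul, ← E.j_add, ← add_assoc, CharTwo.add_self_eq_zero, zero_add]
    have h4 := hM _ (hK h1 (by rw [map_mul, E.ρ_j, mul_one, hsgn])) _ (hK hc₀ hsgn) _
      (inr_mem_bigH A.point.single_mem i) _ (heven (Pi.single q 1 + w) (by
        simp only [Pi.add_apply, Finset.sum_add_distrib, hw, Finset.sum_pi_single',
          Finset.mem_univ, if_true]
        decide)) (h2.trans h3)
    rwa [h2] at h4
  have hmap : ((X.comap SemidirectProduct.inr).map ρ).Normal :=
    Subgroup.Normal.map inferInstance ρ E.surj
  have hmem : ∀ g, ρ g ∈ (X.comap SemidirectProduct.inr).map ρ →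
      (SemidirectProduct.inr g : BigGroup ρ k) ∈ X := by
    rintro g ⟨g', hg', h⟩
    obtain ⟨v, rfl⟩ := E.exists_j_of_ρ_eq h.symm
    rw [map_mul]
    exact X.mul_mem hg' (hJ v)
  -- `F₂₀` contains a double transposition. Lifting its two factors to involutions `x, y` puts `x y`
  -- into `H J`, hence into `X`.
  obtain ⟨a, b, a', b', hab, hab', hfix, hne⟩ := exists_swaps_fix q
  obtain ⟨x, hx, hρx⟩ := hlift (Equiv.swap a b) (by simp) (Equiv.Perm.sign_swap hab)
  obtain ⟨y, hy, hρy⟩ := hlift (Equiv.swap a' b') (by simp) (Equiv.Perm.sign_swap hab')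
  have hxy : (SemidirectProduct.inr (x * y) : BigGroup ρ k) ∈ X := by
    obtain ⟨h, hh, hρh⟩ := A.point.surj _ hfix
    obtain ⟨v, hv⟩ := E.exists_j_of_ρ_eq (a := x * y) (c := h) (by
      rw [map_mul, hρx, hρy, hρh])
    have h1 : (SemidirectProduct.inr x : BigGroup ρ k) * (SemidirectProduct.inr y)⁻¹ =
        SemidirectProduct.inr (x * y) := by
      rw [← map_inv, ← map_mul, inv_eq_of_mul_eq_one_left hy]
    have := hM _ (hK hx (by rw [hρx]; exact Equiv.Perm.sign_swap hab)) _
      (hK hy (by rw [hρy]; exact Equiv.Perm.sign_swap hab')) _ (inr_mem_bigH hh i) _ (hJ v)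
      (by rw [h1, hv, map_mul])
    rwa [h1] at this
  have hA5 := alternatingGroup_le_of_normal hmap (σ := ρ (x * y)) ⟨_, hxy, rfl⟩ (by
      rw [map_mul, hρx, hρy, map_mul, Equiv.Perm.sign_swap hab, Equiv.Perm.sign_swap hab']
      decide) (by rwa [map_mul, hρx, hρy])
  -- An odd element of `H` differs from `c` by an even one, which `X` now contains. So `hM` applies
  -- to the pair `c, 1`.
  obtain ⟨σ, hσ, hsgn⟩ := exists_odd_fix q
  obtain ⟨h, hh, rfl⟩ := A.point.surj σ hσ
  have h1 : (SemidirectProduct.inr (h⁻¹ * c) : BigGroup ρ k) ∈ X := by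
    refine hmem _ (hA5 (Equiv.Perm.mem_alternatingGroup.2 ?_))
    rw [map_mul, map_inv, map_mul, map_inv, hsgn, hρc]
    decide
  have h3 : (SemidirectProduct.inr c : BigGroup ρ k) * 1⁻¹ =
      SemidirectProduct.inr h * SemidirectProduct.inr (h⁻¹ * c) := by
    rw [inv_one, mul_one, ← map_mul, mul_inv_cancel_left]
  have h2 := hM _ (hK hc hρc) _ (one_mem_bigK E hc hρc i) _ (inr_mem_bigH hh i) _ h1 h3
  rwa [inv_one, mul_one] at h2

theorem closure_bigK (E : ExtData J ρ) {c : G} (hc : c * c = 1)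
    (hρc : Equiv.Perm.sign (ρ c) = -1) (i : Fin k) : Subgroup.closure (bigK ρ c J i) = ⊤ := by
  have h1 := eq_top_of_odd_mem (X := Subgroup.normalClosure (bigK ρ c J i)) inferInstance E
    (isOddInvolution_inr hc hρc)
    (Subgroup.subset_normalClosure (inr_mem_bigK_of_odd hc hρc E i hc hρc))
  rw [eq_top_iff, ← h1, Subgroup.normalClosure, Subgroup.closure_le]
  intro x hx
  obtain ⟨y, hy, hyx⟩ := Group.mem_conjugatesOfSet_iff.1 hx
  obtain ⟨g, rfl⟩ := isConj_iff.1 hyx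
  exact Subgroup.subset_closure (conj_mem_bigK E hc hρc hy g)

/-- An odd involution in `X` generates everything. Otherwise `X` has an element over `J₀`: either
its component in `J₀` is nontrivial, or it is a pure vector, which leads to `W ^ k` and then to
`exists_even_of_mem_W`. -/
theorem IsTwist.eq_top_of_normal (A : IsTwist E H q T ψ) {c : G} (hc : c * c = 1)
    (hρc : Equiv.Perm.sign (ρ c) = -1) (i : Fin k) (hX : X.Normal)
    (hM : ∀ x ∈ bigK ρ c J i, ∀ y ∈ bigK ρ c J i, ∀ h ∈ bigH H E.ker i ψ, ∀ m ∈ X,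
      x * y⁻¹ = h * m → x * y⁻¹ ∈ X) (hK : ∃ x ∈ bigK ρ c J i, x ∈ X ∧ x ≠ 1) : X = ⊤ := by
  obtain ⟨x, hx, hxX, hx1⟩ := hK
  rcases (mem_bigK_iff E hc hρc i x).1 hx with hodd | ⟨hxJ, -⟩
  · exact eq_top_of_odd_mem hX E hodd hxX
  refine eq_top_of_odd_mem hX E (isOddInvolution_inr hc hρc)
    (A.odd_mem_of_even_mem hc hρc i hX hM ?_)
  obtain ⟨v, hv, hjv⟩ := (E.mem_J₀ _).1 hxJ
  have hxv : (v, vec x) ∈ E.moduleOf X := by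
    rw [mem_moduleOf, hjv]; exact hxX
  have key : ∃ v u, ∑ p, v p = 0 ∧ (¬ ∃ a, ∀ p, v p = a) ∧ (v, u) ∈ E.moduleOf X := by
    by_cases hc0 : ∃ a, ∀ p, v p = a
    · have hr : x.right = 1 := by rw [← hjv]; exact (E.j_eq_one v).2 hc0
      obtain ⟨w, h1, h2, h3⟩ := exists_mem_moduleOf_W (E := E) (w := vec x) hX (by
        rw [mem_moduleOf, E.j_zero, ← hr]; exact hxX) (fun h0 => hx1 (ext' h0 hr))
      exact A.exists_even_of_mem_W hc hρc i hX hM h2 h3 h1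
    · exact ⟨v, vec x, hv, hc0, hxv⟩
  obtain ⟨v, u, hv, hv', h⟩ := key
  exact fun v' hv0 => even_mem_moduleOf hX hv hv' h v' hv0

end Simple

/-- The construction yields simple Bol loops of exponent `2`. -/
theorem isLoopFolder_bigK {G : Type*} [Group G] {J : Subgroup G} (hG : IsNonsplitS5Extension J)
    (P : Sylow 5 G) {c : G} (hc : orderOf c = 2) (hcJ : c ∉ commutator G ⊔ J)
    {ρ : G →* Equiv.Perm (Fin 5)} (hρ : Function.Surjective ρ) (hρJ : ρ.ker = J)
    {T : Submodule (ZMod 2) U}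
    (hT : ∀ h ∈ Subgroup.normalizer (P : Set G), ∀ u ∈ T, ρ h • u ∈ T)
    (hT1 : T ≠ ⊤) (hTW : T ≠ U.W) (ψ : Additive (J₀ J) ≃+ T)
    (hψ : ∀ h ∈ Subgroup.normalizer (P : Set G), ∀ v v' : J₀ J, (v' : G) = h * v * h⁻¹ →
      (ψ (Additive.ofMul v') : U) = ρ h • (ψ (Additive.ofMul v) : U)) {k : ℕ} (i : Fin k) :
    IsUnionOfInvolutionClasses (bigK ρ c J i) ∧
      ∃ F : IsLoopFolder (bigH (Subgroup.normalizer (P : Set G)) hρJ i ψ) (bigK ρ c J i),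
        Loop.IsBol F.Q ∧ Loop.HasExponent F.Q 2 ∧ Loop.IsSimple F.Q ∧
          Nat.card F.Q = 96 * 16 ^ k := by
  obtain ⟨E⟩ := hG.nonempty_extData hρ hρJ
  have hc2 : c * c = 1 := by rw [← sq, ← hc]; exact pow_orderOf_eq_one c
  have hc1 : c ≠ 1 := by rintro rfl; simp at hc
  have hρc : Equiv.Perm.sign (ρ c) = -1 :=
    (Int.units_eq_one_or _).resolve_left fun h => hcJ ((E.mem_iff c).2 h)
  obtain ⟨q, hq, -⟩ := E.exists_isPointNormalizer P
  have A : IsTwist E (Subgroup.normalizer (P : Set G)) q T ψ :=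
    { point := hq
      admissible := U.isAdmissible q (fun σ hσ u hu => by
          obtain ⟨h, hh, rfl⟩ := hq.surj σ hσ
          exact hT h hh u hu)
        (fun h => hT1 (Submodule.toAddSubgroup_injective h))
        (fun h => hTW (Submodule.toAddSubgroup_injective h))
      smul_mem := hT
      equivariant := hψ }
  have hKc := inr_mem_bigK_of_odd hc2 hρc E i hc2 hρc
  have hK1 : ∃ x ∈ bigK ρ c J i, x ≠ 1 :=
    ⟨_, hKc, fun h => hc1 (SemidirectProduct.inr_injective (h.trans (map_one _).symm))⟩
  have hsq := fun x hx => mul_self_of_mem_bigK (x := x) (i := i) E hc2 hρc hx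
  let F := A.isLoopFolder hc2 hρc i
  exact ⟨isUnionOfInvolutionClasses_bigK E hc2 hρc i, F,
    F.isBol (fun x hx y _ => conj_mem_bigK E hc2 hρc hx y) hsq,
    F.hasExponent_two hsq hK1,
    F.isSimple (closure_bigK E hc2 hρc i) hK1 fun M hMn hM hMK =>
      A.eq_top_of_normal hc2 hρc i hMn hM hMK,
    (A.card_eq hc2 hρc i).2⟩

end BolLoops
namespace BolLoops

/-! ### Homomorphisms from `SL(2, 5)` -/

/-- The word in `u` and `w` that expresses a matrix of determinant `1` over `𝔽₅` when `u` and `w`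
are the matrices `T` and `S`. -/
def normalForm {M : Type*} [Monoid M] (u w : M) (a b c d : ZMod 5) : M :=
  -- For `c ≠ 0` the matrix is `T^x S T^c S T^z` with `x = (a + 1) / c` and `z = (d + 1) / c`; here
  -- `c ^ 3 = 1 / c`. For `c = 0` this is applied to the product with `S`, and `S³ = S⁻¹` is
  -- appended.
  if c = 0 then u ^ ((b + 1) * a).val * (w * u ^ d.val * w * u ^ a.val * (w * w * w))
  else u ^ ((a + 1) * c ^ 3).val * (w * u ^ c.val * w * u ^ ((d + 1) * c ^ 3).val)

/-- The first row of a matrix of determinant `1` with second row `c d`. -/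
def firstRow (c d : ZMod 5) : ZMod 5 × ZMod 5 := if c = 0 then (d ^ 3, 0) else (0, -c ^ 3)

/-- The relations between `u` and `w` that make the normal form multiplicative. -/
structure IsModularPair {M : Type*} [Monoid M] (u w : M) : Prop where
  pow_five : u ^ 5 = 1
  one : normalForm u w 1 0 0 1 = 1
  mul_u : ∀ c d : ZMod 5, (c, d) ≠ 0 →
    normalForm u w (firstRow c d).1 ((firstRow c d).1 + (firstRow c d).2) c (c + d) =
      normalForm u w (firstRow c d).1 (firstRow c d).2 c d * u
  mul_w : ∀ c d : ZMod 5, (c, d) ≠ 0 →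
    normalForm u w (firstRow c d).2 (-(firstRow c d).1) d (-c) =
      normalForm u w (firstRow c d).1 (firstRow c d).2 c d * w

theorem pow_val_add {M : Type*} [Monoid M] {u : M} (h : u ^ 5 = 1) (x y : ZMod 5) :
    u ^ (x + y).val = u ^ x.val * u ^ y.val := by
  rw [← pow_add, ZMod.val_add, ← pow_eq_pow_mod _ h]

theorem exists_firstRow (a b c d : ZMod 5) (h : a * d - b * c = 1) :
    ∃ t, a = (firstRow c d).1 + t * c ∧ b = (firstRow c d).2 + t * d := by
  revert a b c d; decide +kernel

theorem firstRow_det (c d : ZMod 5) (h : (c, d) ≠ 0) :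
    (firstRow c d).1 * d - (firstRow c d).2 * c = 1 := by
  revert c d; decide +kernel

/-- Left multiplication by `T^t` adds `t` times the second row to the first. Hence the relations in
`IsModularPair` are needed for only one first row per second row. -/
theorem normalForm_add {M : Type*} [Monoid M] {u w : M} (h : u ^ 5 = 1) (t a b c d : ZMod 5)
    (hd : a * d - b * c = 1) : normalForm u w (a + t * c) (b + t * d) c d =
      u ^ t.val * normalForm u w a b c d := by
  unfold normalForm
  split_ifs with hc
  · subst hc
    have h1 : (b + t * d + 1) * (a + t * 0) = t + (b + 1) * a := by linear_combination t * hd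
    rw [h1, pow_val_add h, mul_assoc, mul_zero, add_zero]
  · have h1 : (a + t * c + 1) * c ^ 3 = t + (a + 1) * c ^ 3 := by
      have : c ^ 4 = 1 := ZMod.pow_card_sub_one_eq_one hc
      linear_combination t * this
    rw [h1, pow_val_add h, mul_assoc]

namespace IsModularPair

variable {M : Type*} [Monoid M] {u w : M} (h : IsModularPair u w)
include h

theorem normalForm_mul_u (a b c d : ZMod 5) (hd : a * d - b * c = 1) :
    normalForm u w a (a + b) c (c + d) = normalForm u w a b c d * u := by
  obtain ⟨t, ha, hb⟩ := exists_firstRow a b c d hd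
  have hcd : (c, d) ≠ 0 := by
    rintro h0
    rw [Prod.mk_eq_zero] at h0
    rw [h0.1, h0.2] at hd
    simp at hd
  have hd' := firstRow_det c d hcd
  have h1 := h.mul_u c d hcd
  generalize (firstRow c d).1 = a₀ at *
  generalize (firstRow c d).2 = b₀ at *
  subst ha hb
  have h2 : a₀ + t * c + (b₀ + t * d) = a₀ + b₀ + t * (c + d) := by ring
  rw [h2, normalForm_add h.pow_five _ _ _ _ _ hd',
    normalForm_add h.pow_five _ _ _ _ _ (by linear_combination hd'), h1, mul_assoc]

theorem normalForm_mul_w (a b c d : ZMod 5) (hd : a * d - b * c = 1) :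
    normalForm u w b (-a) d (-c) = normalForm u w a b c d * w := by
  obtain ⟨t, ha, hb⟩ := exists_firstRow a b c d hd
  have hcd : (c, d) ≠ 0 := by
    rintro h0
    rw [Prod.mk_eq_zero] at h0
    rw [h0.1, h0.2] at hd
    simp at hd
  have hd' := firstRow_det c d hcd
  have h1 := h.mul_w c d hcd
  generalize (firstRow c d).1 = a₀ at *
  generalize (firstRow c d).2 = b₀ at *
  subst ha hb
  have h2 : -(a₀ + t * c) = -a₀ + t * (-c) := by ring
  rw [h2, normalForm_add h.pow_five _ _ _ _ _ hd',
    normalForm_add h.pow_five _ _ _ _ _ (by linear_combination hd'), h1, mul_assoc]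

end IsModularPair

/-- The matrix `T`. -/
def slT : SL(2, ZMod 5) := ⟨!![1, 1; 0, 1], by decide⟩

/-- The matrix `S`. -/
def slS : SL(2, ZMod 5) := ⟨!![0, -1; 1, 0], by decide⟩

theorem sl_det (A : SL(2, ZMod 5)) : A 0 0 * A 1 1 - A 0 1 * A 1 0 = 1 := by
  rw [← Matrix.det_fin_two]; exact A.2

set_option maxRecDepth 100000 in
theorem normalForm_sl_aux (a b c d : ZMod 5) (h : a * d - b * c = 1) :
    (normalForm slT slS a b c d).1 = !![a, b; c, d] := by
  revert a b c d; decide +kernel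

theorem normalForm_sl (A : SL(2, ZMod 5)) :
    normalForm slT slS (A 0 0) (A 0 1) (A 1 0) (A 1 1) = A := by
  apply Subtype.ext
  rw [normalForm_sl_aux _ _ _ _ (sl_det A)]
  exact (Matrix.eta_fin_two A.1).symm

theorem closure_sl : Subgroup.closure {slT, slS} = (⊤ : Subgroup SL(2, ZMod 5)) := by
  refine eq_top_iff.2 fun A _ => ?_
  have hT : slT ∈ Subgroup.closure {slT, slS} := Subgroup.subset_closure (by simp)
  have hS : slS ∈ Subgroup.closure {slT, slS} := Subgroup.subset_closure (by simp)
  rw [← normalForm_sl A]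
  have hp := fun n => Subgroup.pow_mem _ hT n
  have hm := fun {x y} => Subgroup.mul_mem (Subgroup.closure {slT, slS}) (x := x) (y := y)
  unfold normalForm
  split_ifs
  · exact hm (hp _) (hm (hm (hm (hm hS (hp _)) hS) (hp _)) (hm (hm hS hS) hS))
  · exact hm (hp _) (hm (hm (hm hS (hp _)) hS) (hp _))

/-- The normal form of a matrix. -/
def slForm {M : Type*} [Monoid M] (u w : M) (A : SL(2, ZMod 5)) : M :=
  normalForm u w (A 0 0) (A 0 1) (A 1 0) (A 1 1)

namespace IsModularPair

variable {M : Type*} [Monoid M] {u w : M} (h : IsModularPair u w)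
include h

theorem slForm_one : slForm u w 1 = 1 := h.one

theorem slForm_mul_slT (A : SL(2, ZMod 5)) : slForm u w (A * slT) = slForm u w A * u := by
  unfold slForm
  rw [← h.normalForm_mul_u _ _ _ _ (sl_det A), Matrix.SpecialLinearGroup.coe_mul]
  congr 1 <;> rw [Matrix.mul_apply, Fin.sum_univ_two] <;> simp [slT]

theorem slForm_mul_slS (A : SL(2, ZMod 5)) : slForm u w (A * slS) = slForm u w A * w := by
  unfold slForm
  rw [← h.normalForm_mul_w _ _ _ _ (sl_det A), Matrix.SpecialLinearGroup.coe_mul]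
  congr 1 <;> rw [Matrix.mul_apply, Fin.sum_univ_two] <;> simp [slS]

theorem slForm_slT : slForm u w slT = u := by
  rw [← one_mul slT, h.slForm_mul_slT, h.slForm_one, one_mul]

theorem slForm_slS : slForm u w slS = w := by
  rw [← one_mul slS, h.slForm_mul_slS, h.slForm_one, one_mul]

/-- The homomorphism with `T ↦ u` and `S ↦ w`. -/
def hom : SL(2, ZMod 5) →* M where
  toFun := slForm u w
  map_one' := h.slForm_one
  map_mul' A B := by
    have hB : B ∈ (Subgroup.closure {slT, slS}).toSubmonoid := by rw [closure_sl]; trivial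
    -- In a finite group the generators also generate as a monoid, so the induction needs no
    -- inverses.
    rw [Subgroup.closure_toSubmonoid_of_finite] at hB
    induction hB using Submonoid.closure_induction generalizing A with
    | mem x hx =>
      rcases hx with rfl | rfl
      · rw [h.slForm_mul_slT, h.slForm_slT]
      · rw [h.slForm_mul_slS, h.slForm_slS]
    | one => rw [mul_one, h.slForm_one, mul_one]
    | mul x y _ _ hx hy => rw [← mul_assoc, hy, hx, hy x, mul_assoc]

end IsModularPair

theorem sl_hom_ext {M : Type*} [Monoid M] {f g : SL(2, ZMod 5) →* M} (hT : f slT = g slT)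
    (hS : f slS = g slS) : f = g := by
  refine MonoidHom.eq_of_eqOn_dense closure_sl ?_
  rintro x (rfl | rfl)
  · exact hT
  · exact hS

/-! ### The representations -/

/-- The image of `T` in the lift of the representation of `SL(2, 5)` over `𝔽₄` to `ℤ/4`. -/
def matT : Matrix (Fin 4) (Fin 4) (ZMod 4) := !![0, 0, 3, 0; 0, 0, 0, 3; 1, 0, 1, 1; 0, 1, 3, 2]

/-- The image of `S`. -/
def matS : Matrix (Fin 4) (Fin 4) (ZMod 4) := !![0, 0, 0, 1; 0, 0, 3, 1; 3, 1, 0, 0; 3, 0, 0, 0]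

/-- The image of the outer involution. -/
def matC : Matrix (Fin 4) (Fin 4) (ZMod 4) := !![1, 1, 3, 1; 2, 3, 0, 1; 2, 2, 1, 1; 0, 2, 2, 3]

set_option maxRecDepth 100000 in
-- Stating `IsModularPair` for monoids allows a direct check on matrices; invertibility follows
-- later from `MonoidHom.toHomUnits`.
theorem isModularPair_mat : IsModularPair matT matS := by
  refine ⟨?_, ?_, ?_, ?_⟩ <;> decide +kernel

/-- The image of `T` in `S₅`. -/
def permT : Equiv.Perm (Fin 5) := c[0, 1, 2, 3, 4]

/-- The image of `S` in `S₅`. -/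
def permS : Equiv.Perm (Fin 5) := Equiv.swap 0 4 * Equiv.swap 1 2

/-- The image of the outer involution in `S₅`. -/
def permC : Equiv.Perm (Fin 5) := Equiv.swap 2 4

theorem isModularPair_perm : IsModularPair permT permS := by
  refine ⟨?_, ?_, ?_, ?_⟩ <;> decide +kernel

end BolLoops
namespace BolLoops

/-! ### The double cover of `S₅` -/

/-- The homomorphism from `ℤˣ` that an involution defines. -/
def involutionHom {M : Type*} [Monoid M] (c : M) (hc : c * c = 1) : ℤˣ →* M where
  toFun e := if e = 1 then 1 else c
  map_one' := if_pos rfl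
  map_mul' a b := by
    rcases Int.units_eq_one_or a with rfl | rfl <;> rcases Int.units_eq_one_or b with rfl | rfl <;>
      simp [hc]

/-- Conjugation of `SL(2, 5)` by the matrix `(0, 3; 1, 0)`, as a function. -/
def twistFun (A : SL(2, ZMod 5)) : SL(2, ZMod 5) :=
  ⟨!![A 1 1, 3 * A 1 0; 2 * A 0 1, A 0 0], by
    have h6 : (6 : ZMod 5) = 1 := by decide
    rw [Matrix.det_fin_two_of]
    linear_combination sl_det A - A 0 1 * A 1 0 * h6⟩

theorem twistFun_twistFun (A : SL(2, ZMod 5)) : twistFun (twistFun A) = A := by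
  have h6 : (3 : ZMod 5) * 2 = 1 := by decide
  have h6' : (2 : ZMod 5) * 3 = 1 := by decide
  ext i j
  fin_cases i <;> fin_cases j <;> simp [twistFun, ← mul_assoc, h6, h6']

/-- Conjugation of `SL(2, 5)` by the matrix `(0, 3; 1, 0)`. -/
def twist : MulAut SL(2, ZMod 5) where
  toFun := twistFun
  invFun := twistFun
  left_inv := twistFun_twistFun
  right_inv := twistFun_twistFun
  map_mul' A B := by
    have h6 : (6 : ZMod 5) = 1 := by decide
    apply Subtype.ext
    rw [Matrix.SpecialLinearGroup.coe_mul]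
    simp only [twistFun, Matrix.SpecialLinearGroup.coe_mul, Matrix.mul_apply, Fin.sum_univ_two]
    ext i j
    rw [Matrix.mul_apply, Fin.sum_univ_two]
    fin_cases i <;> fin_cases j <;> simp
    · linear_combination -A 1 0 * B 0 1 * h6
    · ring
    · ring
    · linear_combination -A 0 1 * B 1 0 * h6

theorem twist_mul_twist : twist * twist = 1 := MulEquiv.ext twistFun_twistFun

/-- The double cover of `S₅` in which the transpositions lift to involutions. -/
abbrev DoubleCover : Type := SL(2, ZMod 5) ⋊[involutionHom twist twist_mul_twist] ℤˣ

namespace DoubleCover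

open SemidirectProduct

/-- The homomorphism that extends `f` and maps the outer involution to `c`. -/
def lift {H : Type*} [Group H] (f : SL(2, ZMod 5) →* H) (c : H) (hc : c * c = 1)
    (h : ∀ A, f (twist A) = c * f A * c⁻¹) : DoubleCover →* H :=
  SemidirectProduct.lift f (involutionHom c hc) (by
    intro e
    ext A
    rcases Int.units_eq_one_or e with rfl | rfl
    · simp
    · exact h A)

section lift

variable {H : Type*} [Group H] (f : SL(2, ZMod 5) →* H) (c : H) (hc : c * c = 1)
    (h : ∀ A, f (twist A) = c * f A * c⁻¹)

theorem lift_inl (A : SL(2, ZMod 5)) : lift f c hc h (inl A) = f A :=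
  SemidirectProduct.lift_inl ..

theorem lift_inr : lift f c hc h (inr (-1)) = c :=
  SemidirectProduct.lift_inr ..

end lift

theorem conj_of_generators {M : Type*} [Group M] (f : SL(2, ZMod 5) →* M) (c : M)
    (hT : f (twist slT) = c * f slT * c⁻¹) (hS : f (twist slS) = c * f slS * c⁻¹)
    (A : SL(2, ZMod 5)) : f (twist A) = c * f A * c⁻¹ := by
  have : f.comp twist.toMonoidHom = (MulAut.conj c).toMonoidHom.comp f := sl_hom_ext hT hS
  exact DFunLike.congr_fun this A

theorem closure_generators :
    Subgroup.closure {inl slT, inl slS, inr (-1)} = (⊤ : Subgroup DoubleCover) := by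
  refine eq_top_iff.2 fun x _ => ?_
  rw [← inl_left_mul_inr_right x]
  refine Subgroup.mul_mem _ ?_ ?_
  · have h1 : x.left ∈ (Subgroup.closure {(inl slT : DoubleCover), inl slS, inr (-1)}).comap
        inl := by
      refine (Subgroup.closure_le (K := Subgroup.comap _ _)).2 ?_
        (show x.left ∈ Subgroup.closure {slT, slS} by rw [closure_sl]; trivial)
      rintro y (rfl | rfl)
      · exact Subgroup.subset_closure (by simp)
      · exact Subgroup.subset_closure (by simp)
    exact h1
  · rcases Int.units_eq_one_or x.right with h | h
    · rw [h, map_one]; exact Subgroup.one_mem _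
    · rw [h]; exact Subgroup.subset_closure (by simp)

theorem hom_ext {M : Type*} [Monoid M] {f g : DoubleCover →* M} (hT : f (inl slT) = g (inl slT))
    (hS : f (inl slS) = g (inl slS)) (hc : f (inr (-1)) = g (inr (-1))) : f = g := by
  refine MonoidHom.eq_of_eqOn_dense closure_generators ?_
  rintro x (rfl | rfl | rfl)
  · exact hT
  · exact hS
  · exact hc

/-- The map to `S₅`. -/
def toPerm : DoubleCover →* Equiv.Perm (Fin 5) :=
  lift isModularPair_perm.hom permC (by decide)
    (conj_of_generators _ _ (by decide +kernel) (by decide +kernel))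

/-- The outer involution in the representation over `ℤ/4`. -/
def unitC : GL (Fin 4) (ZMod 4) := ⟨matC, matC, by decide +kernel, by decide +kernel⟩

/-- The representation over `ℤ/4`. -/
def toGL : DoubleCover →* GL (Fin 4) (ZMod 4) :=
  lift isModularPair_mat.hom.toHomUnits unitC (Units.ext (by decide +kernel))
    (conj_of_generators _ _ (Units.ext (by
        change slForm matT matS (twist slT) = matC * slForm matT matS slT * matC
        decide +kernel)) (Units.ext (by
        change slForm matT matS (twist slS) = matC * slForm matT matS slS * matC
        decide +kernel)))

/-- The matrix of an element of the double cover. -/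
def mat (x : DoubleCover) : Matrix (Fin 4) (Fin 4) (ZMod 4) := (toGL x).1

theorem mat_one : mat 1 = 1 := by rw [mat, map_one]; rfl

theorem mat_mul (x y : DoubleCover) : mat (x * y) = mat x * mat y := by rw [mat, map_mul]; rfl

theorem mat_inl (A : SL(2, ZMod 5)) : mat (inl A) = slForm matT matS A := by
  rw [mat, toGL, lift_inl]; rfl

theorem mat_slT : mat (inl slT) = matT := (mat_inl _).trans isModularPair_mat.slForm_slT

theorem mat_slS : mat (inl slS) = matS := (mat_inl _).trans isModularPair_mat.slForm_slS

theorem mat_inr : mat (inr (-1)) = matC := by rw [mat, toGL, lift_inr]; rfl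

theorem toPerm_inl (A : SL(2, ZMod 5)) : toPerm (inl A) = slForm permT permS A := by
  rw [toPerm, lift_inl]; rfl

theorem toPerm_slT : toPerm (inl slT) = permT := (toPerm_inl _).trans isModularPair_perm.slForm_slT

theorem toPerm_slS : toPerm (inl slS) = permS := (toPerm_inl _).trans isModularPair_perm.slForm_slS

theorem toPerm_inr : toPerm (inr (-1)) = permC := by rw [toPerm, lift_inr]

theorem sign_toPerm (x : DoubleCover) : Equiv.Perm.sign (toPerm x) = x.right := by
  have : Equiv.Perm.sign.comp toPerm = rightHom := by
    apply hom_ext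
    · rw [MonoidHom.comp_apply, toPerm_slT]; decide +kernel
    · rw [MonoidHom.comp_apply, toPerm_slS]; decide +kernel
    · rw [MonoidHom.comp_apply, toPerm_inr]; decide +kernel
  exact DFunLike.congr_fun this x

theorem toPerm_surjective : Function.Surjective toPerm := by
  rw [← MonoidHom.range_eq_top, eq_top_iff,
    ← Equiv.Perm.closure_prime_cycle_swap (σ := permT) (τ := permC) (by simpa using Nat.prime_five)
      ⟨0, by decide, fun y _ => ⟨y.val, by rw [zpow_natCast]; revert y; decide⟩⟩
      (by decide +kernel) ⟨2, 4, by decide, rfl⟩,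
    Subgroup.closure_le]
  rintro x (rfl | rfl)
  · exact ⟨_, toPerm_slT⟩
  · exact ⟨_, toPerm_inr⟩

/-- The central subgroup of order `2`. -/
def center (a : ZMod 2) : DoubleCover := if a = 0 then 1 else inl (-1)

theorem normalForm_perm_eq_one (a b c d : ZMod 5) (h : a * d - b * c = 1)
    (h1 : normalForm permT permS a b c d = 1) :
    b = 0 ∧ c = 0 ∧ (a = 1 ∧ d = 1 ∨ a = -1 ∧ d = -1) := by
  revert a b c d; decide +kernel

theorem eq_one_or_neg_one {A : SL(2, ZMod 5)} (h : A 0 1 = 0 ∧ A 1 0 = 0 ∧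
    (A 0 0 = 1 ∧ A 1 1 = 1 ∨ A 0 0 = -1 ∧ A 1 1 = -1)) : A = 1 ∨ A = -1 := by
  obtain ⟨hb, hc, ⟨ha, hd⟩ | ⟨ha, hd⟩⟩ := h
  · left; ext i j; fin_cases i <;> fin_cases j <;> simp [ha, hb, hc, hd]
  · right; ext i j; fin_cases i <;> fin_cases j <;> simp [ha, hb, hc, hd]

theorem eq_center {x : DoubleCover} (hr : x.right = 1) (h : x.left = 1 ∨ x.left = -1) :
    ∃ a, center a = x := by
  rcases h with h | h
  · exact ⟨0, SemidirectProduct.ext h.symm hr.symm⟩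
  · exact ⟨1, SemidirectProduct.ext h.symm hr.symm⟩

theorem toPerm_center (a : ZMod 2) : toPerm (center a) = 1 := by
  unfold center
  split_ifs
  · exact map_one _
  · rw [toPerm_inl]; decide +kernel

theorem toPerm_eq_one_iff (x : DoubleCover) : toPerm x = 1 ↔ ∃ a, center a = x := by
  constructor
  · intro h
    have hr : x.right = 1 := by rw [← sign_toPerm, h, map_one]
    refine eq_center hr (eq_one_or_neg_one (normalForm_perm_eq_one _ _ _ _ (sl_det _) ?_))
    have h1 : x = inl x.left := SemidirectProduct.ext rfl hr
    rw [h1, toPerm_inl] at h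
    exact h
  · rintro ⟨a, rfl⟩
    exact toPerm_center a

end DoubleCover
end BolLoops
namespace BolLoops
namespace DoubleCover

open SemidirectProduct Matrix

/-! ### The map to `PGL(2, 5)` -/

/-- The matrix that induces the outer automorphism of `SL(2, 5)`. -/
def outer : GL (Fin 2) (ZMod 5) := ⟨!![0, 3; 1, 0], !![0, 1; 2, 0], by decide, by decide⟩

theorem mk_outer_sq : ProjGenLinGroup.mk outer * ProjGenLinGroup.mk outer = 1 := by
  let u : (ZMod 5)ˣ := ⟨3, 2, by decide, by decide⟩
  have h : outer * outer = GeneralLinearGroup.scalar (Fin 2) u := Units.ext (by decide)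
  rw [← map_mul, h, ProjGenLinGroup.mk_scalar]

theorem toPGL_twist (A : SL(2, ZMod 5)) : SpecialLinearGroup.toPGL (twist A) =
    ProjGenLinGroup.mk outer * SpecialLinearGroup.toPGL A * (ProjGenLinGroup.mk outer)⁻¹ := by
  have h : SpecialLinearGroup.toGL (twist A) =
      outer * SpecialLinearGroup.toGL A * outer⁻¹ := by
    apply Units.ext
    change (twistFun A).1 = !![0, 3; 1, 0] * A.1 * !![0, 1; 2, 0]
    have h6 : (3 : ZMod 5) * 2 = 1 := by decide
    ext i j
    simp only [Matrix.mul_apply, Fin.sum_univ_two]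
    fin_cases i <;> fin_cases j <;> simp [twistFun]
    · linear_combination -A 1 1 * h6
    · ring
  rw [MonoidHom.comp_apply, MonoidHom.comp_apply, h, map_mul, map_mul, map_inv]

/-- The map to `PGL(2, 5)`. -/
def toPGL : DoubleCover →* PGL(2, ZMod 5) :=
  lift SpecialLinearGroup.toPGL (ProjGenLinGroup.mk outer) mk_outer_sq toPGL_twist

theorem toPGL_inl (A : SL(2, ZMod 5)) :
    toPGL (inl A) = ProjGenLinGroup.mk (SpecialLinearGroup.toGL A) := lift_inl ..

theorem toPGL_inr : toPGL (inr (-1)) = ProjGenLinGroup.mk outer := lift_inr ..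

theorem toPGL_center (a : ZMod 2) : toPGL (center a) = 1 := by
  unfold center
  split_ifs
  · exact map_one _
  · have h : SpecialLinearGroup.toGL (-1 : SL(2, ZMod 5)) =
        GeneralLinearGroup.scalar (Fin 2) (-1) := Units.ext (by decide)
    rw [toPGL_inl, h, ProjGenLinGroup.mk_scalar]

theorem toPGL_eq_one_iff (x : DoubleCover) : toPGL x = 1 ↔ ∃ a, center a = x := by
  constructor
  · intro h
    have hx : x = inl x.left * inr x.right := (inl_left_mul_inr_right x).symm
    have hdet := sl_det x.left
    rcases Int.units_eq_one_or x.right with hr | hr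
    · rw [hx, hr, map_one, mul_one, toPGL_inl, ← map_one ProjGenLinGroup.mk, eq_comm,
        ProjGenLinGroup.mk_eq_mk_iff] at h
      obtain ⟨u, hu⟩ := h
      have h1 : ∀ i j, x.left i j = (GeneralLinearGroup.scalar (Fin 2) u).1 i j := by
        intro i j
        rw [← one_mul (GeneralLinearGroup.scalar (Fin 2) u), hu]; rfl
      have h00 : x.left 0 0 = u := by rw [h1]; simp
      have h01 : x.left 0 1 = 0 := by rw [h1]; simp
      have h10 : x.left 1 0 = 0 := by rw [h1]; simp
      have h11 : x.left 1 1 = u := by rw [h1]; simp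
      refine eq_center hr (eq_one_or_neg_one ⟨h01, h10, ?_⟩)
      rw [h00, h01, h10, h11] at hdet
      rw [h00, h11, and_self, and_self]
      generalize (u : ZMod 5) = v at hdet
      revert v; decide
    · rw [hx, hr, map_mul, toPGL_inl, toPGL_inr, ← map_mul, ← map_one ProjGenLinGroup.mk, eq_comm,
        ProjGenLinGroup.mk_eq_mk_iff] at h
      obtain ⟨u, hu⟩ := h
      have h1 : ∀ i j, (x.left.1 * !![0, 3; 1, 0] : Matrix _ _ (ZMod 5)) i j =
          (GeneralLinearGroup.scalar (Fin 2) u).1 i j := by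
        intro i j
        rw [← one_mul (GeneralLinearGroup.scalar (Fin 2) u), hu]; rfl
      have h00 : x.left 0 1 = u := by simpa [Matrix.mul_apply, Fin.sum_univ_two] using h1 0 0
      have h10 : x.left 1 1 = 0 := by simpa [Matrix.mul_apply, Fin.sum_univ_two] using h1 1 0
      have h11 : x.left 1 0 * 3 = u := by simpa [Matrix.mul_apply, Fin.sum_univ_two] using h1 1 1
      rw [h10, h00, ← h11] at hdet
      exfalso
      generalize x.left 1 0 = v at hdet
      generalize x.left 0 0 = v' at hdet
      revert v v'; decide
  · rintro ⟨a, rfl⟩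
    exact toPGL_center a

/-- Scaling by `u` multiplies the determinant by `u²`. Matrices with square determinant thus come
from `SL(2, 5)`, and `outer`, whose determinant is a nonsquare, accounts for the rest. -/
theorem toPGL_surjective : Function.Surjective toPGL := by
  have key : ∀ (M : GL (Fin 2) (ZMod 5)) (u : ZMod 5), u ^ 2 * M.1.det = 1 →
      ∃ x, toPGL x = ProjGenLinGroup.mk M := by
    intro M u hu
    have hu0 : u ≠ 0 := by rintro rfl; simp at hu
    let A : SL(2, ZMod 5) := ⟨u • M.1, by rw [det_smul, Fintype.card_fin, hu]⟩
    refine ⟨inl A, ?_⟩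
    rw [toPGL_inl, eq_comm, ProjGenLinGroup.mk_eq_mk_iff]
    refine ⟨Units.mk0 u hu0, Units.ext ?_⟩
    change M.1 * Matrix.scalar (Fin 2) u = u • M.1
    ext i j
    simp [mul_comm]
  intro g
  induction g using ProjGenLinGroup.induction_on with
  | mk M =>
    have h0 : M.1.det ≠ 0 := (Matrix.isUnit_iff_isUnit_det _ |>.1 M.isUnit).ne_zero
    have h1 : ∀ e : ZMod 5, e ≠ 0 → ∃ u : ZMod 5, u ^ 2 * e = 1 ∨ u ^ 2 * (e * 3) = 1 := by
      decide
    obtain ⟨u, hu | hu⟩ := h1 _ h0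
    · exact key M u hu
    · obtain ⟨x, hx⟩ := key (M * outer⁻¹) u (by
        have : (outer⁻¹).1.det = 3 := by decide
        rw [Units.val_mul, det_mul, this, hu])
      refine ⟨x * inr (-1), ?_⟩
      rw [map_mul, hx, toPGL_inr, ← map_mul, inv_mul_cancel_right]

/-! ### Commutators in the double cover -/

/-- `T` is the commutator of `diag(2, 3)` and `T²`, and `S = T⁻¹ (S T S⁻¹)⁻¹ T⁻¹`. -/
theorem commutator_sl : commutator SL(2, ZMod 5) = ⊤ := by
  have hT : slT ∈ commutator SL(2, ZMod 5) := by
    let D : SL(2, ZMod 5) := ⟨!![2, 0; 0, 3], by decide⟩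
    have h : slT = D * slT ^ 2 * D⁻¹ * (slT ^ 2)⁻¹ := by decide
    rw [h, commutator_def]
    exact Subgroup.commutator_mem_commutator (Subgroup.mem_top D) (Subgroup.mem_top (slT ^ 2))
  have hL : (slS * slT * slS⁻¹)⁻¹ ∈ commutator SL(2, ZMod 5) :=
    Subgroup.inv_mem _ (Subgroup.Normal.conj_mem inferInstance _ hT _)
  have hS : slS ∈ commutator SL(2, ZMod 5) := by
    have h := Subgroup.mul_mem _ (Subgroup.mul_mem _ (Subgroup.inv_mem _ hT) hL)
      (Subgroup.inv_mem _ hT)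
    convert h using 1
    decide
  rw [eq_top_iff, ← closure_sl, Subgroup.closure_le]
  rintro x (rfl | rfl)
  · exact hT
  · exact hS

theorem inl_mem_commutator (A : SL(2, ZMod 5)) : (inl A : DoubleCover) ∈ commutator DoubleCover := by
  have h : (inl A : DoubleCover) ∈ (commutator SL(2, ZMod 5)).map inl :=
    Subgroup.mem_map_of_mem _ (by rw [commutator_sl]; trivial)
  rw [commutator_def, Subgroup.map_commutator] at h
  exact Subgroup.commutator_mono le_top le_top h

theorem center_comm (a : ZMod 2) (x : DoubleCover) : center a * x = x * center a := by
  unfold center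
  split_ifs
  · rw [one_mul, mul_one]
  · have h : twist (-1) = -1 := by decide
    apply SemidirectProduct.ext
    · rcases Int.units_eq_one_or x.right with hr | hr
      · simp [hr]
      · rw [mul_left, mul_left, left_inl, right_inl, map_one, MulAut.one_apply, hr]
        change -1 * x.left = x.left * twist (-1)
        rw [h]; simp
    · simp

theorem center_add (a b : ZMod 2) : center (a + b) = center a * center b := by
  have h : center 1 * center 1 = 1 := by
    change (inl (-1) : DoubleCover) * inl (-1) = 1
    rw [← map_mul]; simp
  have h2 : ∀ a : ZMod 2, a = 0 ∨ a = 1 := by decide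
  have h0 : center 0 = 1 := rfl
  rcases h2 a with rfl | rfl <;> rcases h2 b with rfl | rfl
  · rw [h0, mul_one]; rfl
  · rw [h0, one_mul, zero_add]
  · rw [h0, mul_one, add_zero]
  · rw [h]; rfl

theorem mat_center_one : mat (center 1) = -1 := by
  change mat (inl (-1)) = -1
  rw [mat_inl]; decide +kernel

theorem mat_center (a : ZMod 2) : mat (center a) = 1 ∨ mat (center a) = -1 := by
  have h2 : ∀ a : ZMod 2, a = 0 ∨ a = 1 := by decide
  rcases h2 a with rfl | rfl
  · exact Or.inl mat_one
  · exact Or.inr mat_center_one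

end DoubleCover
end BolLoops
namespace BolLoops

open SemidirectProduct Matrix DoubleCover

/-! ### The extension -/

/-- The double cover acts on `(ℤ/4) ^ 4`. -/
def actFour : DoubleCover →* MulAut (Multiplicative (Fin 4 → ZMod 4)) :=
  MonoidHom.mk'
    (fun x =>
      { toFun := fun v => Multiplicative.ofAdd (mat x *ᵥ v.toAdd)
        invFun := fun v => Multiplicative.ofAdd (mat x⁻¹ *ᵥ v.toAdd)
        left_inv := fun v => by simp [← mat_mul, mat_one]
        right_inv := fun v => by simp [← mat_mul, mat_one]
        map_mul' := fun v w => by simp [Matrix.mulVec_add] })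
    (fun x y => by
      apply MulEquiv.ext
      intro v
      simp [mat_mul])

/-- The affine group in which the extension lies. -/
abbrev AffineCover : Type := Multiplicative (Fin 4 → ZMod 4) ⋊[actFour] DoubleCover

namespace AffineCover

/-- The translation part. -/
def tr (g : AffineCover) : Fin 4 → ZMod 4 := g.left.toAdd

/-- The element with given parts. -/
def affine (v : Fin 4 → ZMod 4) (x : DoubleCover) : AffineCover := ⟨Multiplicative.ofAdd v, x⟩

theorem tr_affine (v x) : (affine v x).tr = v := rfl

theorem right_affine (v x) : (affine v x).right = x := rfl

theorem tr_one : tr 1 = 0 := rfl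

theorem tr_mul (g h : AffineCover) : (g * h).tr = g.tr + mat g.right *ᵥ h.tr := rfl

theorem tr_inv (g : AffineCover) : g⁻¹.tr = -(mat g.right⁻¹ *ᵥ g.tr) := by
  have h := tr_mul g⁻¹ g
  rw [inv_mul_cancel, tr_one, inv_right] at h
  exact eq_neg_of_add_eq_zero_left h.symm

theorem ext' {g h : AffineCover} (h1 : g.tr = h.tr) (h2 : g.right = h.right) : g = h :=
  SemidirectProduct.ext h1 h2

end AffineCover

open AffineCover

/-- Lifts of six points of `𝔽₂ ^ 4` that the affine group permutes like the projective line. -/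
def hyperoval : Fin 6 → Fin 4 → ZMod 4 :=
  ![![0, 0, 0, 0], ![0, 1, 0, 0], ![1, 0, 0, 1], ![0, 0, 0, 1], ![1, 0, 1, 0], ![0, 1, 1, 0]]

/-- The affine maps that permute the six points modulo `2` in the way that the linear part
prescribes. -/
def extension : Subgroup AffineCover where
  -- The factor `2` turns this into a condition modulo `2`. Over `±1` it leaves exactly the
  -- translations by vectors `v` with `2 v = 0`.
  carrier := {g | ∀ p, (2 : ZMod 4) • (mat g.right *ᵥ hyperoval p + g.tr) =
    (2 : ZMod 4) • hyperoval (act6 (toPerm g.right) p)}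
  one_mem' p := by
    rw [one_right, mat_one, map_one, map_one, tr_one, one_mulVec, add_zero]; rfl
  mul_mem' {g h} hg hh p := by
    have h1 := hg (act6 (toPerm h.right) p)
    rw [smul_add, ← mulVec_smul, ← hh p, mulVec_smul, ← smul_add, mulVec_add] at h1
    rw [mul_right, mat_mul, tr_mul, map_mul, map_mul, Equiv.Perm.mul_apply, ← h1, mulVec_mulVec]
    congr 1
    abel
  inv_mem' {g} hg p := by
    have h1 := hg ((act6 (toPerm g.right))⁻¹ p)
    rw [show act6 (toPerm g.right) ((act6 (toPerm g.right))⁻¹ p) = p by simp] at h1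
    have h2 := congrArg (fun v => mat g.right⁻¹ *ᵥ v) h1
    simp only [mulVec_smul, mulVec_add, mulVec_mulVec, ← mat_mul, inv_mul_cancel, mat_one,
      one_mulVec] at h2
    rw [inv_right, tr_inv, map_inv, map_inv, smul_add, ← h2, ← smul_add]
    congr 1
    abel

theorem mem_extension (g : AffineCover) : g ∈ extension ↔
    ∀ p, (2 : ZMod 4) • (mat g.right *ᵥ hyperoval p + g.tr) =
      (2 : ZMod 4) • hyperoval (act6 (toPerm g.right) p) := Iff.rfl

namespace extension

/-- The outer involution of the extension. -/
theorem affine_inr_mem : affine (hyperoval 5) (inr (-1)) ∈ extension := by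
  rw [mem_extension, right_affine, tr_affine, mat_inr, toPerm_inr]
  decide +kernel

theorem exists_right_eq (x : DoubleCover) : ∃ g : extension, g.1.right = x := by
  have h : x ∈ extension.map rightHom := by
    have hx : x ∈ Subgroup.closure {(inl slT : DoubleCover), inl slS, inr (-1)} := by
      rw [closure_generators]; trivial
    refine (Subgroup.closure_le _).2 ?_ hx
    rintro y (rfl | rfl | rfl)
    -- As `hyperoval 0 = 0`, the translation part is modulo `2` the image of the point `0`. This
    -- gives `0` for `T` and `hyperoval 5` for the other two generators.
    · refine ⟨affine 0 (inl slT), ?_, rfl⟩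
      change _ ∈ extension
      rw [mem_extension, right_affine, tr_affine, mat_slT, toPerm_slT]
      decide +kernel
    · refine ⟨affine (hyperoval 5) (inl slS), ?_, rfl⟩
      change _ ∈ extension
      rw [mem_extension, right_affine, tr_affine, mat_slS, toPerm_slS]
      decide +kernel
    · exact ⟨_, affine_inr_mem, rfl⟩
  obtain ⟨g, hg, rfl⟩ := h
  exact ⟨⟨g, hg⟩, rfl⟩

/-- The projection to the double cover. -/
def toCover : extension →* DoubleCover := rightHom.comp extension.subtype

theorem toCover_surjective : Function.Surjective toCover := exists_right_eq

/-! ### The permutation module in the extension -/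

/-- The embedding of `𝔽₂` in `ℤ/4`. -/
def dbl (a : ZMod 2) : ZMod 4 := 2 * (a.val : ZMod 4)

theorem dbl_add (a b : ZMod 2) : dbl (a + b) = dbl a + dbl b := by
  revert a b; decide

theorem dbl_smul {v w : Fin 4 → ZMod 4} (h : (2 : ZMod 4) • v = (2 : ZMod 4) • w) (a : ZMod 2) :
    dbl a • v = dbl a • w := by
  rw [dbl, mul_comm, mul_smul, mul_smul, h]

theorem dbl_sum (v : Fin 6 → ZMod 2) : ∑ p, dbl (v p) = dbl (∑ p, v p) :=
  (map_sum (AddMonoidHom.mk' dbl dbl_add) v Finset.univ).symm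

/-- The translation part of the element of the permutation module. -/
def doubleSum (v : Fin 6 → ZMod 2) : Fin 4 → ZMod 4 := ∑ p, dbl (v p) • hyperoval p

theorem doubleSum_add (v w : Fin 6 → ZMod 2) :
    doubleSum (v + w) = doubleSum v + doubleSum w := by
  simp only [doubleSum, Pi.add_apply, dbl_add, add_smul, Finset.sum_add_distrib]

theorem two_smul_doubleSum (v : Fin 6 → ZMod 2) : (2 : ZMod 4) • doubleSum v = 0 := by
  have h : ∀ a : ZMod 2, (2 : ZMod 4) * dbl a = 0 := by decide
  simp only [doubleSum, Finset.smul_sum, smul_smul, h, zero_smul, Finset.sum_const_zero]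

theorem neg_eq_of_two_smul {v : Fin 4 → ZMod 4} (h : (2 : ZMod 4) • v = 0) : -v = v := by
  rw [neg_eq_iff_add_eq_zero, ← h, two_smul]

theorem mat_center_mulVec (a : ZMod 2) {v : Fin 4 → ZMod 4} (h : (2 : ZMod 4) • v = 0) :
    mat (center a) *ᵥ v = v := by
  rcases mat_center a with ha | ha
  · rw [ha, one_mulVec]
  · rw [ha, neg_mulVec, one_mulVec, neg_eq_of_two_smul h]

theorem two_smul_two_smul (v : Fin 4 → ZMod 4) : (2 : ZMod 4) • (2 : ZMod 4) • v = 0 := by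
  rw [smul_smul, show (2 : ZMod 4) * 2 = 0 by decide, zero_smul]

theorem affine_mem_extension (a : ZMod 2) (v : Fin 4 → ZMod 4) :
    affine v (center a) ∈ extension ↔ (2 : ZMod 4) • v = 0 := by
  have h : ∀ p, (2 : ZMod 4) • (mat (center a) *ᵥ hyperoval p) = (2 : ZMod 4) • hyperoval p :=
    fun p => by rw [← mulVec_smul, mat_center_mulVec a (two_smul_two_smul _)]
  rw [mem_extension, right_affine, tr_affine, toPerm_center, map_one]
  constructor
  · intro h1
    have h2 := h1 0
    rw [smul_add, h] at h2
    exact add_eq_left.1 h2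
  · intro h1 p
    rw [smul_add, h, h1, add_zero]; rfl

/-- The element of the extension that belongs to a vector of the permutation module. -/
def j (v : Fin 6 → ZMod 2) : extension :=
  ⟨affine (doubleSum v) (center (∑ p, v p)), (affine_mem_extension _ _).2 (two_smul_doubleSum v)⟩

theorem tr_j (v : Fin 6 → ZMod 2) : (j v).1.tr = doubleSum v := rfl

theorem right_j (v : Fin 6 → ZMod 2) : (j v).1.right = center (∑ p, v p) := rfl

theorem j_add (v w : Fin 6 → ZMod 2) : j (v + w) = j v * j w := by
  apply Subtype.ext
  apply ext'
  · rw [Subgroup.coe_mul, tr_mul, tr_j, tr_j, tr_j, right_j, mat_center_mulVec _ (two_smul_doubleSum w), doubleSum_add]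
  · rw [Subgroup.coe_mul, mul_right, right_j, right_j, right_j, ← center_add]
    simp only [Pi.add_apply, Finset.sum_add_distrib]

/-- The only nontrivial affine dependence modulo `2` among the six points is that all of them add up
to zero. -/
theorem doubleSum_eq_zero (v : Fin 6 → ZMod 2) :
    (doubleSum v = 0 ∧ ∑ p, v p = 0) ↔ ∃ a, ∀ p, v p = a := by
  revert v; decide +kernel

theorem exists_doubleSum (u : Fin 4 → ZMod 2) (a : ZMod 2) :
    ∃ v, ∑ p, v p = a ∧ doubleSum v = fun l => dbl (u l) := by
  revert u a; decide +kernel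

theorem center_eq_one_iff (a : ZMod 2) : center a = 1 ↔ a = 0 := by
  constructor
  · intro h
    by_contra h0
    have h1 : center a = inl (-1) := if_neg h0
    rw [h1] at h
    have := congrArg SemidirectProduct.left h
    revert this
    decide
  · rintro rfl; rfl

theorem j_eq_one (v : Fin 6 → ZMod 2) : j v = 1 ↔ ∃ a, ∀ p, v p = a := by
  rw [← doubleSum_eq_zero]
  constructor
  · intro h
    have h : affine (doubleSum v) (center (∑ p, v p)) = 1 := congrArg Subtype.val h
    exact ⟨congrArg tr h, (center_eq_one_iff _).1 (congrArg SemidirectProduct.right h)⟩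
  · rintro ⟨h1, h2⟩
    apply Subtype.ext
    apply ext'
    · exact h1
    · exact (center_eq_one_iff _).2 h2

theorem exists_j_eq {g : extension} {a : ZMod 2} (h : center a = g.1.right) :
    ∃ v, ∑ p, v p = a ∧ j v = g := by
  have h1 : (2 : ZMod 4) • g.1.tr = 0 := by
    have := g.2
    rwa [← (ext' rfl h : affine g.1.tr (center a) = g.1), affine_mem_extension] at this
  have h2 : ∀ b : ZMod 4, 2 * b = 0 → ∃ c, dbl c = b := by decide
  choose u hu using fun l => h2 (g.1.tr l) (congrFun h1 l)
  obtain ⟨v, hv, hvu⟩ := exists_doubleSum u a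
  refine ⟨v, hv, Subtype.ext (ext' (hvu.trans (funext hu)) ?_)⟩
  change center (∑ p, v p) = _
  rw [hv, h]

/-- For odd `v` the affine action on the points contributes twice the translation `t` of `g`. The
same term arises from the linear part `-1` of `j v`, because `t - (-t) = 2 t`; this is why
translations are taken modulo `4`. -/
theorem j_conj (g : extension) (v : Fin 6 → ZMod 2) :
    g * j v * g⁻¹ = j (fun p => v ((act6 (toPerm (toCover g)))⁻¹ p)) := by
  have hsum : ∑ p, v ((act6 (toPerm (toCover g)))⁻¹ p) = ∑ p, v p :=
    Equiv.sum_comp (act6 (toPerm (toCover g)))⁻¹ v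
  rw [mul_inv_eq_iff_eq_mul]
  apply Subtype.ext
  apply ext'
  · rw [Subgroup.coe_mul, Subgroup.coe_mul, tr_mul, tr_mul, tr_j, tr_j, right_j, hsum]
    have h1 : doubleSum (fun p => v ((act6 (toPerm (toCover g)))⁻¹ p)) =
        mat g.1.right *ᵥ doubleSum v + dbl (∑ p, v p) • g.1.tr := by
      have hinv : ∀ p, (act6 (toPerm (toCover g)))⁻¹ (act6 (toPerm (toCover g)) p) = p := by simp
      rw [doubleSum, ← Equiv.sum_comp (act6 (toPerm (toCover g)))]
      have h2 : ∀ p, dbl (v p) • hyperoval (act6 (toPerm (toCover g)) p) =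
          dbl (v p) • (mat g.1.right *ᵥ hyperoval p + g.1.tr) :=
        fun p => (dbl_smul (g.2 p) (v p)).symm
      simp only [hinv, h2, smul_add, Finset.sum_add_distrib, ← Finset.sum_smul, dbl_sum]
      rw [doubleSum, mulVec_sum]
      simp only [mulVec_smul]
    rw [h1, add_comm, add_assoc, add_right_inj]
    have h2 : ∀ a : ZMod 2, a = 0 ∨ a = 1 := by decide
    rcases h2 (∑ p, v p) with h | h
    · rw [h, show dbl 0 = 0 by decide, zero_smul, zero_add,
        show center 0 = 1 from rfl, mat_one, one_mulVec]
    · rw [h, mat_center_one, neg_mulVec, one_mulVec, show dbl 1 = 2 by decide, two_smul,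
        add_neg_cancel_right]
  · rw [Subgroup.coe_mul, Subgroup.coe_mul, mul_right, mul_right, right_j, right_j, hsum,
      center_comm]

end extension
end BolLoops
namespace BolLoops

/-! ### Verification of the axioms for the extension -/

theorem commutator_sup_ker {G : Type*} [Group G] {ρ : G →* Equiv.Perm (Fin 5)}
    (hρ : Function.Surjective ρ) (g : G) :
    g ∈ commutator G ⊔ ρ.ker ↔ Equiv.Perm.sign (ρ g) = 1 := by
  have h : (commutator G).map ρ = alternatingGroup (Fin 5) := by
    rw [← alternatingGroup.commutator_perm_eq (by simp), commutator_def, commutator_def,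
      Subgroup.map_commutator, Subgroup.map_top_of_surjective ρ hρ]
  rw [← Subgroup.comap_map_eq, h, Subgroup.mem_comap, Equiv.Perm.mem_alternatingGroup]

theorem isComplement_zpowers {G : Type*} [Group G] {ρ : G →* Equiv.Perm (Fin 5)}
    (hρ : Function.Surjective ρ) {c : G} (hc : c * c = 1)
    (hρc : Equiv.Perm.sign (ρ c) = -1) :
    Subgroup.IsComplement' (commutator G ⊔ ρ.ker) (Subgroup.zpowers c) := by
  have hmem : ∀ x ∈ Subgroup.zpowers c, x = 1 ∨ x = c := by
    rintro x ⟨n, rfl⟩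
    rcases Int.even_or_odd' n with ⟨m, rfl | rfl⟩
    · left; simp [zpow_mul, zpow_ofNat, sq, hc]
    · right; simp [zpow_add, zpow_mul, zpow_ofNat, sq, hc]
  refine Subgroup.isComplement'_of_disjoint_and_mul_eq_univ ?_ ?_
  · rw [Subgroup.disjoint_def]
    intro x hx hx'
    rw [commutator_sup_ker hρ] at hx
    rcases hmem x hx' with rfl | rfl
    · rfl
    · rw [hρc] at hx
      exact absurd hx (by decide)
  · refine Set.eq_univ_iff_forall.2 fun g => ?_
    rcases Int.units_eq_one_or (Equiv.Perm.sign (ρ g)) with h | h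
    · exact ⟨g, (commutator_sup_ker hρ g).2 h, 1, Subgroup.one_mem _, mul_one g⟩
    · refine ⟨g * c, (commutator_sup_ker hρ _).2 ?_, c, Subgroup.mem_zpowers c, ?_⟩
      · rw [map_mul, map_mul, h, hρc]; decide
      · simp only [mul_assoc, hc, mul_one]

namespace extension

open DoubleCover

/-- The map of the extension onto `S₅`. -/
def toPerm : extension →* Equiv.Perm (Fin 5) := DoubleCover.toPerm.comp toCover

theorem toPerm_surjective : Function.Surjective toPerm :=
  DoubleCover.toPerm_surjective.comp toCover_surjective

theorem mem_ker_iff (x : extension) : toPerm x = 1 ↔ ∃ v, j v = x := by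
  rw [toPerm, MonoidHom.comp_apply, toPerm_eq_one_iff]
  constructor
  · rintro ⟨a, ha⟩
    obtain ⟨v, -, hv⟩ := exists_j_eq ha
    exact ⟨v, hv⟩
  · rintro ⟨v, rfl⟩
    exact ⟨_, rfl⟩

theorem card_ker : Nat.card toPerm.ker = 32 := by
  let f : {v : Fin 6 → ZMod 2 // v 0 = 0} → toPerm.ker :=
    fun v => ⟨j v.1, (mem_ker_iff _).2 ⟨_, rfl⟩⟩
  have hf : Function.Bijective f := by
    constructor
    · intro v w h
      have h1 : j v.1 = j w.1 := congrArg Subtype.val h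
      have h2 : j (v.1 + w.1) = 1 := by
        rw [j_add, h1, ← j_add, CharTwo.add_self_eq_zero]
        exact (j_eq_one 0).2 ⟨0, fun _ => rfl⟩
      obtain ⟨a, ha⟩ := (j_eq_one _).1 h2
      have h0 := ha 0
      rw [Pi.add_apply, v.2, w.2, add_zero] at h0
      apply Subtype.ext
      funext p
      exact CharTwo.add_eq_zero.1 ((ha p).trans h0.symm)
    · rintro ⟨x, hx⟩
      obtain ⟨v, rfl⟩ := (mem_ker_iff x).1 hx
      refine ⟨⟨v + fun _ => v 0, CharTwo.add_self_eq_zero _⟩, Subtype.ext ?_⟩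
      change j (v + fun _ => v 0) = j v
      rw [j_add, (j_eq_one _).2 ⟨v 0, fun _ => rfl⟩, mul_one]
  rw [← Nat.card_eq_of_bijective f hf, Nat.card_eq_fintype_card]
  decide +kernel

theorem mem_J₀_iff (x : extension) : x ∈ J₀ toPerm.ker ↔ ∃ v, ∑ p, v p = 0 ∧ j v = x :=
  mem_commutator_iff_even toPerm_surjective j_add j_conj mem_ker_iff x

theorem right_toCover_of_mem_commutator {x : extension} (hx : x ∈ commutator extension) :
    (toCover x).right = 1 := by
  have h : commutator extension ≤ (SemidirectProduct.rightHom.comp toCover).ker :=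
    Abelianization.commutator_subset_ker _
  exact h hx

/-- The map of the commutator subgroup of the extension onto `SL(2, 5)`. -/
def commutatorToSL : commutator extension →* SL(2, ZMod 5) where
  toFun x := (toCover x).left
  map_one' := by simp
  map_mul' x y := by
    rw [Subgroup.coe_mul, map_mul, SemidirectProduct.mul_left,
      right_toCover_of_mem_commutator x.2, map_one, MulAut.one_apply]

theorem commutatorToSL_surjective : Function.Surjective commutatorToSL := by
  intro A
  have h : (commutator extension).map toCover = commutator DoubleCover := by
    rw [commutator_def, commutator_def, Subgroup.map_commutator,
      Subgroup.map_top_of_surjective _ toCover_surjective]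
  have hA := inl_mem_commutator A
  rw [← h] at hA
  obtain ⟨x, hx, hxA⟩ := hA
  refine ⟨⟨x, hx⟩, ?_⟩
  change (toCover x).left = A
  rw [hxA]; rfl

/-- An element over `1` in the double cover is `j v` with `center (∑ v) = 1`, that is, with `v`
even. -/
theorem ker_commutatorToSL :
    commutatorToSL.ker = (J₀ toPerm.ker).subgroupOf (commutator extension) := by
  ext x
  rw [MonoidHom.mem_ker, Subgroup.mem_subgroupOf, mem_J₀_iff]
  have hr := right_toCover_of_mem_commutator x.2
  constructor
  · intro hx
    have hx : (toCover x).left = 1 := hx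
    exact exists_j_eq (a := 0) (SemidirectProduct.ext hx.symm hr.symm)
  · rintro ⟨v, hv, hvx⟩
    change (toCover x).left = 1
    have h1 : toCover x = center 0 := by
      rw [← hvx, ← hv]; rfl
    rw [h1]; rfl

theorem exists_outer_involution : ∃ c : extension, c * c = 1 ∧
    Equiv.Perm.sign (toPerm c) = -1 := by
  refine ⟨⟨_, affine_inr_mem⟩, Subtype.ext (AffineCover.ext' ?_ ?_), ?_⟩
  · rw [Subgroup.coe_mul, AffineCover.tr_mul, AffineCover.right_affine, AffineCover.tr_affine,
      mat_inr]
    decide +kernel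
  · rw [Subgroup.coe_mul, SemidirectProduct.mul_right, AffineCover.right_affine, ← map_mul]
    rfl
  · exact sign_toPerm _

/-- The extension has the required structure. -/
theorem isNonsplitS5Extension : IsNonsplitS5Extension toPerm.ker where
  normal := inferInstance
  card := card_ker
  comm x hx y hy := by
    obtain ⟨v, rfl⟩ := (mem_ker_iff x).1 hx
    obtain ⟨w, rfl⟩ := (mem_ker_iff y).1 hy
    rw [← j_add, ← j_add, add_comm]
  sq x hx := by
    obtain ⟨v, rfl⟩ := (mem_ker_iff x).1 hx
    rw [sq, ← j_add, CharTwo.add_self_eq_zero]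
    exact (j_eq_one 0).2 ⟨0, fun _ => rfl⟩
  perm_module := by
    let π : extension →* PGL(2, ZMod 5) := toPGL.comp toCover
    have hπ : Function.Surjective π := toPGL_surjective.comp toCover_surjective
    have hker : π.ker = toPerm.ker := by
      ext x
      exact (toPGL_eq_one_iff _).trans (toPerm_eq_one_iff _).symm
    let _ : MulAction extension (ℙ (ZMod 5) (Fin 2 → ZMod 5)) := MulAction.compHom _ π
    have hsm : ∀ (g : extension) (x : ℙ (ZMod 5) (Fin 2 → ZMod 5)), g • x = π g • x :=
      fun _ _ => rfl
    have _ : MulAction.IsPretransitive extension (ℙ (ZMod 5) (Fin 2 → ZMod 5)) := by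
      refine ⟨fun x y => ?_⟩
      obtain ⟨s, hs⟩ := MulAction.exists_smul_eq PGL(2, ZMod 5) x y
      obtain ⟨g, rfl⟩ := hπ s
      exact ⟨g, hs⟩
    obtain ⟨ε, hε⟩ := exists_equiv_fin_six card_projectiveLine toPerm toPerm_surjective (by
      intro g hg x
      have : g ∈ π.ker := by rw [hker]; exact hg
      rw [hsm, MonoidHom.mem_ker.1 this, one_smul])
    refine ⟨π, hπ, hker, AddMonoidHom.mk'
      (fun v => Additive.ofMul ⟨j fun p => v (ε.symm p), (mem_ker_iff _).2 ⟨_, rfl⟩⟩)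
      fun v w => Subtype.ext (j_add _ _), ?_, ?_, ?_⟩
    · intro x
      obtain ⟨v, hv⟩ := (mem_ker_iff _).1 x.toMul.2
      refine ⟨fun p => v (ε p), Subtype.ext (Eq.trans ?_ hv)⟩
      change j (fun p => v (ε (ε.symm p))) = j v
      simp only [Equiv.apply_symm_apply]
    · intro v
      have h1 := j_eq_one fun p => v (ε.symm p)
      have h2 : (∃ a, ∀ p, v (ε.symm p) = a) ↔ ∃ a, ∀ p, v p = a :=
        exists_congr fun a => ε.symm.forall_congr_right (q := fun p => v p = a)
      rw [← h2, ← h1]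
      exact Subtype.ext_iff
    · intro g v
      change j (fun p => v ((π g)⁻¹ • ε.symm p)) = g * j (fun p => v (ε.symm p)) * g⁻¹
      rw [j_conj]
      have : ∀ p, (π g)⁻¹ • ε.symm p = ε.symm ((act6 (toPerm g))⁻¹ p) := by
        intro p
        rw [← map_inv, ← hsm, Equiv.eq_symm_apply, hε, map_inv, map_inv, Equiv.apply_symm_apply]
      simp only [this]
      rfl
  quotient_SL := ⟨commutatorToSL, commutatorToSL_surjective, ker_commutatorToSL⟩
  splits := by
    obtain ⟨c, hc, hρc⟩ := exists_outer_involution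
    exact ⟨_, isComplement_zpowers toPerm_surjective hc hρc⟩

end extension
end BolLoops
namespace BolLoops

/-! ### The modules `T` and the isomorphism `ψ` -/

/-- One of the two diagonal submodules for the normalizer of the first Sylow `5`-subgroup. -/
def diagonal : Submodule (ZMod 2) U where
  carrier := {u | u.2 = fiveCycle 0 • u.1 + (fiveCycle 0) ^ 4 • u.1}
  add_mem' {u v} hu hv := by
    change (u + v).2 = _ • (u + v).1 + _ • (u + v).1
    rw [U.add_fst, U.add_snd, hu, hv, smul_add, smul_add, add_add_add_comm]
  zero_mem' := by
    change (0 : U).2 = _ • (0 : U).1 + _ • (0 : U).1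
    rw [U.zero_fst, U.zero_snd, smul_zero, smul_zero, add_zero]
  smul_mem' r u hu := by
    have h : r = 0 ∨ r = 1 := by revert r; decide
    rcases h with rfl | rfl
    · rw [zero_smul]
      change (0 : U).2 = _ • (0 : U).1 + _ • (0 : U).1
      rw [U.zero_fst, U.zero_snd, smul_zero, smul_zero, add_zero]
    · rwa [one_smul]

theorem mem_diagonal {u : U} :
    u ∈ diagonal ↔ u.2 = fiveCycle 0 • u.1 + (fiveCycle 0) ^ 4 • u.1 := Iff.rfl

instance : DecidablePred (· ∈ diagonal) := fun _ => decidable_of_iff' _ mem_diagonal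

/-- The first component of the map from the permutation module to the diagonal submodule. -/
def toDiagonalFst (v : Fin 6 → ZMod 2) : N :=
  -- `1, 3, 5, 4, 2` is the cyclic order in which `act6 (fiveCycle 0)` moves the five points other
  -- than `0`. Adding a shifted copy makes the coordinate sum zero.
  ⟨fun x => v ((![1, 3, 5, 4, 2] : Fin 5 → Fin 6) x) +
    v ((![1, 3, 5, 4, 2] : Fin 5 → Fin 6) (x + 3)), by
    have h := Equiv.sum_comp (Equiv.addRight (3 : Fin 5))
      (fun x => v ((![1, 3, 5, 4, 2] : Fin 5 → Fin 6) x))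
    refine Finset.sum_add_distrib.trans ((congrArg (_ + ·) h).trans ?_)
    exact CharTwo.add_self_eq_zero _⟩

/-- The map from the permutation module to the diagonal submodule. -/
def toDiagonal (v : Fin 6 → ZMod 2) : U :=
  U.mk (toDiagonalFst v) (fiveCycle 0 • toDiagonalFst v + (fiveCycle 0) ^ 4 • toDiagonalFst v)

theorem toDiagonal_mem (v : Fin 6 → ZMod 2) : toDiagonal v ∈ diagonal := rfl

theorem toDiagonalFst_add (v w : Fin 6 → ZMod 2) :
    toDiagonalFst (v + w) = toDiagonalFst v + toDiagonalFst w :=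
  Subtype.ext (funext fun _ => add_add_add_comm _ _ _ _)

theorem toDiagonal_add (v w : Fin 6 → ZMod 2) :
    toDiagonal (v + w) = toDiagonal v + toDiagonal w := by
  apply U.ext
  · exact toDiagonalFst_add v w
  · rw [U.add_snd, toDiagonal, toDiagonal, toDiagonal, U.mk_snd, U.mk_snd, U.mk_snd,
      toDiagonalFst_add, smul_add, smul_add, add_add_add_comm]

/-- Equivariance is needed only under the stabilizer of the point `0`, which is `F₂₀`. Over `A₅` the
operator `annihilator` distinguishes `J₀` from the submodules of `U`. -/
theorem toDiagonal_perm6 (σ : Equiv.Perm (Fin 5)) (hσ : act6 σ 0 = 0) (v : Fin 6 → ZMod 2)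
    (hv : ∑ p, v p = 0) : toDiagonal (perm6 σ v) = σ • toDiagonal v := by
  revert σ v; decide +kernel

theorem toDiagonal_eq_zero (v : Fin 6 → ZMod 2) (hv : ∑ p, v p = 0) :
    toDiagonal v = 0 ↔ ∃ a, ∀ p, v p = a := by
  revert v; decide +kernel

theorem exists_toDiagonal (u : U) (hu : u ∈ diagonal) : ∃ v, ∑ p, v p = 0 ∧ toDiagonal v = u := by
  have h : ∀ n : N, ∃ v, ∑ p, v p = 0 ∧ toDiagonalFst v = n := by decide +kernel
  obtain ⟨v, hv, hvn⟩ := h u.1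
  refine ⟨v, hv, U.ext hvn ?_⟩
  rw [mem_diagonal.1 hu, toDiagonal, U.mk_snd, hvn]

theorem smul_mem_diagonal (σ : Equiv.Perm (Fin 5)) (hσ : act6 σ 0 = 0) {u : U}
    (hu : u ∈ diagonal) : σ • u ∈ diagonal := by
  obtain ⟨v, hv, rfl⟩ := exists_toDiagonal u hu
  rw [← toDiagonal_perm6 σ hσ v hv]
  exact toDiagonal_mem _

theorem diagonal_ne : diagonal ≠ ⊥ ∧ diagonal ≠ ⊤ ∧ diagonal ≠ U.W := by
  have h1 : ∃ u, u ∈ diagonal ∧ u ∉ U.W ∧ u ≠ 0 := by decide +kernel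
  have h2 : ∃ u, u ∉ diagonal := by decide +kernel
  obtain ⟨u, hu, huW, hu0⟩ := h1
  obtain ⟨u', hu'⟩ := h2
  refine ⟨fun h => hu0 ?_, fun h => hu' ?_, fun h => huW (h ▸ hu)⟩
  · rwa [h, Submodule.mem_bot] at hu
  · rw [h]; trivial

section

variable {G : Type*} [Group G] {J : Subgroup G} {ρ : G →* Equiv.Perm (Fin 5)}

theorem act6_fiveCycle_eq (i p : Fin 6) (h : act6 (fiveCycle i) p = p) : p = i := by
  revert i p; decide +kernel

/-- Conjugation moves the fixed point of a Sylow normalizer to `0`, the point for which `diagonal`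
is defined. -/
theorem ExtData.exists_sylow (E : ExtData J ρ) : ∃ P : Sylow 5 G,
    ∀ h ∈ Subgroup.normalizer (P : Set G), act6 (ρ h) 0 = 0 := by
  obtain ⟨P⟩ : Nonempty (Sylow 5 G) := inferInstance
  obtain ⟨i, -, y, hy, hρy⟩ := E.exists_isPointNormalizer P
  obtain ⟨σ, hσ⟩ := act6_transitive i 0
  obtain ⟨g, rfl⟩ := E.surj σ
  obtain ⟨i', A, -⟩ := E.exists_isPointNormalizer (g • P)
  have hy' : g * y * g⁻¹ ∈ Subgroup.normalizer ((g • P : Sylow 5 G) : Set G) := by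
    refine Subgroup.le_normalizer ?_
    rw [Sylow.coe_subgroup_smul, ← MulAut.conj_apply]
    exact Subgroup.smul_mem_pointwise_smul _ _ _ hy
  have h1 := A.fix _ hy'
  simp only [map_mul, map_inv, hρy, Equiv.Perm.mul_apply] at h1
  have h2 : act6 (fiveCycle i) ((act6 (ρ g))⁻¹ i') = (act6 (ρ g))⁻¹ i' := by
    rw [Equiv.Perm.eq_inv_iff_eq, h1]
  have h3 : i' = 0 := by
    rw [← hσ, ← act6_fiveCycle_eq _ _ h2]; simp
  refine ⟨g • P, fun h hh => ?_⟩
  have := A.fix h hh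
  rwa [h3] at this

theorem ExtData.exists_iso (E : ExtData J ρ) : ∃ ψ : Additive (J₀ J) ≃+ diagonal,
    ∀ g, act6 (ρ g) 0 = 0 → ∀ v v' : J₀ J, (v' : G) = g * v * g⁻¹ →
      (ψ (Additive.ofMul v') : U) = ρ g • (ψ (Additive.ofMul v) : U) := by
  choose s hs hjs using fun x : J₀ J => (E.mem_J₀ x).1 x.2
  have hadd : ∀ v w : Fin 6 → ZMod 2, ∑ p, v p = 0 → ∑ p, w p = 0 → ∑ p, (v + w) p = 0 := by
    intro v w hv hw
    simp only [Pi.add_apply, Finset.sum_add_distrib, hv, hw, add_zero]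
  -- An element of `J₀` has two even representatives, which differ by a constant; `toDiagonal` does
  -- not see the choice.
  have hs' : ∀ (x : J₀ J) v, ∑ p, v p = 0 → E.j v = x → toDiagonal (s x) = toDiagonal v := by
    intro x v hv hvx
    have h1 := (toDiagonal_eq_zero _ (hadd _ _ (hs x) hv)).2
      ((E.j_eq_iff _ _).1 ((hjs x).trans hvx.symm))
    rw [toDiagonal_add] at h1
    rw [← add_left_inj (toDiagonal v), h1, U.add_self]
  let f : Additive (J₀ J) →+ diagonal := AddMonoidHom.mk'
    (fun x => ⟨toDiagonal (s x.toMul), toDiagonal_mem _⟩) (by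
      intro x y
      apply Subtype.ext
      refine (hs' (x.toMul * y.toMul) (s x.toMul + s y.toMul) (hadd _ _ (hs _) (hs _)) ?_).trans
        (toDiagonal_add _ _)
      rw [E.j_add, hjs, hjs]; rfl)
  have hf : Function.Bijective f := by
    constructor
    · rw [injective_iff_map_eq_zero]
      intro x hx
      have h1 : toDiagonal (s x.toMul) = 0 := congrArg Subtype.val hx
      have h2 := (E.j_eq_one _).2 ((toDiagonal_eq_zero _ (hs _)).1 h1)
      rw [hjs] at h2
      exact Subtype.ext h2
    · rintro ⟨u, hu⟩
      obtain ⟨v, hv, rfl⟩ := exists_toDiagonal u hu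
      exact ⟨Additive.ofMul ⟨E.j v, (E.mem_J₀ _).2 ⟨v, hv, rfl⟩⟩,
        Subtype.ext (hs' _ v hv rfl)⟩
  refine ⟨AddEquiv.ofBijective f hf, fun g hg v v' h => ?_⟩
  change toDiagonal (s v') = ρ g • toDiagonal (s v)
  rw [← toDiagonal_perm6 _ hg _ (hs v)]
  refine hs' _ _ ((Equiv.sum_comp (act6 (ρ g))⁻¹ (s v)).trans (hs v)) ?_
  rw [h, ← hjs v, E.j_conj]; rfl

end

/-! ### Simple Bol loops of order `96 · 16 ^ k` -/

theorem exists_simple_bol_loop (k : ℕ) (hk : 1 ≤ k) : ∃ (Q : Type) (_ : Loop Q),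
    Loop.IsBol Q ∧ Loop.HasExponent Q 2 ∧ Loop.IsSimple Q ∧ Nat.card Q = 96 * 16 ^ k := by
  have hG := extension.isNonsplitS5Extension
  have hρ := extension.toPerm_surjective
  obtain ⟨E⟩ := hG.nonempty_extData hρ rfl
  obtain ⟨c, hc, hρc⟩ := extension.exists_outer_involution
  obtain ⟨P, hP⟩ := E.exists_sylow
  obtain ⟨ψ, hψ⟩ := E.exists_iso
  have hc1 : c ≠ 1 := by
    rintro rfl
    rw [map_one, map_one] at hρc
    exact absurd hρc (by decide)
  obtain ⟨-, F, h1, h2, h3, h4⟩ := isLoopFolder_bigK hG P (c := c)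
    (orderOf_eq_prime (by rw [sq, hc]) hc1) (by
      rw [commutator_sup_ker hρ, hρc]; decide) hρ rfl
    (fun h hh u hu => smul_mem_diagonal _ (hP h hh) hu) diagonal_ne.2.1 diagonal_ne.2.2 ψ
    (fun h hh => hψ h (hP h hh)) (⟨0, hk⟩ : Fin k)
  exact ⟨F.Q, inferInstance, h1, h2, h3, h4⟩

end BolLoops

open BolLoops in
theorem mainTheorem3 :
    (∀ (G : Type*) [Group G] (J : Subgroup G) (_ : IsNonsplitS5Extension J)
      (P : Sylow 5 G)
      (c : G) (_ : orderOf c = 2) (_ : c ∉ commutator G ⊔ J)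
      (ρ : G →* Equiv.Perm (Fin 5)) (_ : Function.Surjective ρ) (hρ : ρ.ker = J)
      (T : Submodule (ZMod 2) U)
      (_ : ∀ h ∈ Subgroup.normalizer (P : Set G), ∀ u ∈ T, ρ h • u ∈ T)
      (_ : T ≠ ⊥) (_ : T ≠ ⊤) (_ : T ≠ U.W)
      (ψ : Additive (J₀ J) ≃+ T)
      (_ : ∀ h ∈ Subgroup.normalizer (P : Set G), ∀ v v' : J₀ J, (v' : G) = h * v * h⁻¹ →
        (ψ (Additive.ofMul v') : U) = ρ h • (ψ (Additive.ofMul v) : U))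
      (k : ℕ) (_ : 1 ≤ k) (i : Fin k),
      IsUnionOfInvolutionClasses (bigK ρ c J i) ∧
      ∃ F : IsLoopFolder (bigH (Subgroup.normalizer (P : Set G)) hρ i ψ) (bigK ρ c J i),
        Loop.IsBol F.Q ∧ Loop.HasExponent F.Q 2 ∧ Loop.IsSimple F.Q ∧
          Nat.card F.Q = 96 * 16 ^ k) ∧
    (∀ k : ℕ, 1 ≤ k → ∃ (Q : Type) (_ : Loop Q),
      Loop.IsBol Q ∧ Loop.HasExponent Q 2 ∧ Loop.IsSimple Q ∧ Nat.card Q = 96 * 16 ^ k) := by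
  exact ⟨fun G _ J hG P c hc hcJ ρ hρ hρJ T hT _ hT1 hTW ψ hψ k _ i =>
      isLoopFolder_bigK hG P hc hcJ hρ hρJ hT hT1 hTW ψ hψ i,
    exists_simple_bol_loop⟩
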